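/- \textbf{Setting.} All vector spaces are complex, $\otimes$ between $C^*$-algebras is the spatial (minimal) tensor product, and $\odot$ is the algebraic one. A \emph{$C^*$-hyperbialgebra} $(\mathsf A,\Delta,\epsilon)$ is a unital $C^*$-algebra $\mathsf A$ with a unital completely positive map $\Delta:\mathsf A\to\mathsf A\otimes\mathsf A$ and a character $\epsilon:\mathsf A\to\mathbb C$ such that $(\Delta\otimes\mathrm{id})\circ\Delta=(\mathrm{id}\otimes\Delta)\circ\Delta$ and $(\epsilon\otimes\mathrm{id})\circ\Delta=(\mathrm{id}\otimes\epsilon)\circ\Delta=\mathrm{id}_{\mathsf A}$. Let $\mathsf k$ be a Hilbert space. For an interval $I\subseteq\mathbb R_+$ let $\mathcal F_I$ be the symmetric Fock space over $L^2(I;\mathsf k)$, with exponential vectors $\varepsilon(f)$, and put $\mathcal F=\mathcal F_{\mathbb R_+}$; let $\mathbb S=\mathrm{Lin}\{d_{[0,s[}:d\in\mathsf k,\ s\ge 0\}$, $\mathcal E=\mathrm{Lin}\{\varepsilon(f):f\in\mathbb S\}$ and $\mathcal E_{[0,t[}=\mathrm{Lin}\{\varepsilon(f|_{[0,t[}):f\in\mathbb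 S\}\subseteq\mathcal F_{[0,t[}$. Identify $\mathcal F=\mathcal F_{[0,t[}\otimes\mathcal F_{[t,\infty[}$, and let $\sigma=(\sigma_s)_{s\ge0}$ be the CCR flow on $B(\mathcal F)$: $\sigma_s(X)=I_{[0,s[}\otimes X'$, where $X'\in B(\mathcal F_{[s,\infty[})$ is the conjugate of $X$ by the second quantised shift $\mathcal F\to\mathcal F_{[s,\infty[}$. A \emph{completely bounded process} on a unital $C^*$-algebra $\mathsf A$ is a family $l=(l_t)_{t\ge0}$ of completely bounded linear maps $l_t:\mathsf A\to B(\mathcal F)$ such that, for each $a\in\mathsf A$, $t\mapsto l_t(a)\xi$ is weakly measurable for all $\xi\in\mathcal E$, and $l(a)$ is adapted: for each $t$ there is a linear map $X(t):\mathcal E_{[0,t[}\to\mathcal F_{[0,t[}$ with $l_t(a)\varepsilon(f)=X(t)\varepsilon(f|_{[0,t[})\otimes\varepsilon(f|_{[t,\infty[})$ for $f\in\mathbb S$. If $\mathsf A$ carries $(\Delta,\epsilon)$, then $l$ has the \emph{convolution increment property} if $l_{s+t}=(l_s\otimes(\sigma_s\circ l_t))\circ\Delta$ for all $s,t\ge0$,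 and $l$ is a \emph{QS convolution cocycle} on $\mathsf A$ if moreover $l_0(a)=\epsilon(a)I_{\mathcal F}$ for all $a\in\mathsf A$. \textbf{Statement.} Let $(\mathsf A,\Delta,\epsilon)$ be a $C^*$-hyperbialgebra, let $\widetilde{\mathsf A}\subseteq\mathsf A$ be a unital $C^*$-subalgebra, and let $P$ be a conditional expectation, that is, a norm-one projection, from $\mathsf A$ onto $\widetilde{\mathsf A}$ such that \[(P\otimes\mathrm{id}_{\mathsf A})\circ\Delta\circ P=(P\otimes P)\circ\Delta=(\mathrm{id}_{\mathsf A}\otimes P)\circ\Delta .\] Put $\widetilde\Delta=(P\otimes P)\circ\Delta|_{\widetilde{\mathsf A}}$ and $\widetilde\epsilon=\epsilon|_{\widetilde{\mathsf A}}$. Then $(\widetilde{\mathsf A},\widetilde\Delta,\widetilde\epsilon)$ is a $C^*$-hyperbialgebra, and $\widetilde l\mapsto(\widetilde l_t\circ P)_{t\ge0}$ is a bijection from the set of QS convolution cocycles $\widetilde l$ on $\widetilde{\mathsf A}$ (with noise dimension space $\mathsf k$) onto the set of completely bounded processes $l$ on $\mathsf A$ that are $P$-invariant ($l_t\circ P=l_t$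 for all $t\geq 0$), have the convolution increment property, and satisfy $l_0(a)=\epsilon(P(a))I_{\mathcal F}$ for all $a\in\mathsf A$. Its inverse is the restriction $l\mapsto(l_t|_{\widetilde{\mathsf A}})_{t\ge0}$. -/

import Mathlib

open scoped TensorProduct NNReal InnerProductSpace
open MeasureTheory

noncomputable section

/-! ## Hilbert space tensor products -/

section HilbertTensor

/-- The Hilbert space tensor product: the completion of the algebraic tensor product. -/
def HilbertTensor (H K : Type*) [NormedAddCommGroup H] [InnerProductSpace ℂ H]
    [NormedAddCommGroup K] [InnerProductSpace ℂ K] :=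
  UniformSpace.Completion (H ⊗[ℂ] K)

variable {H H' K K' : Type*} [NormedAddCommGroup H] [InnerProductSpace ℂ H]
  [NormedAddCommGroup K] [InnerProductSpace ℂ K]
  [NormedAddCommGroup H'] [InnerProductSpace ℂ H']
  [NormedAddCommGroup K'] [InnerProductSpace ℂ K']

instance : NormedAddCommGroup (HilbertTensor H K) :=
  inferInstanceAs (NormedAddCommGroup (UniformSpace.Completion (H ⊗[ℂ] K)))

instance : InnerProductSpace ℂ (HilbertTensor H K) :=
  inferInstanceAs (InnerProductSpace ℂ (UniformSpace.Completion (H ⊗[ℂ] K)))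

instance : CompleteSpace (HilbertTensor H K) :=
  inferInstanceAs (CompleteSpace (UniformSpace.Completion (H ⊗[ℂ] K)))

/-- The isometric embedding of the algebraic tensor product. -/
def HilbertTensor.ofAlg : H ⊗[ℂ] K →ₗᵢ[ℂ] HilbertTensor H K :=
  (UniformSpace.Completion.toComplₗᵢ : H ⊗[ℂ] K →ₗᵢ[ℂ] UniformSpace.Completion (H ⊗[ℂ] K))

theorem HilbertTensor.denseRange_ofAlg :
    DenseRange (HilbertTensor.ofAlg : H ⊗[ℂ] K → HilbertTensor H K) :=
  UniformSpace.Completion.denseRange_coe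

/-- The elementary tensor `x ⊗ y` in the Hilbert space tensor product. -/
def hTmul (x : H) (y : K) : HilbertTensor H K := HilbertTensor.ofAlg (x ⊗ₜ[ℂ] y)

/-- The tensor product `T ⊗ S` of bounded operators. -/
def opTensor (T : H →L[ℂ] H') (S : K →L[ℂ] K') : HilbertTensor H K →L[ℂ] HilbertTensor H' K' :=
  ((TensorProduct.mapL T S).completion :
    UniformSpace.Completion (H ⊗[ℂ] K) →L[ℂ] UniformSpace.Completion (H' ⊗[ℂ] K'))

theorem opTensor_ofAlg (T : H →L[ℂ] H') (S : K →L[ℂ] K') (x : H ⊗[ℂ] K) :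
    opTensor T S (HilbertTensor.ofAlg x) = HilbertTensor.ofAlg (TensorProduct.mapL T S x) :=
  ContinuousLinearMap.completion_apply_coe _ _

theorem inner_hTmul (x x' : H) (y y' : K) :
    ⟪hTmul x y, hTmul x' y'⟫_ℂ = ⟪x, x'⟫_ℂ * ⟪y, y'⟫_ℂ := by
  simp [hTmul]

theorem opTensor_hTmul (T : H →L[ℂ] H') (S : K →L[ℂ] K') (x : H) (y : K) :
    opTensor T S (hTmul x y) = hTmul (T x) (S y) := by
  simp [hTmul, opTensor_ofAlg]

/-- Two bounded operators that agree on algebraic tensors are equal. -/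
theorem HilbertTensor.clm_ext {f g : HilbertTensor H K →L[ℂ] HilbertTensor H' K'}
    (h : ∀ x : H ⊗[ℂ] K, f (HilbertTensor.ofAlg x) = g (HilbertTensor.ofAlg x)) : f = g := by
  ext x
  exact HilbertTensor.denseRange_ofAlg.induction_on (p := fun x => f x = g x) x
    (isClosed_eq f.continuous g.continuous) h

theorem opTensor_add_left (T T' : H →L[ℂ] H') (S : K →L[ℂ] K') :
    opTensor (T + T') S = opTensor T S + opTensor T' S :=
  HilbertTensor.clm_ext fun x => by
    simp [opTensor_ofAlg, TensorProduct.mapL_add_left, -TensorProduct.mapL_apply]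

theorem opTensor_add_right (T : H →L[ℂ] H') (S S' : K →L[ℂ] K') :
    opTensor T (S + S') = opTensor T S + opTensor T S' :=
  HilbertTensor.clm_ext fun x => by
    simp [opTensor_ofAlg, TensorProduct.mapL_add_right, -TensorProduct.mapL_apply]

theorem opTensor_smul_left (c : ℂ) (T : H →L[ℂ] H') (S : K →L[ℂ] K') :
    opTensor (c • T) S = c • opTensor T S :=
  HilbertTensor.clm_ext fun x => by
    simp [opTensor_ofAlg, TensorProduct.mapL_smul_left, -TensorProduct.mapL_apply]

theorem opTensor_smul_right (c : ℂ) (T : H →L[ℂ] H') (S : K →L[ℂ] K') :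
    opTensor T (c • S) = c • opTensor T S :=
  HilbertTensor.clm_ext fun x => by
    simp [opTensor_ofAlg, TensorProduct.mapL_smul_right, -TensorProduct.mapL_apply]

/-- If `v` has dense span in `H` and `w` has dense span in `K`, then the vectors `v i ⊗ w j` have
dense span in the Hilbert space tensor product. -/
theorem hTmul_total {ι κ : Type*} {v : ι → H} {w : κ → K}
    (hv : (Submodule.span ℂ (Set.range v)).topologicalClosure = ⊤)
    (hw : (Submodule.span ℂ (Set.range w)).topologicalClosure = ⊤) :
    (Submodule.span ℂ (Set.range fun p : ι × κ => hTmul (v p.1) (w p.2))).topologicalClosure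
      = ⊤ := by
  set S := (Submodule.span ℂ (Set.range fun p : ι × κ => hTmul (v p.1) (w p.2))).topologicalClosure
    with hS
  have hclosed : IsClosed (S : Set (HilbertTensor H K)) := Submodule.isClosed_topologicalClosure _
  let L (x : H) : K →L[ℂ] HilbertTensor H K :=
    HilbertTensor.ofAlg.toContinuousLinearMap.comp (TensorProduct.mkL ℂ H K x)
  let R (y : K) : H →L[ℂ] HilbertTensor H K :=
    HilbertTensor.ofAlg.toContinuousLinearMap.comp ((TensorProduct.mkL ℂ H K).flip y)
  have hL : ∀ x y, L x y = hTmul x y := fun x y => rfl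
  have hR : ∀ x y, R y x = hTmul x y := fun x y => rfl
  have h1 : ∀ i (y : K), hTmul (v i) y ∈ S := by
    intro i
    have : (⊤ : Submodule ℂ K) ≤ S.comap (L (v i)).toLinearMap := by
      rw [← hw]
      refine Submodule.topologicalClosure_minimal _ ?_ (hclosed.preimage (L (v i)).continuous)
      rw [Submodule.span_le]
      rintro _ ⟨j, rfl⟩
      exact Submodule.le_topologicalClosure _ (Submodule.subset_span ⟨(i, j), rfl⟩)
    intro y
    exact this (Submodule.mem_top (x := y))
  have h2 : ∀ (x : H) (y : K), hTmul x y ∈ S := by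
    intro x y
    have : (⊤ : Submodule ℂ H) ≤ S.comap (R y).toLinearMap := by
      rw [← hv]
      refine Submodule.topologicalClosure_minimal _ ?_ (hclosed.preimage (R y).continuous)
      rw [Submodule.span_le]
      rintro _ ⟨i, rfl⟩
      exact h1 i y
    exact this (Submodule.mem_top (x := x))
  rw [eq_top_iff]
  rintro x -
  refine HilbertTensor.denseRange_ofAlg.induction_on (p := fun x => x ∈ S) x hclosed fun x => ?_
  induction x using TensorProduct.induction_on with
  | zero => rw [map_zero]; exact S.zero_mem
  | tmul x y => exact h2 x y
  | add x y hx hy => rw [map_add]; exact S.add_mem hx hy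

/-- Two families with the same Gram matrix, the first of which has dense span, are related by a
linear isometry. -/
theorem exists_isometry_of_gram {ι : Type*} [CompleteSpace K] {v : ι → H} {w : ι → K}
    (hv : (Submodule.span ℂ (Set.range v)).topologicalClosure = ⊤)
    (h : ∀ i j, ⟪w i, w j⟫_ℂ = ⟪v i, v j⟫_ℂ) : ∃ V : H →ₗᵢ[ℂ] K, ∀ i, V (v i) = w i := by
  let e : (ι →₀ ℂ) →ₗ[ℂ] H := Finsupp.linearCombination ℂ v
  let f : (ι →₀ ℂ) →ₗ[ℂ] K := Finsupp.linearCombination ℂ w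
  have hd : DenseRange e := by
    have : (Set.range e) = (Submodule.span ℂ (Set.range v) : Set H) := by
      rw [← Finsupp.range_linearCombination]; rfl
    rw [DenseRange, this]
    exact (Submodule.dense_iff_topologicalClosure_eq_top).2 hv
  have hn : ∀ x, ‖f x‖ = ‖e x‖ := by
    intro x
    have : ⟪f x, f x⟫_ℂ = ⟪e x, e x⟫_ℂ := by
      simp only [e, f, Finsupp.linearCombination_apply, Finsupp.sum, sum_inner, inner_sum,
        inner_smul_left, inner_smul_right, h]
    rw [@norm_eq_sqrt_re_inner ℂ, @norm_eq_sqrt_re_inner ℂ, this]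
  have hb : ∃ C, ∀ x, ‖f x‖ ≤ C * ‖e x‖ := ⟨1, fun x => by rw [hn, one_mul]⟩
  let T := f.extendOfNorm e
  refine ⟨⟨T.toLinearMap, ?_⟩, ?_⟩
  · intro x
    refine hd.induction_on (p := fun x => ‖T x‖ = ‖x‖) x
      (isClosed_eq (by fun_prop) (by fun_prop)) ?_
    intro y
    rw [LinearMap.extendOfNorm_eq hd hb, hn]
  · intro i
    have := LinearMap.extendOfNorm_eq hd hb (Finsupp.single i 1)
    simpa [e, f, T] using this

end HilbertTensor

/-! ## Symmetric Fock space -/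

section Fock

universe u

/-- A bundled complex Hilbert space. -/
structure HilbertBundle : Type (u + 1) where
  carrier : Type u
  [normedAddCommGroup : NormedAddCommGroup carrier]
  [innerProductSpace : InnerProductSpace ℂ carrier]
  [completeSpace : CompleteSpace carrier]

attribute [instance] HilbertBundle.normedAddCommGroup HilbertBundle.innerProductSpace
  HilbertBundle.completeSpace

variable (K : Type u) [NormedAddCommGroup K] [InnerProductSpace ℂ K]

/-- The Hilbert space tensor powers `K^{⊗ n}`; the zeroth power is a copy of `ℂ`. -/
def hilbertPowBundle : ℕ → HilbertBundle.{u}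
  | 0 => ⟨EuclideanSpace ℂ PUnit.{u + 1}⟩
  | n + 1 => ⟨HilbertTensor K (hilbertPowBundle n).carrier⟩

/-- The `n`-fold Hilbert space tensor power of `K`. -/
abbrev HilbertPow (n : ℕ) : Type u := (hilbertPowBundle K n).carrier

variable {K}

/-- The diagonal tensor `f ⊗ ⋯ ⊗ f` in `K^{⊗ n}`. -/
def diagTensor (f : K) : ∀ n : ℕ, HilbertPow K n
  | 0 => (EuclideanSpace.single PUnit.unit (1 : ℂ) : EuclideanSpace ℂ PUnit.{u + 1})
  | n + 1 => (hTmul f (diagTensor f n) : HilbertTensor K (HilbertPow K n))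

theorem inner_diagTensor (f g : K) (n : ℕ) :
    ⟪diagTensor f n, diagTensor g n⟫_ℂ = ⟪f, g⟫_ℂ ^ n := by
  induction n with
  | zero =>
    change ⟪(EuclideanSpace.single PUnit.unit (1 : ℂ) : EuclideanSpace ℂ PUnit.{u + 1}),
      EuclideanSpace.single PUnit.unit (1 : ℂ)⟫_ℂ = _
    simp
  | succ n ih =>
    change ⟪hTmul f (diagTensor f n), hTmul g (diagTensor g n)⟫_ℂ = _
    rw [inner_hTmul, ih, pow_succ']

theorem diagTensor_smul (z : ℂ) (f : K) (n : ℕ) :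
    diagTensor (z • f) n = z ^ n • diagTensor f n := by
  induction n with
  | zero => rw [pow_zero, one_smul]; rfl
  | succ n ih =>
    change hTmul (z • f) (diagTensor (z • f) n) = z ^ (n + 1) • hTmul f (diagTensor f n)
    rw [ih]
    simp only [hTmul, ← map_smul, TensorProduct.smul_tmul', TensorProduct.tmul_smul, smul_smul,
      pow_succ]

variable (K) in
/-- The `n`-th symmetric power of `K`: the closed span of the diagonal tensors in `K^{⊗ n}`. -/
def symPow (n : ℕ) : Submodule ℂ (HilbertPow K n) :=
  (Submodule.span ℂ (Set.range fun f : K => diagTensor f n)).topologicalClosure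

instance (n : ℕ) : CompleteSpace (symPow K n) :=
  (Submodule.isClosed_topologicalClosure _).completeSpace_coe

/-- `diagTensor` as an element of the symmetric power. -/
def symTensor (f : K) (n : ℕ) : symPow K n :=
  ⟨diagTensor f n, Submodule.le_topologicalClosure _ (Submodule.subset_span ⟨f, rfl⟩)⟩

theorem inner_symTensor (f g : K) (n : ℕ) :
    ⟪symTensor f n, symTensor g n⟫_ℂ = ⟪f, g⟫_ℂ ^ n := inner_diagTensor f g n

variable (K) in
/-- The symmetric Fock space over `K`: the Hilbert space direct sum of the symmetric powers. -/
def Fock : Type u := lp (fun n => symPow K n) 2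

instance : NormedAddCommGroup (Fock K) :=
  inferInstanceAs (NormedAddCommGroup (lp (fun n => symPow K n) 2))

instance : InnerProductSpace ℂ (Fock K) :=
  inferInstanceAs (InnerProductSpace ℂ (lp (fun n => symPow K n) 2))

instance : CompleteSpace (Fock K) :=
  inferInstanceAs (CompleteSpace (lp (fun n => symPow K n) 2))

/-- The exponential vector `ε(f)`, with components `(n!)^{-1/2} f ⊗ ⋯ ⊗ f`. -/
def expVecLp (f : K) : lp (fun n => symPow K n) 2 :=
  ⟨fun n => (((Real.sqrt (n.factorial : ℝ))⁻¹ : ℝ) : ℂ) • symTensor f n, by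
    refine memℓp_gen ?_
    have := Real.summable_pow_div_factorial (‖f‖ ^ 2)
    refine this.congr fun n => ?_
    have h1 : ‖symTensor f n‖ ^ 2 = (‖f‖ ^ 2) ^ n := by
      have := inner_symTensor f f n
      rw [inner_self_eq_norm_sq_to_K, inner_self_eq_norm_sq_to_K] at this
      exact_mod_cast this
    have h2 : (2 : ENNReal).toReal = ((2 : ℕ) : ℝ) := by simp
    rw [h2, Real.rpow_natCast, norm_smul, mul_pow, h1, Complex.norm_real, norm_inv, inv_pow,
      Real.norm_of_nonneg (Real.sqrt_nonneg _), Real.sq_sqrt (by positivity)]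
    field_simp⟩

theorem expVecLp_apply (f : K) (n : ℕ) :
    expVecLp f n = (((Real.sqrt (n.factorial : ℝ))⁻¹ : ℝ) : ℂ) • symTensor f n := rfl

theorem inner_expVecLp (f g : K) : ⟪expVecLp f, expVecLp g⟫_ℂ = Complex.exp ⟪f, g⟫_ℂ := by
  rw [lp.inner_eq_tsum, Complex.exp_eq_exp_ℂ, NormedSpace.exp_eq_tsum_div]
  refine tsum_congr fun n => ?_
  have h : ((Real.sqrt (n.factorial : ℝ) : ℝ) : ℂ) * (Real.sqrt (n.factorial : ℝ) : ℝ)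
      = (n.factorial : ℂ) := by
    rw [← Complex.ofReal_mul, Real.mul_self_sqrt (by positivity)]; simp
  have h0 : ((Real.sqrt (n.factorial : ℝ) : ℝ) : ℂ) ≠ 0 := by
    intro h'
    rw [h', zero_mul] at h
    exact (Nat.cast_ne_zero.2 n.factorial_ne_zero) h.symm
  rw [expVecLp_apply, expVecLp_apply, inner_smul_left, inner_smul_right, inner_symTensor,
    Complex.conj_ofReal, ← h, Complex.ofReal_inv]
  field_simp

/-- The exponential vectors have dense span in the Fock space. -/
theorem expVecLp_total :
    (Submodule.span ℂ (Set.range (expVecLp : K → lp (fun n => symPow K n) 2))).topologicalClosure = ⊤ := by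
  rw [Submodule.topologicalClosure_eq_top_iff, Submodule.eq_bot_iff]
  intro x hx
  have hx' : ∀ f : K, ⟪x, expVecLp f⟫_ℂ = 0 := fun f => by
    rw [← inner_conj_symm, hx _ (Submodule.subset_span ⟨f, rfl⟩), map_zero]
  have key : ∀ (f : K) (n : ℕ), ⟪x n, symTensor f n⟫_ℂ = 0 := by
    intro f n
    let c : ℕ → ℂ := fun n => ⟪x n, expVecLp f n⟫_ℂ
    have hs : ∀ z : ℂ, HasSum (fun n => z ^ n • c n) 0 := by
      intro z
      have := lp.hasSum_inner (𝕜 := ℂ) (G := fun n => symPow K n) x (expVecLp (z • f))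
      rw [hx'] at this
      refine this.congr_fun fun n => ?_
      have : symTensor (z • f) n = z ^ n • symTensor f n := Subtype.ext (diagTensor_smul z f n)
      simp only [c, expVecLp_apply, this, inner_smul_right, smul_eq_mul]
      ring
    have hp : HasFPowerSeriesAt (0 : ℂ → ℂ) (FormalMultilinearSeries.ofScalars ℂ c) 0 := by
      rw [hasFPowerSeriesAt_iff]
      refine Filter.Eventually.of_forall fun z => ?_
      simpa [FormalMultilinearSeries.coeff_ofScalars] using hs z
    have hc : c n = 0 := by
      have := congrArg (fun p => FormalMultilinearSeries.coeff p n) hp.eq_zero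
      rw [FormalMultilinearSeries.coeff_ofScalars] at this
      simpa [FormalMultilinearSeries.coeff] using this
    simp only [c, expVecLp_apply, inner_smul_right, mul_eq_zero] at hc
    refine hc.resolve_left ?_
    rw [← ne_eq, Complex.ofReal_ne_zero]
    positivity
  ext n : 2
  have hle : symPow K n ≤ (ℂ ∙ (x n : HilbertPow K n))ᗮ := by
    refine Submodule.topologicalClosure_minimal _ ?_ (Submodule.isClosed_orthogonal _)
    rw [Submodule.span_le]
    rintro _ ⟨f, rfl⟩
    rw [SetLike.mem_coe, Submodule.mem_orthogonal_singleton_iff_inner_right]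
    exact key f n
  have := Submodule.mem_orthogonal_singleton_iff_inner_right.1 (hle (x n).2)
  exact inner_self_eq_zero.1 this

/-- The exponential vector `ε(f)` in the Fock space. -/
def expVec (f : K) : Fock K := expVecLp f

theorem inner_expVec (f g : K) : ⟪expVec f, expVec g⟫_ℂ = Complex.exp ⟪f, g⟫_ℂ :=
  inner_expVecLp f g

/-- The exponential vectors have dense span in the Fock space. -/
theorem expVec_total :
    (Submodule.span ℂ (Set.range (expVec : K → Fock K))).topologicalClosure = ⊤ :=
  expVecLp_total

/-- For isometries `i : K₁ → K` and `j : K₂ → K` with orthogonal ranges, the isometry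
`Fock K₁ ⊗ Fock K₂ → Fock K` that sends `ε(f) ⊗ ε(g)` to `ε(i f + j g)`. -/
theorem exists_fockJoin {K₁ K₂ K : Type*} [NormedAddCommGroup K₁] [InnerProductSpace ℂ K₁]
    [NormedAddCommGroup K₂] [InnerProductSpace ℂ K₂] [NormedAddCommGroup K]
    [InnerProductSpace ℂ K] (i : K₁ →ₗᵢ[ℂ] K) (j : K₂ →ₗᵢ[ℂ] K)
    (hij : ∀ f g, ⟪i f, j g⟫_ℂ = 0) :
    ∃ V : HilbertTensor (Fock K₁) (Fock K₂) →ₗᵢ[ℂ] Fock K,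
      ∀ f g, V (hTmul (expVec f) (expVec g)) = expVec (i f + j g) := by
  have hji : ∀ f g, ⟪j g, i f⟫_ℂ = 0 := fun f g => by rw [← inner_conj_symm, hij, map_zero]
  obtain ⟨V, hV⟩ := exists_isometry_of_gram
    (w := fun p : K₁ × K₂ => expVec (i p.1 + j p.2)) (hTmul_total expVec_total expVec_total)
    (by
      rintro ⟨f, g⟩ ⟨f', g'⟩
      simp [inner_hTmul, inner_expVec, hij, hji, Complex.exp_add])
  exact ⟨V, fun f g => hV (f, g)⟩

/-- The isometry `Fock K₁ ⊗ Fock K₂ → Fock K` determined by `ε(f) ⊗ ε(g) ↦ ε(i f + j g)`. -/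
def fockJoin {K₁ K₂ K : Type*} [NormedAddCommGroup K₁] [InnerProductSpace ℂ K₁]
    [NormedAddCommGroup K₂] [InnerProductSpace ℂ K₂] [NormedAddCommGroup K]
    [InnerProductSpace ℂ K] (i : K₁ →ₗᵢ[ℂ] K) (j : K₂ →ₗᵢ[ℂ] K)
    (hij : ∀ f g, ⟪i f, j g⟫_ℂ = 0) :
    HilbertTensor (Fock K₁) (Fock K₂) →ₗᵢ[ℂ] Fock K :=
  (exists_fockJoin i j hij).choose

theorem fockJoin_apply {K₁ K₂ K : Type*} [NormedAddCommGroup K₁] [InnerProductSpace ℂ K₁]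
    [NormedAddCommGroup K₂] [InnerProductSpace ℂ K₂] [NormedAddCommGroup K]
    [InnerProductSpace ℂ K] (i : K₁ →ₗᵢ[ℂ] K) (j : K₂ →ₗᵢ[ℂ] K)
    (hij : ∀ f g, ⟪i f, j g⟫_ℂ = 0) (f : K₁) (g : K₂) :
    fockJoin i j hij (hTmul (expVec f) (expVec g)) = expVec (i f + j g) :=
  (exists_fockJoin i j hij).choose_spec f g

end Fock

/-! ## Noise space, test functions, adaptedness and the CCR flow -/

section Noise

variable (k : Type*) [NormedAddCommGroup k] [InnerProductSpace ℂ k]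

/-- `L²(I; k)`, as the subspace of `L²(ℝ; k)` of the functions that vanish a.e. outside `I`. -/
def L2on (I : Set ℝ) : Submodule ℂ (Lp k 2 (volume : Measure ℝ)) where
  carrier := {f | ∀ᵐ r : ℝ, r ∉ I → f r = 0}
  zero_mem' := by
    filter_upwards [Lp.coeFn_zero k 2 (volume : Measure ℝ)] with r hr _
    rw [hr]; rfl
  add_mem' := by
    intro f g hf hg
    filter_upwards [hf, hg, Lp.coeFn_add f g] with r h1 h2 h3 hr
    rw [h3, Pi.add_apply, h1 hr, h2 hr, add_zero]
  smul_mem' := by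
    intro c f hf
    filter_upwards [hf, Lp.coeFn_smul c f] with r h1 h2 hr
    rw [h2, Pi.smul_apply, h1 hr, smul_zero]

variable {k}

theorem L2on_mono {I J : Set ℝ} (h : I ⊆ J) : L2on k I ≤ L2on k J := by
  intro f (hf : ∀ᵐ r : ℝ, r ∉ I → f r = 0)
  change ∀ᵐ r : ℝ, r ∉ J → f r = 0
  filter_upwards [hf] with r hr hJ
  exact hr fun hI => hJ (h hI)

theorem inner_L2on_eq_zero {I J : Set ℝ} (h : Disjoint I J) {f g : Lp k 2 (volume : Measure ℝ)}
    (hf : f ∈ L2on k I) (hg : g ∈ L2on k J) : ⟪f, g⟫_ℂ = 0 := by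
  rw [L2.inner_def]
  refine integral_eq_zero_of_ae ?_
  filter_upwards [hf, hg] with r h1 h2
  by_cases hr : r ∈ I
  · rw [h2 (Set.disjoint_left.1 h hr), inner_zero_right]; rfl
  · rw [h1 hr, inner_zero_left]; rfl

/-- The inclusion `L²(I; k) ⊆ L²(J; k)` for `I ⊆ J`. -/
def L2on.incl {I J : Set ℝ} (h : I ⊆ J) : L2on k I →ₗᵢ[ℂ] L2on k J :=
  ⟨Submodule.inclusion (L2on_mono h), fun _ => rfl⟩

/-- The restriction `f ↦ f_I` of functions on `ℝ` to `I`. -/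
def L2on.restrict {I : Set ℝ} (hI : MeasurableSet I) :
    Lp k 2 (volume : Measure ℝ) →ₗ[ℂ] L2on k I where
  toFun f := ⟨((Lp.memLp f).indicator hI).toLp, by
    filter_upwards [((Lp.memLp f).indicator hI).coeFn_toLp] with r hr hrI
    rw [hr, Set.indicator_of_notMem hrI]⟩
  map_add' f g := by
    refine Subtype.ext (Lp.ext ?_)
    refine ((Lp.memLp (f + g)).indicator hI).coeFn_toLp.trans ?_
    refine Filter.EventuallyEq.trans ?_ (Lp.coeFn_add _ _).symm
    filter_upwards [((Lp.memLp f).indicator hI).coeFn_toLp,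
      ((Lp.memLp g).indicator hI).coeFn_toLp, Lp.coeFn_add f g] with r h1 h2 h3
    rw [Pi.add_apply, h1, h2]
    by_cases hr : r ∈ I
    · rw [Set.indicator_of_mem hr, Set.indicator_of_mem hr, Set.indicator_of_mem hr, h3]; rfl
    · rw [Set.indicator_of_notMem hr, Set.indicator_of_notMem hr, Set.indicator_of_notMem hr,
        add_zero]
  map_smul' c f := by
    refine Subtype.ext (Lp.ext ?_)
    refine ((Lp.memLp (c • f)).indicator hI).coeFn_toLp.trans ?_
    refine Filter.EventuallyEq.trans ?_ (Lp.coeFn_smul _ _).symm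
    filter_upwards [((Lp.memLp f).indicator hI).coeFn_toLp, Lp.coeFn_smul c f] with r h1 h3
    rw [Pi.smul_apply, h1]
    by_cases hr : r ∈ I
    · rw [Set.indicator_of_mem hr, Set.indicator_of_mem hr, h3]; rfl
    · rw [Set.indicator_of_notMem hr, Set.indicator_of_notMem hr]; exact (smul_zero c).symm

theorem L2on.inner_incl {I J T : Set ℝ} (hI : I ⊆ T) (hJ : J ⊆ T) (h : Disjoint I J)
    (f : L2on k I) (g : L2on k J) : ⟪L2on.incl hI f, L2on.incl hJ g⟫_ℂ = 0 :=
  (Submodule.coe_inner _ _ _).trans (inner_L2on_eq_zero h f.2 g.2)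

theorem disjoint_Ico_Ici (t : ℝ) : Disjoint (Set.Ico 0 t) (Set.Ici t) :=
  Set.disjoint_left.2 fun _ hr hr' => not_lt.2 hr' hr.2

/-- Translation by `s` on `L²(ℝ; k)`: `f ↦ f(· - s)`. -/
def L2translate (s : ℝ) :
    Lp k 2 (volume : Measure ℝ) →ₗᵢ[ℂ] Lp k 2 (volume : Measure ℝ) :=
  Lp.compMeasurePreservingₗᵢ ℂ (fun r : ℝ => r - s) (measurePreserving_sub_right volume s)

theorem L2translate_mem (s : ℝ≥0) {f : Lp k 2 (volume : Measure ℝ)} (hf : f ∈ L2on k (Set.Ici 0)) :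
    L2translate s f ∈ L2on k (Set.Ici (s : ℝ)) := by
  have h1 : L2translate (s : ℝ) f =ᵐ[volume] fun r => f (r - s) :=
    Lp.coeFn_compMeasurePreserving f (measurePreserving_sub_right volume (s : ℝ))
  have h2 : ∀ᵐ r : ℝ, r - s ∉ Set.Ici (0 : ℝ) → f (r - s) = 0 :=
    (measurePreserving_sub_right volume (s : ℝ)).quasiMeasurePreserving.ae hf
  change ∀ᵐ r : ℝ, r ∉ Set.Ici (s : ℝ) → L2translate (s : ℝ) f r = 0
  filter_upwards [h1, h2] with r hr1 hr2 hr
  rw [hr1]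
  refine hr2 fun h => hr ?_
  simpa using h

/-- The right shift by `s ≥ 0`, as an isometry from `L²(ℝ₊; k)` to `L²([s,∞[; k)`. -/
def L2on.shift (s : ℝ≥0) : L2on k (Set.Ici 0) →ₗᵢ[ℂ] L2on k (Set.Ici (s : ℝ)) :=
  ⟨(L2translate (k := k) s).toLinearMap.restrict fun _ hf => L2translate_mem s hf,
    fun f => (L2translate (k := k) s).norm_map f⟩

variable (k)

/-- The span of the functions `d_{[0,s[}`, for `d ∈ k` and `s ≥ 0`. -/
def stepSpan : Submodule ℂ (Lp k 2 (volume : Measure ℝ)) :=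
  Submodule.span ℂ (Set.range fun p : k × ℝ≥0 =>
    indicatorConstLp 2 (measurableSet_Ico (a := (0 : ℝ)) (b := (p.2 : ℝ)))
      (measure_Ico_lt_top).ne p.1)

variable {k} in
/-- The exponential domain over `I`: the span of the exponential vectors `ε(f_I)` of the
restrictions to `I` of the step functions `f`. -/
def expDomain {I : Set ℝ} (hI : MeasurableSet I) : Submodule ℂ (Fock (L2on k I)) :=
  Submodule.span ℂ ((fun f => expVec (L2on.restrict hI f)) '' (stepSpan k : Set _))

/-- The exponential vector `ε(f_I)` of a step function `f`, as an element of the domain. -/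
def expDomain.mk {I : Set ℝ} (hI : MeasurableSet I) (f : stepSpan k) :
    expDomain (k := k) hI :=
  ⟨expVec (L2on.restrict hI f), Submodule.subset_span ⟨f, f.2, rfl⟩⟩

/-- The symmetric Fock space over `L²(ℝ₊; k)`. -/
abbrev FockSpace := Fock (L2on k (Set.Ici 0))

/-- The space of test vectors `ℰ = Lin {ε(f) : f ∈ 𝕊}` in the Fock space over `L²(ℝ₊; k)`, where
`𝕊 = Lin {d_{[0,s[}}`. -/
abbrev TestSpace : Submodule ℂ (FockSpace k) :=
  expDomain (k := k) (measurableSet_Ici (a := (0 : ℝ)))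

/-- The identification of `ℱ_{[0,t[} ⊗ ℱ_{[t,∞[}` with `ℱ`. -/
def fockSplit (t : ℝ≥0) :
    HilbertTensor (Fock (L2on k (Set.Ico 0 (t : ℝ)))) (Fock (L2on k (Set.Ici (t : ℝ)))) →ₗᵢ[ℂ]
      FockSpace k :=
  fockJoin (L2on.incl Set.Ico_subset_Ici_self) (L2on.incl (Set.Ici_subset_Ici.2 t.2))
    (L2on.inner_incl _ _ (disjoint_Ico_Ici _))

/-- The identification of `ℱ_{[0,s[} ⊗ ℱ` with `ℱ = ℱ_{[0,s[} ⊗ ℱ_{[s,∞[}` by means of the second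
quantised shift: `ε(f) ⊗ ε(g) ↦ ε(f + g(· - s))`. -/
def fockShift (s : ℝ≥0) :
    HilbertTensor (Fock (L2on k (Set.Ico 0 (s : ℝ)))) (FockSpace k) →ₗᵢ[ℂ] FockSpace k :=
  fockJoin (L2on.incl Set.Ico_subset_Ici_self)
    ((L2on.incl (Set.Ici_subset_Ici.2 s.2)).comp (L2on.shift s))
    fun f g => L2on.inner_incl Set.Ico_subset_Ici_self (Set.Ici_subset_Ici.2 s.2)
      (disjoint_Ico_Ici _) f (L2on.shift s g)

variable {k} in
/-- The CCR flow `σ_s` on `B(ℱ)`: `σ_s(X) = I_{[0,s[} ⊗ (shift of X)`. -/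
def ccrFlow (s : ℝ≥0) (X : FockSpace k →L[ℂ] FockSpace k) : FockSpace k →L[ℂ] FockSpace k :=
  (fockShift k s).toContinuousLinearMap ∘L
    opTensor (ContinuousLinearMap.id ℂ (Fock (L2on k (Set.Ico 0 (s : ℝ))))) X ∘L
      ContinuousLinearMap.adjoint (fockShift k s).toContinuousLinearMap

/-- An operator process: a family `X = (X_t)_{t ≥ 0}` of operators in the Fock space with domain
`ℰ` that is weakly measurable in `t` and adapted: `X_t ε(f) = X(t) ε(f_{[0,t[}) ⊗ ε(f_{[t,∞[})` for
some operator `X(t)` in `ℱ_{[0,t[}` with domain `ℰ_{[0,t[}`. -/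
structure IsOperatorProcess (X : ℝ≥0 → TestSpace k →ₗ[ℂ] FockSpace k) : Prop where
  weakly_measurable : ∀ (ξ : TestSpace k) (ζ : FockSpace k),
    Measurable fun t => ⟪ζ, X t ξ⟫_ℂ
  adapted : ∀ t : ℝ≥0,
    ∃ Y : expDomain (k := k) (measurableSet_Ico (a := (0 : ℝ)) (b := (t : ℝ))) →ₗ[ℂ]
        Fock (L2on k (Set.Ico 0 (t : ℝ))),
      ∀ f : stepSpan k,
        X t (expDomain.mk k measurableSet_Ici f) =
          fockSplit k t (hTmul (Y (expDomain.mk k measurableSet_Ico f))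
            (expVec (L2on.restrict measurableSet_Ici f)))

end Noise

/-! ## C⋆-algebras: complete positivity, complete boundedness, spatial tensor products -/

section CStar

open scoped CStarAlgebra

/-- Complete positivity of a linear map of C⋆-algebras (with their canonical orders). -/
def IsCompletelyPositive {A B : Type*} [CStarAlgebra A] [CStarAlgebra B] (φ : A →ₗ[ℂ] B) : Prop :=
  letI := CStarAlgebra.spectralOrder A
  letI := CStarAlgebra.spectralOrder B
  haveI := CStarAlgebra.spectralOrderedRing A
  haveI := CStarAlgebra.spectralOrderedRing B
  ∃ ψ : A →CP B, ∀ a, ψ a = φ a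

/-- Complete boundedness of a linear map of C⋆-algebras: the amplifications to `n × n` matrices
are bounded uniformly in `n`. -/
def IsCompletelyBounded {A B : Type*} [CStarAlgebra A] [CStarAlgebra B] (φ : A →ₗ[ℂ] B) : Prop :=
  letI := CStarAlgebra.spectralOrder A
  letI := CStarAlgebra.spectralOrder B
  haveI := CStarAlgebra.spectralOrderedRing A
  haveI := CStarAlgebra.spectralOrderedRing B
  ∃ C : ℝ, ∀ (n : ℕ) (M : CStarMatrix (Fin n) (Fin n) A), ‖M.map φ‖ ≤ C * ‖M‖

variable {A B C D H K L M : Type*} [CStarAlgebra A] [CStarAlgebra B] [CStarAlgebra C]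
  [CStarAlgebra D]
  [NormedAddCommGroup H] [InnerProductSpace ℂ H] [CompleteSpace H]
  [NormedAddCommGroup K] [InnerProductSpace ℂ K] [CompleteSpace K]
  [NormedAddCommGroup L] [InnerProductSpace ℂ L] [CompleteSpace L]
  [NormedAddCommGroup M] [InnerProductSpace ℂ M] [CompleteSpace M]

/-- The spatial tensor product `A ⊗ B` of C⋆-algebras that are represented (faithfully) by `π` on
`H` and by `ρ` on `K`: the C⋆-subalgebra of `B(H ⊗ K)` generated by the operators
`π(a) ⊗ ρ(b)`. -/
def spatialTensor (π : A →⋆ₐ[ℂ] (H →L[ℂ] H)) (ρ : B →⋆ₐ[ℂ] (K →L[ℂ] K)) :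
    StarSubalgebra ℂ (HilbertTensor H K →L[ℂ] HilbertTensor H K) :=
  (StarAlgebra.adjoin ℂ
    (Set.range fun p : A × B => opTensor (π p.1) (ρ p.2))).topologicalClosure

instance (π : A →⋆ₐ[ℂ] (H →L[ℂ] H)) (ρ : B →⋆ₐ[ℂ] (K →L[ℂ] K)) :
    CStarAlgebra (spatialTensor π ρ) :=
  StarSubalgebra.cstarAlgebra _ (h_closed := StarSubalgebra.isClosed_topologicalClosure _)

namespace spatialTensor

/-- The algebraic tensor product `A ⊙ B`, mapped into `A ⊗ B`. -/
def ofAlg (π : A →⋆ₐ[ℂ] (H →L[ℂ] H)) (ρ : B →⋆ₐ[ℂ] (K →L[ℂ] K)) :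
    A ⊗[ℂ] B →ₗ[ℂ] spatialTensor π ρ :=
  TensorProduct.lift <| LinearMap.mk₂ ℂ
    (fun a b => (⟨opTensor (π a) (ρ b),
      StarSubalgebra.le_topologicalClosure _ (StarAlgebra.subset_adjoin ℂ _ ⟨(a, b), rfl⟩)⟩ :
        spatialTensor π ρ))
    (fun a a' b => Subtype.ext (by simp [opTensor_add_left]))
    (fun c a b => Subtype.ext (by simp [opTensor_smul_left]))
    (fun a b b' => Subtype.ext (by simp [opTensor_add_right]))
    (fun c a b => Subtype.ext (by simp [opTensor_smul_right]))

/-- The representation of `A ⊗ B` on `H ⊗ K`. -/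
abbrev rep (π : A →⋆ₐ[ℂ] (H →L[ℂ] H)) (ρ : B →⋆ₐ[ℂ] (K →L[ℂ] K)) :
    spatialTensor π ρ →⋆ₐ[ℂ] (HilbertTensor H K →L[ℂ] HilbertTensor H K) :=
  (spatialTensor π ρ).subtype

/-- The unique continuous linear extension to `A ⊗ B` of a linear map on the dense subspace `A ⊙ B`
that is bounded for the norm of `A ⊗ B`. -/
def extend {V : Type*} [NormedAddCommGroup V] [NormedSpace ℂ V] [CompleteSpace V]
    (π : A →⋆ₐ[ℂ] (H →L[ℂ] H)) (ρ : B →⋆ₐ[ℂ] (K →L[ℂ] K)) (f : A ⊗[ℂ] B →ₗ[ℂ] V) :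
    spatialTensor π ρ →L[ℂ] V :=
  f.extendOfNorm (ofAlg π ρ)

/-- The tensor product `φ ⊗ ψ : A ⊗ B → C ⊗ D` of completely bounded maps: the continuous
extension of the algebraic tensor product `φ ⊙ ψ`. -/
def map (π : A →⋆ₐ[ℂ] (H →L[ℂ] H)) (ρ : B →⋆ₐ[ℂ] (K →L[ℂ] K))
    (π' : C →⋆ₐ[ℂ] (L →L[ℂ] L)) (ρ' : D →⋆ₐ[ℂ] (M →L[ℂ] M))
    (φ : A →ₗ[ℂ] C) (ψ : B →ₗ[ℂ] D) : spatialTensor π ρ →L[ℂ] spatialTensor π' ρ' :=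
  extend π ρ (ofAlg π' ρ' ∘ₗ TensorProduct.map φ ψ)

/-- The associativity isomorphism `(A ⊗ B) ⊗ C → A ⊗ (B ⊗ C)`. -/
def assoc (π : A →⋆ₐ[ℂ] (H →L[ℂ] H)) (ρ : B →⋆ₐ[ℂ] (K →L[ℂ] K)) (τ : C →⋆ₐ[ℂ] (L →L[ℂ] L)) :
    spatialTensor (rep π ρ) τ →L[ℂ] spatialTensor π (rep ρ τ) :=
  (ofAlg π (rep ρ τ) ∘ₗ TensorProduct.map LinearMap.id (ofAlg ρ τ) ∘ₗ
      (TensorProduct.assoc ℂ A B C).toLinearMap).extendOfNorm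
    (ofAlg (rep π ρ) τ ∘ₗ TensorProduct.map (ofAlg π ρ) LinearMap.id)

end spatialTensor

end CStar

/-! ## C⋆-hyperbialgebras and quantum stochastic convolution cocycles -/

section Hyperbialgebra

variable {A H : Type*} [CStarAlgebra A]
  [NormedAddCommGroup H] [InnerProductSpace ℂ H] [CompleteSpace H]

/-- `(A, Δ, ε)` is a C⋆-hyperbialgebra. Here `A` is a unital C⋆-algebra with a faithful
representation `π` (which serves to form `A ⊗ A`), `Δ : A → A ⊗ A` is unital, completely positive and
coassociative, and the character `ε` is a counit for `Δ`. -/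
structure IsCStarHyperbialgebra (π : A →⋆ₐ[ℂ] (H →L[ℂ] H)) (Δ : A →ₗ[ℂ] spatialTensor π π)
    (ε : A →⋆ₐ[ℂ] ℂ) : Prop where
  completelyPositive : IsCompletelyPositive Δ
  map_one : Δ 1 = 1
  coassoc : ∀ a,
    spatialTensor.assoc π π π
        (spatialTensor.map π π (spatialTensor.rep π π) π Δ LinearMap.id (Δ a)) =
      spatialTensor.map π π π (spatialTensor.rep π π) LinearMap.id Δ (Δ a)
  counit_left : ∀ a, spatialTensor.extend π π
    ((TensorProduct.lid ℂ A).toLinearMap ∘ₗ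
      TensorProduct.map (ε.toAlgHom.toLinearMap) LinearMap.id) (Δ a) = a
  counit_right : ∀ a, spatialTensor.extend π π
    ((TensorProduct.rid ℂ A).toLinearMap ∘ₗ
      TensorProduct.map LinearMap.id (ε.toAlgHom.toLinearMap)) (Δ a) = a

variable {k : Type*} [NormedAddCommGroup k] [InnerProductSpace ℂ k]

/-- A completely bounded process on `A` with noise dimension space `k` (and values in `ℂ`); the
bounded operators `l_t(a)` are identified with their continuous extensions from `ℰ` to `ℱ`. -/
structure IsCBProcess (l : ℝ≥0 → A →ₗ[ℂ] (FockSpace k →L[ℂ] FockSpace k)) : Prop where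
  isOperatorProcess : ∀ a,
    IsOperatorProcess k fun t => (l t a).toLinearMap ∘ₗ (TestSpace k).subtype
  completelyBounded : ∀ t, IsCompletelyBounded (l t)

theorem ccrFlow_add (s : ℝ≥0) (X Y : FockSpace k →L[ℂ] FockSpace k) :
    ccrFlow s (X + Y) = ccrFlow s X + ccrFlow s Y := by
  simp [ccrFlow, opTensor_add_right]

theorem ccrFlow_smul (s : ℝ≥0) (c : ℂ) (X : FockSpace k →L[ℂ] FockSpace k) :
    ccrFlow s (c • X) = c • ccrFlow s X := by
  simp [ccrFlow, opTensor_smul_right]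

/-- The map `l_s ⊗ (σ_s ∘ l_t) : A ⊗ A → B(ℱ_{[0,s[} ⊗ ℱ_{[s,∞[}) = B(ℱ)`. By adaptedness, `l_s(a)`
acts on the first factor and `σ_s(l_t(b))` acts on the second one, so that the value on `a ⊗ b` is the
product of these two operators on `ℱ`. -/
def incrementTensor (π : A →⋆ₐ[ℂ] (H →L[ℂ] H))
    (l : ℝ≥0 → A →ₗ[ℂ] (FockSpace k →L[ℂ] FockSpace k)) (s t : ℝ≥0) :
    spatialTensor π π →L[ℂ] (FockSpace k →L[ℂ] FockSpace k) :=
  spatialTensor.extend π π <| TensorProduct.lift <| LinearMap.mk₂ ℂ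
    (fun a b => l s a ∘L ccrFlow s (l t b))
    (fun a a' b => by rw [map_add, ContinuousLinearMap.add_comp])
    (fun c a b => by rw [map_smul, ContinuousLinearMap.smul_comp])
    (fun a b b' => by rw [map_add, ccrFlow_add, ContinuousLinearMap.comp_add])
    (fun c a b => by rw [map_smul, ccrFlow_smul, ContinuousLinearMap.comp_smul])

/-- The convolution increment property `l_{s+t} = (l_s ⊗ (σ_s ∘ l_t)) ∘ Δ`. -/
def HasConvolutionIncrements (π : A →⋆ₐ[ℂ] (H →L[ℂ] H)) (Δ : A →ₗ[ℂ] spatialTensor π π)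
    (l : ℝ≥0 → A →ₗ[ℂ] (FockSpace k →L[ℂ] FockSpace k)) : Prop :=
  ∀ (s t : ℝ≥0) (a : A), l (s + t) a = incrementTensor π l s t (Δ a)

/-- A quantum stochastic convolution cocycle on `(A, Δ, ε)`: a completely bounded process with the
convolution increment property and the initial condition `l_0(a) = ε(a) I`. -/
structure IsQSConvolutionCocycle (π : A →⋆ₐ[ℂ] (H →L[ℂ] H)) (Δ : A →ₗ[ℂ] spatialTensor π π)
    (ε : A →⋆ₐ[ℂ] ℂ) (l : ℝ≥0 → A →ₗ[ℂ] (FockSpace k →L[ℂ] FockSpace k)) : Prop where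
  isCBProcess : IsCBProcess l
  increments : HasConvolutionIncrements π Δ l
  initial : ∀ a, l 0 a = ε a • ContinuousLinearMap.id ℂ (FockSpace k)

/-! ### The conditional expectation construction -/

variable (S : StarSubalgebra ℂ A) [hS : IsClosed (S : Set A)]

/-- A conditional expectation of `A` onto the C⋆-subalgebra `S`: a projection of norm one. -/
structure IsConditionalExpectation (P : A →L[ℂ] S) : Prop where
  proj : ∀ b : S, P b = b
  norm_eq_one : ‖P‖ = 1

/-- `P`, regarded as a map from `A` to `A`. -/
def expectationEnd (P : A →L[ℂ] S) : A →ₗ[ℂ] A :=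
  S.subtype.toAlgHom.toLinearMap ∘ₗ P.toLinearMap

/-- The compatibility of `P` with the coproduct:
`(P ⊗ id) ∘ Δ ∘ P = (P ⊗ P) ∘ Δ = (id ⊗ P) ∘ Δ`. -/
structure IsCompatibleExpectation (π : A →⋆ₐ[ℂ] (H →L[ℂ] H)) (Δ : A →ₗ[ℂ] spatialTensor π π)
    (P : A →L[ℂ] S) : Prop where
  left : ∀ a,
    spatialTensor.map π π π π (expectationEnd S P) LinearMap.id (Δ (P a)) =
      spatialTensor.map π π π π (expectationEnd S P) (expectationEnd S P) (Δ a)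
  right : ∀ a,
    spatialTensor.map π π π π (expectationEnd S P) (expectationEnd S P) (Δ a) =
      spatialTensor.map π π π π LinearMap.id (expectationEnd S P) (Δ a)

/-- The restriction of the representation of `A` to `S`. -/
abbrev restrictRep (π : A →⋆ₐ[ℂ] (H →L[ℂ] H)) : S →⋆ₐ[ℂ] (H →L[ℂ] H) := π.comp S.subtype

/-- The coproduct `(P ⊗ P) ∘ Δ|_S : S → S ⊗ S`. -/
def restrictCoproduct (π : A →⋆ₐ[ℂ] (H →L[ℂ] H)) (Δ : A →ₗ[ℂ] spatialTensor π π)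
    (P : A →L[ℂ] S) : S →ₗ[ℂ] spatialTensor (restrictRep S π) (restrictRep S π) :=
  (spatialTensor.map π π (restrictRep S π) (restrictRep S π)
      P.toLinearMap P.toLinearMap).toLinearMap ∘ₗ
    Δ ∘ₗ S.subtype.toAlgHom.toLinearMap

/-- The counit `ε|_S`. -/
abbrev restrictCounit (ε : A →⋆ₐ[ℂ] ℂ) : S →⋆ₐ[ℂ] ℂ := ε.comp S.subtype

end Hyperbialgebra

end

/-! The algebraic reason is that `P` intertwines the coproducts. Evaluating the first compatibility
identity at `a` and at `P a` gives `(P ⊗ P) Δ P = (P ⊗ P) Δ`, that is `Δ̃ ∘ P = (P ⊗ P) ∘ Δ`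
(`restrictCoproduct_apply_expectation`). Coassociativity of `Δ̃` is then the image of that of `Δ`
under `P ⊗ P ⊗ P`. For each counit law `P ⊗ P` is replaced by `id ⊗ P` or `P ⊗ id`, whichever leaves
alone the leg on which `ε` acts, so `ε ∘ P = ε` is never needed; this is why lifted cocycles start
at `ε ∘ P`. For processes, `(l̃_s ∘ P) ⊗ (σ_s ∘ l̃_t ∘ P)` factors through `P ⊗ P`, so the increment
identity of `l̃` for `Δ̃` becomes that of `l̃ ∘ P` for `Δ`. Since `P`-invariance says exactly that
`l` is its own restriction composed with `P`, restriction and lifting are mutually inverse.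

The analytic work is to show that these tensor products of maps exist on the completed tensor
products. Three facts carry it. A norm-one projection onto a C⋆-subalgebra is a bimodule map
(Tomiyama, `map_mul_left_of_projection`), hence completely contractive and completely positive. The
same applies to `P ⊗ P`, which is again such a projection, from `A ⊗ A` onto `S ⊗ S`. Completely
bounded maps can be tensored on spatial tensor products: matrix coefficients along an orthonormal
family reduce `φ ⊗ id` to a matrix amplification of `φ` (`spatialTensor.norm_ofAlg_map_left_le`). A
bounded adapted operator is the ampliation of its compression to `ℱ_{[0,s[}`, so `l_s(a)
σ_s(l_t(b))` is a compression of `l_s(a) ⊗ l_t(b)` by operators that depend on neither `a` nor `b`.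
This makes `l_s ⊗ (σ_s ∘ l_t)` bounded (`IsCBProcess.exists_norm_increment_le`). -/

noncomputable section

/-! ### Unital contractions are hermitian and positive -/

section UnitalContraction

variable {A B : Type*} [CStarAlgebra A] [CStarAlgebra B]

theorem norm_self_add_I_smul_sq_le {a : A} (ha : IsSelfAdjoint a) (t : ℝ) :
    ‖a + (t * Complex.I : ℂ) • (1 : A)‖ ^ 2 ≤ ‖a‖ ^ 2 + t ^ 2 := by
  rcases subsingleton_or_nontrivial A with h | h
  · rw [Subsingleton.elim (a + (t * Complex.I : ℂ) • (1 : A)) 0, norm_zero]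
    simpa using add_nonneg (sq_nonneg ‖a‖) (sq_nonneg t)
  have h1 : star (a + (t * Complex.I : ℂ) • (1 : A)) * (a + (t * Complex.I : ℂ) • (1 : A)) =
      a * a + ((t ^ 2 : ℝ) : ℂ) • (1 : A) := by
    have h2 : ((t : ℂ) * Complex.I) * ((t : ℂ) * Complex.I) = -((t ^ 2 : ℝ) : ℂ) := by
      push_cast
      linear_combination (t : ℂ) ^ 2 * Complex.I_mul_I
    have h3 : star ((t : ℂ) * Complex.I) = -(t * Complex.I) := by simp
    simp only [star_add, ha.star_eq, star_smul, star_one, add_mul, mul_add, smul_mul_assoc,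
      mul_smul_comm, one_mul, mul_one, smul_add, smul_smul, h3, neg_smul, smul_neg, neg_mul, h2, neg_neg]
    abel
  rw [sq, ← CStarRing.norm_star_mul_self, h1]
  refine (norm_add_le _ _).trans ?_
  rw [norm_smul, norm_one, mul_one, Complex.norm_real, Real.norm_of_nonneg (sq_nonneg t), sq ‖a‖]
  gcongr
  exact norm_mul_le _ _

theorem IsSelfAdjoint.exists_mem_spectrum_abs_eq_norm [Nontrivial A] {a : A}
    (ha : IsSelfAdjoint a) : ∃ γ : ℝ, γ ∈ spectrum ℝ a ∧ |γ| = ‖a‖ := by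
  let := CStarAlgebra.spectralOrder A
  have := CStarAlgebra.spectralOrderedRing A
  rcases CStarAlgebra.norm_or_neg_norm_mem_spectrum ha with h | h
  · exact ⟨_, h, abs_of_nonneg (norm_nonneg _)⟩
  · exact ⟨_, h, by rw [abs_neg, abs_of_nonneg (norm_nonneg _)]⟩

/-- Adding `i t` to `a` moves the imaginary part `c` of `φ a` by `t`, while the norm of `a + i t`
grows only like `√(‖a‖² + t²)`. A nonzero spectral value of `c` would make `c + t` too large for a
suitable `t`. -/
theorem isSelfAdjoint_map_of_unital_contraction {φ : A →ₗ[ℂ] B} (h1 : φ 1 = 1)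
    (hφ : ∀ a, ‖φ a‖ ≤ ‖a‖) {a : A} (ha : IsSelfAdjoint a) : IsSelfAdjoint (φ a) := by
  rcases subsingleton_or_nontrivial B with h | h
  · exact Subsingleton.elim _ _
  set c : selfAdjoint B := imaginaryPart (φ a) with hc
  have key : ∀ t : ℝ, ‖(c : B) + algebraMap ℝ B t‖ ^ 2 ≤ ‖a‖ ^ 2 + t ^ 2 := by
    intro t
    refine le_trans ?_ (norm_self_add_I_smul_sq_le ha t)
    have : (c : B) + algebraMap ℝ B t =
        ((imaginaryPart (φ (a + (t * Complex.I : ℂ) • (1 : A))) : selfAdjoint B) : B) := by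
      rw [map_add φ, map_smul φ, h1, map_add imaginaryPart, mul_comm, mul_smul, imaginaryPart_I_smul]
      rw [AddSubgroup.coe_add, ← hc]
      congr 1
      rw [IsSelfAdjoint.coe_realPart]
      · rw [Algebra.algebraMap_eq_smul_one]; rfl
      · change star _ = _
        simp
    rw [this]
    gcongr
    exact (imaginaryPart.norm_le _).trans (hφ _)
  have hcs : IsSelfAdjoint (c : B) := c.2
  have hc0 : ‖(c : B)‖ = 0 := by
    clear_value c
    obtain ⟨γ, hγ, hγn⟩ := hcs.exists_mem_spectrum_abs_eq_norm
    have hb : ∀ t : ℝ, (γ + t) ^ 2 ≤ ‖a‖ ^ 2 + t ^ 2 := by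
      intro t
      refine le_trans ?_ (key t)
      have : γ + t ∈ spectrum ℝ ((c : B) + algebraMap ℝ B t) :=
        add_comm (algebraMap ℝ B t) (c : B) ▸ spectrum.add_mem_add_iff.2 hγ
      have := spectrum.norm_le_norm_of_mem this
      rw [Real.norm_eq_abs] at this
      rw [← sq_abs]
      gcongr
    rw [← hγn, abs_eq_zero]
    by_contra h0
    -- This `t` makes the cross term `2 γ t` equal to `‖a‖²`, which leaves `γ² ≤ 0`.
    have := hb (‖a‖ ^ 2 / (2 * γ))
    have h3 : γ * (‖a‖ ^ 2 / (2 * γ)) = ‖a‖ ^ 2 / 2 := by field_simp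
    have h4 : 0 < γ ^ 2 := by positivity
    nlinarith
  have : (c : B) = 0 := norm_eq_zero.1 hc0
  rw [← realPart_add_I_smul_imaginaryPart (φ a), ← hc, this, smul_zero, add_zero]
  exact (realPart (φ a)).2

/-- Unital contractions between C⋆-algebras are hermitian. -/
theorem map_star_of_unital_contraction {φ : A →ₗ[ℂ] B} (h1 : φ 1 = 1)
    (hφ : ∀ a, ‖φ a‖ ≤ ‖a‖) (a : A) : φ (star a) = star (φ a) := by
  have h : ∀ x : selfAdjoint A, star (φ x) = φ x := fun x =>
    (isSelfAdjoint_map_of_unital_contraction h1 hφ x.2).star_eq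
  conv_lhs => rw [← realPart_add_I_smul_imaginaryPart a]
  conv_rhs => rw [← realPart_add_I_smul_imaginaryPart a]
  simp [h]

/-- Unital contractions between C⋆-algebras are positive. -/
theorem map_nonneg_of_unital_contraction [PartialOrder A] [StarOrderedRing A] [PartialOrder B]
    [StarOrderedRing B] {φ : A →ₗ[ℂ] B} (h1 : φ 1 = 1)
    (hφ : ∀ a, ‖φ a‖ ≤ ‖a‖) {a : A} (ha : 0 ≤ a) : 0 ≤ φ a := by
  rcases eq_or_ne a 0 with rfl | h0
  · rw [map_zero]
  have hn : 0 < ‖a‖ := norm_pos_iff.2 h0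
  set x : A := (‖a‖⁻¹ : ℝ) • a with hx
  have hx0 : 0 ≤ x := smul_nonneg (by positivity) ha
  have hxn : ‖x‖ ≤ 1 := by
    rw [hx, norm_smul, norm_inv, norm_norm, inv_mul_cancel₀ hn.ne']
  -- For positive `x` in the unit ball, `1 - x` is in the unit ball too. The contraction keeps `1 -
  -- φ x` there, and being self-adjoint it is at most `1`.
  have h2 : 1 - x ∈ Set.Icc 0 1 := by
    have := CStarAlgebra.mem_Icc_iff_norm_le_one.2 ⟨hx0, hxn⟩
    exact ⟨sub_nonneg.2 this.2, sub_le_self _ hx0⟩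
  have h3 : ‖(1 : A) - x‖ ≤ 1 := (CStarAlgebra.mem_Icc_iff_norm_le_one.1 h2).2
  have hsa : IsSelfAdjoint ((1 : B) - φ x) :=
    (IsSelfAdjoint.one B).sub (isSelfAdjoint_map_of_unital_contraction h1 hφ (.of_nonneg hx0))
  have h4 : ‖(1 : B) - φ x‖ ≤ 1 := by
    rw [← h1, ← map_sub]
    exact (hφ _).trans h3
  have h5 : (1 : B) - φ x ≤ 1 := by
    refine hsa.le_algebraMap_norm_self.trans ?_
    simpa using algebraMap_mono B h4
  have h6 : 0 ≤ φ x := by simpa using h5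
  have h7 : φ a = ‖a‖ • φ x := by
    rw [hx, φ.map_smul_of_tower, smul_smul, mul_inv_cancel₀ hn.ne', one_smul]
  rw [h7]
  exact smul_nonneg (norm_nonneg _) h6

end UnitalContraction

/-! ### Tomiyama's theorem -/

section NormOneProjection

variable {A B : Type*} [CStarAlgebra A] [CStarAlgebra B]

/-- For self-adjoint `y` and `t` put `w = [y, t]`. Since `y` commutes with both `w` and `[y, t²] = w
t + t w`, taking one more commutator with `y` gives `2 w² = 0`. As `w` is skew-adjoint, `w⋆ w = 0`
and so `w = 0`. The general case splits into real and imaginary parts. -/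
theorem commute_of_commute_commutators {z : B} (h : ∀ s t : B, Commute z (s * t - t * s)) (t : B) :
    Commute z t := by
  have key : ∀ y : B, IsSelfAdjoint y → (∀ s t : B, Commute y (s * t - t * s)) →
      ∀ t : B, IsSelfAdjoint t → Commute y t := by
    intro y hy hc t ht
    set w := y * t - t * y with hw
    have h1 : y * w = w * y := hc y t
    have h2 : y * (y * (t * t) - t * t * y) = (y * (t * t) - t * t * y) * y := hc y (t * t)
    have h3 : y * (t * t) - t * t * y = w * t + t * w := by rw [hw]; noncomm_ring
    have h4 : (2 : ℂ) • (w * w) = 0 := by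
      have : (2 : ℂ) • (w * w) = y * (w * t + t * w) - (w * t + t * w) * y -
          (y * w - w * y) * t - t * (y * w - w * y) := by
        rw [two_smul, hw]; noncomm_ring
      rw [this, ← h3, h2, h1]
      simp
    have h5 : star w = -w := by
      rw [hw]; simp [hy.star_eq, ht.star_eq]
    have h6 : star w * w = 0 := by
      rw [h5, neg_mul, (smul_eq_zero.1 h4).resolve_left two_ne_zero, neg_zero]
    exact sub_eq_zero.1 (CStarRing.star_mul_self_eq_zero_iff w |>.1 h6)
  have hstar : ∀ s t : B, Commute (star z) (s * t - t * s) := by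
    intro s t
    have := (h (star t) (star s)).star_star
    simpa using this
  have hre : ∀ s t : B, Commute ((realPart z : selfAdjoint B) : B) (s * t - t * s) := by
    intro s t
    rw [realPart_apply_coe]
    exact ((h s t).add_left (hstar s t)).smul_left _
  have him : ∀ s t : B, Commute ((imaginaryPart z : selfAdjoint B) : B) (s * t - t * s) := by
    intro s t
    rw [imaginaryPart_apply_coe]
    exact (((h s t).sub_left (hstar s t)).smul_left _).smul_left _
  have hsa : ∀ t : B, IsSelfAdjoint t → Commute z t := by
    intro t ht
    rw [← realPart_add_I_smul_imaginaryPart z]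
    exact (key _ (realPart z).2 hre t ht).add_left
      ((key _ (imaginaryPart z).2 him t ht).smul_left _)
  rw [← realPart_add_I_smul_imaginaryPart t]
  exact (hsa _ (realPart t).2).add_right ((hsa _ (imaginaryPart t).2).smul_right _)

variable {i : B →⋆ₐ[ℂ] A} {P : A →ₗ[ℂ] B}

/-- The map `Q x = u⋆ P(u x)` is again a unital contraction, hence hermitian. Its hermiticity at `(x
u)⋆`, combined with that of `P`, is the asserted identity. -/
theorem map_unitary_conj_of_projection (hP : ∀ a, ‖P a‖ ≤ ‖a‖) (hi : ∀ b, P (i b) = b)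
    {u : B} (hu : u ∈ unitary B) (x : A) : P (i u * x * i u) = u * P x * u := by
  have hu' : star u * u = 1 := Unitary.star_mul_self_of_mem hu
  have hu'' : u * star u = 1 := Unitary.mul_star_self_of_mem hu
  have hiu : i u * star (i u) = 1 := by rw [← map_star, ← map_mul, hu'', map_one]
  have hiu' : i u ∈ unitary A := Unitary.map_mem i hu
  let Q : A →ₗ[ℂ] B := LinearMap.mulLeft ℂ (star u) ∘ₗ P ∘ₗ LinearMap.mulLeft ℂ (i u)
  have hQ : ∀ x, Q x = star u * P (i u * x) := fun x => rfl
  have hQ1 : Q 1 = 1 := by rw [hQ, mul_one, hi, hu']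
  have hQn : ∀ x, ‖Q x‖ ≤ ‖x‖ := by
    intro x
    rw [hQ, CStarRing.norm_mem_unitary_mul _ (Unitary.star_mem hu)]
    refine (hP _).trans ?_
    rw [CStarRing.norm_mem_unitary_mul _ hiu']
  have hPs : ∀ a, P (star a) = star (P a) :=
    map_star_of_unital_contraction (by rw [← map_one i, hi]) hP
  have := map_star_of_unital_contraction hQ1 hQn (star (x * i u))
  rw [hQ, hQ, star_star, star_mul (star u), star_star, ← hPs, star_mul, star_star, mul_assoc x, hiu,
    mul_one] at this
  rw [mul_assoc (i u), mul_assoc u, ← this, ← mul_assoc u, hu'', one_mul]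

/-- This is the derivative at `t = 0` of `P(u x u) = u P(x) u` along the unitaries `u = exp(i t h)`
with `h` self-adjoint. -/
theorem jordan_of_projection (hP : ∀ a, ‖P a‖ ≤ ‖a‖) (hi : ∀ b, P (i b) = b)
    (s : B) (x : A) : P (i s * x) + P (x * i s) = s * P x + P x * s := by
  have key : ∀ h : B, IsSelfAdjoint h → P (i h * x) + P (x * i h) = h * P x + P x * h := by
    intro h hh
    let Pc : A →L[ℝ] B := (P.mkContinuous 1 (by simpa using hP)).restrictScalars ℝ
    let ic : B →L[ℝ] A := (i.toAlgHom.toLinearMap.mkContinuous 1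
      (by simpa using NonUnitalStarAlgHom.norm_apply_le i)).restrictScalars ℝ
    let a : B := Complex.I • h
    let e : ℝ → B := fun t => NormedSpace.exp (t • a)
    have he : HasDerivAt e a 0 := by
      have := hasDerivAt_exp_smul_const (𝕂 := ℝ) a (0 : ℝ)
      simpa using this
    have he0 : e 0 = 1 := by simp [e]
    have hie : HasDerivAt (fun t => i (e t)) (i a) 0 := ic.hasFDerivAt.comp_hasDerivAt 0 he
    have hu : ∀ t, e t ∈ unitary B := by
      intro t
      have := (selfAdjoint.expUnitary (⟨t • h, (IsSelfAdjoint.all t).smul hh⟩ : selfAdjoint B)).2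
      rw [selfAdjoint.expUnitary_coe] at this
      have h2 : t • a = Complex.I • t • h := smul_comm _ _ _
      simp only [e, h2]
      exact this
    have hd1 : HasDerivAt (fun t => P (i (e t) * x * i (e t))) (P (i a * x + x * i a)) 0 := by
      have h1 := (hie.mul_const x).mul hie
      simp only [he0, map_one, mul_one, one_mul] at h1
      exact Pc.hasFDerivAt.comp_hasDerivAt 0 h1
    have hd2 : HasDerivAt (fun t => e t * P x * e t) (a * P x + P x * a) 0 := by
      have h1 := (he.mul_const (P x)).mul he
      simp only [he0, mul_one, one_mul] at h1
      exact h1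
    have heq : (fun t => P (i (e t) * x * i (e t))) = fun t => e t * P x * e t :=
      funext fun t => map_unitary_conj_of_projection hP hi (hu t) x
    rw [heq] at hd1
    have := hd1.unique hd2
    simp only [a, map_smul, smul_mul_assoc, mul_smul_comm, ← smul_add] at this
    rw [← map_add]
    exact smul_right_injective B Complex.I_ne_zero this
  conv_lhs => rw [← realPart_add_I_smul_imaginaryPart s]
  conv_rhs => rw [← realPart_add_I_smul_imaginaryPart s]
  have h1 := key _ (realPart s).2
  have h2 := key _ (imaginaryPart s).2
  simp only [map_add, map_smul, add_mul, mul_add, smul_mul_assoc, mul_smul_comm]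
  calc _ = (P (i (realPart s) * x) + P (x * i (realPart s))) + Complex.I •
        (P (i (imaginaryPart s) * x) + P (x * i (imaginaryPart s))) := by rw [smul_add]; abel
    _ = _ := by rw [h1, h2, smul_add]; abel

/-- Tomiyama's theorem: a norm-one projection onto a C⋆-subalgebra is a left module map. -/
theorem map_mul_left_of_projection (hP : ∀ a, ‖P a‖ ≤ ‖a‖) (hi : ∀ b, P (i b) = b)
    (s : B) (x : A) : P (i s * x) = s * P x := by
  have J := jordan_of_projection hP hi
  -- The defect of left linearity. By the Jordan identity it is also minus the defect of right
  -- linearity (`hD'`), and comparing the two forms on products forces it to vanish.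
  let D : B → A → B := fun s x => P (i s * x) - s * P x
  have hD' : ∀ s x, D s x = P x * s - P (x * i s) := fun s x => by
    rw [sub_eq_sub_iff_add_eq_add, J, add_comm]
  have ha : ∀ s t x, D (s * t) x = D s (i t * x) + s * D t x := fun s t x => by
    simp only [D, map_mul]; noncomm_ring
  have hb : ∀ s t x, D (s * t) x = D s x * t + D t (x * i s) := fun s t x => by
    simp only [hD', map_mul]; noncomm_ring
  have hc : ∀ s t x, D s (i t * x) + D t (x * i s) = D t x * s + t * D s x := fun s t x => by
    rw [hD' s (i t * x), hD' s x]; simp only [D, ← mul_assoc]; noncomm_ring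
  have h2 : ∀ s t x, D (s * t) x + D (s * t) x =
      D t x * s + t * D s x + s * D t x + D s x * t := fun s t x => by
    rw [← hc]
    nth_rewrite 1 [ha]
    rw [hb]
    abel
  -- The right side of `h2` is symmetric in `s` and `t`, so `D` kills commutators.
  have hsymm : ∀ s t x, D (s * t) x = D (t * s) x := fun s t x => by
    have : (2 : ℂ) • D (s * t) x = (2 : ℂ) • D (t * s) x := by
      rw [two_smul, two_smul, h2, h2]; abel
    exact smul_right_injective B two_ne_zero this
  have hcomm0 : ∀ s t x, D (s * t - t * s) x = 0 := fun s t x => by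
    have : D (s * t - t * s) x = D (s * t) x - D (t * s) x := by
      simp only [D, map_sub, sub_mul]; abel
    rw [this, hsymm, sub_self]
  -- For a commutator `c`, `ha` gives `D (c r) x = c D r x`, whereas `h2` gives `2 D (c r) x = D r x
  -- c + c D r x`. Hence `D r x` commutes with `c`.
  have hcentral : ∀ r x t, Commute (D r x) t := fun r x => by
    refine commute_of_commute_commutators fun s t => ?_
    have h3 := h2 (s * t - t * s) r x
    rw [ha, hcomm0, hcomm0] at h3
    simp only [zero_add, mul_zero, zero_mul, add_zero] at h3
    exact (add_right_cancel h3).symm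
  have hder : ∀ s t x, D (s * t) x = s * D t x + t * D s x := fun s t x => by
    have := h2 s t x
    rw [(hcentral t x s).eq, (hcentral s x t).eq] at this
    have h4 : (2 : ℂ) • D (s * t) x = (2 : ℂ) • (s * D t x + t * D s x) := by
      rw [two_smul, two_smul, this]; abel
    exact smul_right_injective B two_ne_zero h4
  -- With central values, `D · x` is a derivation, so `D (u ^ (n + 1)) x = (n + 1) u ^ n D u x`. For
  -- unitary `u` the left side is bounded by `2 ‖x‖` independently of `n`, so `D u x` must vanish.
  have hunit : ∀ u ∈ unitary B, D u x = 0 := by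
    intro u hu
    have hpow : ∀ n : ℕ, D (u ^ (n + 1)) x = ((n : ℂ) + 1) • (u ^ n * D u x) := by
      intro n
      induction n with
      | zero => simp
      | succ n ih =>
        rw [pow_succ' u (n + 1), hder, ih, mul_smul_comm, ← mul_assoc, ← pow_succ', Nat.cast_succ]
        simp only [add_smul, one_smul]
    have hbd : ∀ n : ℕ, ((n : ℝ) + 1) * ‖D u x‖ ≤ 2 * ‖x‖ := by
      intro n
      have hun : u ^ n ∈ unitary B := pow_mem hu n
      have hun' : u ^ (n + 1) ∈ unitary B := pow_mem hu (n + 1)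
      have h5 : ‖D (u ^ (n + 1)) x‖ = ((n : ℝ) + 1) * ‖D u x‖ := by
        rw [hpow, norm_smul, CStarRing.norm_mem_unitary_mul _ hun]
        congr 1
        exact_mod_cast Complex.norm_natCast (n + 1)
      rw [← h5, two_mul]
      refine (norm_sub_le _ _).trans (add_le_add ?_ ?_)
      · refine (hP _).trans ?_
        rw [CStarRing.norm_mem_unitary_mul _ (Unitary.map_mem i hun')]
      · rw [CStarRing.norm_mem_unitary_mul _ hun']
        exact hP x
    by_contra h0
    have hpos : 0 < ‖D u x‖ := norm_pos_iff.2 h0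
    obtain ⟨n, hn⟩ := exists_nat_gt (2 * ‖x‖ / ‖D u x‖)
    rw [div_lt_iff₀ hpos] at hn
    have := hbd n
    nlinarith
  have hspan : s ∈ Submodule.span ℂ (unitary B : Set B) := by
    rw [CStarAlgebra.span_unitary]; trivial
  induction hspan using Submodule.span_induction with
  | mem u hu => exact sub_eq_zero.1 (hunit u hu)
  | zero => simp
  | add s t _ _ hs ht => rw [map_add, add_mul, map_add, hs, ht, add_mul]
  | smul c s _ hs => rw [map_smul, smul_mul_assoc, map_smul, hs, smul_mul_assoc]

theorem map_mul_right_of_projection (hP : ∀ a, ‖P a‖ ≤ ‖a‖) (hi : ∀ b, P (i b) = b)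
    (s : B) (x : A) : P (x * i s) = P x * s := by
  have := jordan_of_projection hP hi s x
  rw [map_mul_left_of_projection hP hi] at this
  exact add_left_cancel this

end NormOneProjection

/-! ### Complete positivity and complete boundedness -/

section CompletelyBounded

variable {A B : Type*} [CStarAlgebra A] [CStarAlgebra B]

open WithCStarModule in
/-- The amplifications of a norm-one projection onto a C⋆-subalgebra are contractive. -/
theorem norm_cstarMatrix_map_le_of_projection [PartialOrder A] [StarOrderedRing A]
    [PartialOrder B] [StarOrderedRing B] {i : B →⋆ₐ[ℂ] A} {P : A →ₗ[ℂ] B}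
    (hP : ∀ a, ‖P a‖ ≤ ‖a‖) (hi : ∀ b, P (i b) = b) {n : Type*} [Fintype n]
    (M : CStarMatrix n n A) : ‖M.map P‖ ≤ ‖M‖ := by
  refine CStarMatrix.norm_le_of_forall_inner_le (C := ‖M‖₊) fun v w => ?_
  let lift : C⋆ᵐᵒᵈ(B, n → B) → C⋆ᵐᵒᵈ(A, n → A) := fun v => (equiv _ _).symm fun j => i (v j)
  have hlift : ∀ v, ‖lift v‖ = ‖v‖ := by
    intro v
    have h1 : (∑ j, ⟪lift v j, lift v j⟫_A) = i (∑ j, ⟪v j, v j⟫_B) := by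
      simp [lift, inner_def, map_star]
    rw [pi_norm, pi_norm, h1,
      NonUnitalStarAlgHom.norm_map i (Function.LeftInverse.injective hi)]
  -- The bimodule property lets `P` be pulled out of the inner product, so one application of `‖P a‖
  -- ≤ ‖a‖` bounds every amplification.
  have h2 : ⟪w, CStarMatrix.toCLM (M.map P) v⟫_B = P ⟪lift w, CStarMatrix.toCLM M (lift v)⟫_A := by
    simp only [CStarMatrix.toCLM_apply_eq_sum, pi_inner, equiv_symm_pi_apply, inner_def, lift,
      map_sum, ← map_star, map_mul_right_of_projection hP hi, map_mul_left_of_projection hP hi,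
      CStarMatrix.map_apply]
  rw [h2]
  refine (hP _).trans ((CStarModule.norm_inner_le _).trans ?_)
  rw [hlift, mul_comm, coe_nnnorm, ← hlift v]
  gcongr
  exact (CStarMatrix.toCLM M).le_opNorm _

theorem isCompletelyBounded_of_projection {i : B →⋆ₐ[ℂ] A} {P : A →ₗ[ℂ] B}
    (hP : ∀ a, ‖P a‖ ≤ ‖a‖) (hi : ∀ b, P (i b) = b) : IsCompletelyBounded P := by
  let := CStarAlgebra.spectralOrder A
  let := CStarAlgebra.spectralOrder B
  have := CStarAlgebra.spectralOrderedRing A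
  have := CStarAlgebra.spectralOrderedRing B
  refine ⟨1, fun n M => ?_⟩
  rw [one_mul]
  exact norm_cstarMatrix_map_le_of_projection hP hi M

/-- Each amplification is a unital contraction between C⋆-algebras of matrices, hence positive. -/
theorem isCompletelyPositive_of_projection {i : B →⋆ₐ[ℂ] A} {P : A →ₗ[ℂ] B}
    (hP : ∀ a, ‖P a‖ ≤ ‖a‖) (hi : ∀ b, P (i b) = b) : IsCompletelyPositive P := by
  let := CStarAlgebra.spectralOrder A
  let := CStarAlgebra.spectralOrder B
  have := CStarAlgebra.spectralOrderedRing A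
  have := CStarAlgebra.spectralOrderedRing B
  refine ⟨{ P with
    map_cstarMatrix_nonneg' := fun k M hM => ?_ }, fun a => rfl⟩
  have hP1 : P 1 = 1 := by rw [← map_one i, hi]
  refine map_nonneg_of_unital_contraction (φ := CStarMatrix.mapₗ P) ?_
    (norm_cstarMatrix_map_le_of_projection hP hi) hM
  ext r s
  rcases eq_or_ne r s with rfl | h
  · simp [CStarMatrix.mapₗ, CStarMatrix.map_apply, hP1]
  · simp [CStarMatrix.mapₗ, CStarMatrix.map_apply, h]

theorem isCompletelyPositive_starAlgHom (φ : A →⋆ₐ[ℂ] B) :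
    IsCompletelyPositive φ.toAlgHom.toLinearMap := by
  let := CStarAlgebra.spectralOrder A
  let := CStarAlgebra.spectralOrder B
  have := CStarAlgebra.spectralOrderedRing A
  have := CStarAlgebra.spectralOrderedRing B
  exact ⟨CompletelyPositiveMapClass.toCompletelyPositiveLinearMap φ, fun a => rfl⟩

theorem IsCompletelyPositive.comp {C : Type*} [CStarAlgebra C] {ψ : B →ₗ[ℂ] C} {φ : A →ₗ[ℂ] B}
    (hψ : IsCompletelyPositive ψ) (hφ : IsCompletelyPositive φ) :
    IsCompletelyPositive (ψ ∘ₗ φ) := by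
  let := CStarAlgebra.spectralOrder A
  let := CStarAlgebra.spectralOrder B
  let := CStarAlgebra.spectralOrder C
  have := CStarAlgebra.spectralOrderedRing A
  have := CStarAlgebra.spectralOrderedRing B
  have := CStarAlgebra.spectralOrderedRing C
  obtain ⟨φ', hφ'⟩ := hφ
  obtain ⟨ψ', hψ'⟩ := hψ
  refine ⟨{ ψ ∘ₗ φ with
    map_cstarMatrix_nonneg' := fun k M hM => ?_ }, fun a => rfl⟩
  have := ψ'.map_cstarMatrix_nonneg _ (φ'.map_cstarMatrix_nonneg M hM)
  convert this using 1
  ext r s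
  simp [CStarMatrix.map_apply, hφ', hψ']

/-- A unital positive map of C⋆-algebras has norm at most two. -/
theorem norm_map_le_of_unital_nonneg [PartialOrder A] [StarOrderedRing A]
    [PartialOrder B] [StarOrderedRing B] {φ : A →ₗ[ℂ] B} (h1 : φ 1 = 1)
    (hφ : ∀ a, 0 ≤ a → 0 ≤ φ a) (a : A) : ‖φ a‖ ≤ 2 * ‖a‖ := by
  have key : ∀ a : A, IsSelfAdjoint a → ‖φ a‖ ≤ ‖a‖ := by
    intro a ha
    have hr : ∀ r : ℝ, φ (algebraMap ℝ A r) = algebraMap ℝ B r := fun r => by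
      rw [Algebra.algebraMap_eq_smul_one, Algebra.algebraMap_eq_smul_one, φ.map_smul_of_tower, h1]
    have hle : φ a ≤ algebraMap ℝ B ‖a‖ := by
      have := hφ _ (sub_nonneg.2 ha.le_algebraMap_norm_self)
      rwa [map_sub, hr, sub_nonneg] at this
    have hge : -algebraMap ℝ B ‖a‖ ≤ φ a := by
      have := hφ _ (sub_nonneg.2 ha.neg_algebraMap_norm_le_self)
      rwa [map_sub, map_neg, hr, sub_nonneg] at this
    have hsa : IsSelfAdjoint (φ a) := by
      have h3 : IsSelfAdjoint (algebraMap ℝ B ‖a‖) := .algebraMap B (.all _)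
      have := h3.sub (IsSelfAdjoint.of_nonneg (sub_nonneg.2 hle))
      simpa using this
    rcases subsingleton_or_nontrivial B with h | h
    · rw [Subsingleton.elim (φ a) 0, norm_zero]
      exact norm_nonneg _
    obtain ⟨γ, hγ, hγn⟩ := hsa.exists_mem_spectrum_abs_eq_norm
    rw [← hγn, abs_le]
    refine ⟨?_, (le_algebraMap_iff_spectrum_le (R := ℝ) hsa).1 hle γ hγ⟩
    rw [← map_neg] at hge
    exact (algebraMap_le_iff_le_spectrum (R := ℝ) hsa).1 hge γ hγ
  -- The factor two comes from estimating the real and imaginary parts separately. Only uniformity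
  -- in the size of the matrices matters for complete boundedness, so the sharp constant is not
  -- pursued.
  conv_lhs => rw [← realPart_add_I_smul_imaginaryPart a]
  rw [map_add, map_smul, two_mul]
  refine (norm_add_le _ _).trans (add_le_add ?_ ?_)
  · exact (key _ (realPart a).2).trans (realPart.norm_le a)
  · rw [norm_smul, Complex.norm_I, one_mul]
    exact (key _ (imaginaryPart a).2).trans (imaginaryPart.norm_le a)

/-- Every amplification of `φ` is unital and positive, so the bound for unital positive maps applies
with the same constant at each matrix size. -/
theorem IsCompletelyPositive.isCompletelyBounded {φ : A →ₗ[ℂ] B} (hφ : IsCompletelyPositive φ)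
    (h1 : φ 1 = 1) : IsCompletelyBounded φ := by
  let := CStarAlgebra.spectralOrder A
  let := CStarAlgebra.spectralOrder B
  have := CStarAlgebra.spectralOrderedRing A
  have := CStarAlgebra.spectralOrderedRing B
  obtain ⟨φ', hφ'⟩ := hφ
  refine ⟨2, fun n M => ?_⟩
  refine norm_map_le_of_unital_nonneg (φ := CStarMatrix.mapₗ φ) ?_ (fun N hN => ?_) M
  · ext r s
    rcases eq_or_ne r s with rfl | h
    · simp [CStarMatrix.mapₗ, CStarMatrix.map_apply, h1]
    · simp [CStarMatrix.mapₗ, CStarMatrix.map_apply, h]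
  · have := φ'.map_cstarMatrix_nonneg N hN
    convert this using 1
    ext r s
    simp [CStarMatrix.mapₗ, CStarMatrix.map_apply, hφ']

theorem isCompletelyBounded_starAlgHom (φ : A →⋆ₐ[ℂ] B) :
    IsCompletelyBounded φ.toAlgHom.toLinearMap :=
  (isCompletelyPositive_starAlgHom φ).isCompletelyBounded (map_one φ)

theorem IsCompletelyBounded.comp {C : Type*} [CStarAlgebra C] {ψ : B →ₗ[ℂ] C} {φ : A →ₗ[ℂ] B}
    (hψ : IsCompletelyBounded ψ) (hφ : IsCompletelyBounded φ) :
    IsCompletelyBounded (ψ ∘ₗ φ) := by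
  let := CStarAlgebra.spectralOrder A
  let := CStarAlgebra.spectralOrder B
  let := CStarAlgebra.spectralOrder C
  have := CStarAlgebra.spectralOrderedRing A
  have := CStarAlgebra.spectralOrderedRing B
  have := CStarAlgebra.spectralOrderedRing C
  obtain ⟨C₁, h₁⟩ := hφ
  obtain ⟨C₂, h₂⟩ := hψ
  refine ⟨|C₂| * C₁, fun n M => ?_⟩
  refine (h₂ n (M.map φ)).trans ((mul_le_mul_of_nonneg_right (le_abs_self C₂)
    (norm_nonneg _)).trans ?_)
  rw [mul_assoc]
  gcongr
  exact h₁ n M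

end CompletelyBounded

/-! ### Matrix amplifications of representations -/

section MatrixRepresentation

variable {A H : Type*} [CStarAlgebra A] [NormedAddCommGroup H] [InnerProductSpace ℂ H]

/-- The operator on `H ^ n` given by a matrix of operators on `H`. -/
def matrixOp {n : ℕ} (T : Fin n → Fin n → H →L[ℂ] H) :
    PiLp 2 (fun _ : Fin n => H) →L[ℂ] PiLp 2 (fun _ : Fin n => H) :=
  (PiLp.continuousLinearEquiv 2 ℂ (fun _ : Fin n => H)).symm.toContinuousLinearMap ∘L
    ContinuousLinearMap.pi fun r => ∑ j, T r j ∘L PiLp.proj 2 (fun _ : Fin n => H) j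

theorem matrixOp_apply {n : ℕ} (T : Fin n → Fin n → H →L[ℂ] H) (x : PiLp 2 (fun _ : Fin n => H))
    (r : Fin n) : matrixOp T x r = ∑ j, T r j (x j) := by
  simp [matrixOp]

theorem inner_matrixOp {n : ℕ} (T : Fin n → Fin n → H →L[ℂ] H)
    (x y : PiLp 2 (fun _ : Fin n => H)) :
    ⟪y, matrixOp T x⟫_ℂ = ∑ r, ∑ j, ⟪y r, T r j (x j)⟫_ℂ := by
  simp [PiLp.inner_apply, matrixOp_apply, inner_sum]

variable [CompleteSpace H]

/-- The amplification to `n × n` matrices of a representation. -/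
def matrixRep (π : A →⋆ₐ[ℂ] (H →L[ℂ] H)) (n : ℕ) : CStarMatrix (Fin n) (Fin n) A →⋆ₙₐ[ℂ]
    (PiLp 2 (fun _ : Fin n => H) →L[ℂ] PiLp 2 (fun _ : Fin n => H)) where
  toFun M := matrixOp fun r j => π (M r j)
  map_smul' c M := by
    ext x r
    simp [matrixOp_apply, Finset.smul_sum]
  map_zero' := by
    ext x r
    simp [matrixOp_apply]
  map_add' M N := by
    ext x r
    simp [matrixOp_apply, Finset.sum_add_distrib]
  map_mul' M N := by
    ext x r
    simp only [matrixOp_apply, CStarMatrix.mul_apply, map_sum, map_mul,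
      sum_apply, mul_apply_eq_comp]
    exact Finset.sum_comm
  map_star' M := by
    rw [ContinuousLinearMap.star_eq_adjoint, ContinuousLinearMap.eq_adjoint_iff]
    intro x y
    rw [← inner_conj_symm, inner_matrixOp, inner_matrixOp, Finset.sum_comm, map_sum]
    refine Finset.sum_congr rfl fun r _ => ?_
    rw [map_sum]
    refine Finset.sum_congr rfl fun j _ => ?_
    rw [inner_conj_symm, CStarMatrix.star_apply, map_star, ContinuousLinearMap.star_eq_adjoint,
      ContinuousLinearMap.adjoint_inner_left]

theorem matrixRep_apply (π : A →⋆ₐ[ℂ] (H →L[ℂ] H)) {n : ℕ} (M : CStarMatrix (Fin n) (Fin n) A) :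
    matrixRep π n M = matrixOp fun r j => π (M r j) := rfl

theorem matrixRep_injective {π : A →⋆ₐ[ℂ] (H →L[ℂ] H)} (hπ : Function.Injective π) (n : ℕ) :
    Function.Injective (matrixRep π n) := by
  rw [injective_iff_map_eq_zero]
  intro M hM
  ext r j
  refine hπ ?_
  rw [CStarMatrix.zero_apply, map_zero]
  ext x
  have := congrArg (fun T => T (PiLp.single 2 j x) r) hM
  simpa [matrixRep_apply, matrixOp_apply, apply_ite, PiLp.single_apply, Pi.single_apply] using this

/-- Complete boundedness, expressed in terms of representations. -/
theorem IsCompletelyBounded.exists_norm_matrixRep_le {C L : Type*} [CStarAlgebra C]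
    [NormedAddCommGroup L] [InnerProductSpace ℂ L] [CompleteSpace L]
    {φ : A →ₗ[ℂ] C} (hφ : IsCompletelyBounded φ) {π : A →⋆ₐ[ℂ] (H →L[ℂ] H)}
    (hπ : Function.Injective π) (τ : C →⋆ₐ[ℂ] (L →L[ℂ] L)) :
    ∃ c : ℝ, ∀ (n : ℕ) (M : CStarMatrix (Fin n) (Fin n) A),
      ‖matrixRep τ n (M.map φ)‖ ≤ c * ‖matrixRep π n M‖ := by
  let := CStarAlgebra.spectralOrder A
  let := CStarAlgebra.spectralOrder C
  have := CStarAlgebra.spectralOrderedRing A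
  have := CStarAlgebra.spectralOrderedRing C
  obtain ⟨c, hc⟩ := hφ
  refine ⟨c, fun n M => ?_⟩
  rw [NonUnitalStarAlgHom.norm_map (matrixRep π n) (matrixRep_injective hπ n)]
  exact (NonUnitalStarAlgHom.norm_apply_le _ _).trans (hc n M)

/-- A norm-one projection onto a C⋆-subalgebra is a complete contraction, expressed in terms of
representations. -/
theorem norm_matrixRep_map_le_of_projection {C L : Type*} [CStarAlgebra C]
    [NormedAddCommGroup L] [InnerProductSpace ℂ L] [CompleteSpace L]
    {i : C →⋆ₐ[ℂ] A} {P : A →ₗ[ℂ] C} (hP : ∀ a, ‖P a‖ ≤ ‖a‖) (hi : ∀ b, P (i b) = b)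
    {π : A →⋆ₐ[ℂ] (H →L[ℂ] H)}
    (hπ : Function.Injective π) (τ : C →⋆ₐ[ℂ] (L →L[ℂ] L))
    (n : ℕ) (M : CStarMatrix (Fin n) (Fin n) A) :
      ‖matrixRep τ n (M.map P)‖ ≤ 1 * ‖matrixRep π n M‖ := by
  let := CStarAlgebra.spectralOrder A
  let := CStarAlgebra.spectralOrder C
  have := CStarAlgebra.spectralOrderedRing A
  have := CStarAlgebra.spectralOrderedRing C
  rw [NonUnitalStarAlgHom.norm_map (matrixRep π n) (matrixRep_injective hπ n), one_mul]
  exact (NonUnitalStarAlgHom.norm_apply_le _ _).trans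
    (norm_cstarMatrix_map_le_of_projection hP hi M)

end MatrixRepresentation

/-! ### Algebraic tensors as columns along an orthonormal family -/

section Slice

variable {L K : Type*} [NormedAddCommGroup L] [InnerProductSpace ℂ L]
  [NormedAddCommGroup K] [InnerProductSpace ℂ K]

/-- The vector `∑ j, ξ j ⊗ f j`. -/
def columnTensor {n : ℕ} (f : Fin n → K) (ξ : PiLp 2 (fun _ : Fin n => L)) : L ⊗[ℂ] K :=
  ∑ j, ξ j ⊗ₜ[ℂ] f j

theorem norm_columnTensor {n : ℕ} {f : Fin n → K} (hf : Orthonormal ℂ f)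
    (ξ : PiLp 2 (fun _ : Fin n => L)) : ‖columnTensor f ξ‖ = ‖ξ‖ := by
  have : ⟪columnTensor f ξ, columnTensor f ξ⟫_ℂ = ⟪ξ, ξ⟫_ℂ := by
    simp only [columnTensor, sum_inner, inner_sum, TensorProduct.inner_tmul, PiLp.inner_apply]
    refine Finset.sum_congr rfl fun j _ => ?_
    simp [orthonormal_iff_ite.1 hf]
  rw [@norm_eq_sqrt_re_inner ℂ, @norm_eq_sqrt_re_inner ℂ, this]

/-- Both tensors lie in `L ⊗ F` for one finite-dimensional `F ⊆ K`, and an orthonormal basis of `F`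
serves for both. The common family turns a matrix coefficient between `v` and `w` into one between
columns. -/
theorem exists_columnTensor_eq (v w : L ⊗[ℂ] K) :
    ∃ (n : ℕ) (f : Fin n → K), Orthonormal ℂ f ∧
      (∃ ξ, columnTensor f ξ = v) ∧ ∃ η, columnTensor f η = w := by
  obtain ⟨F, hF, hvw⟩ := TensorProduct.exists_finite_submodule_right_of_setFinite {v, w}
    (Set.toFinite _)
  let b := stdOrthonormalBasis ℂ F
  have key : ∀ u : L ⊗[ℂ] F, ∃ ξ, columnTensor (fun j => (b j : K)) ξ = F.subtype.lTensor L u := by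
    intro u
    induction u using TensorProduct.induction_on with
    | zero => exact ⟨0, by simp [columnTensor]⟩
    | tmul x y =>
      refine ⟨WithLp.toLp 2 fun j => ⟪b j, y⟫_ℂ • x, ?_⟩
      rw [LinearMap.lTensor_tmul]
      conv_rhs => rw [← b.sum_repr' y, map_sum, TensorProduct.tmul_sum]
      simp [columnTensor, TensorProduct.smul_tmul]
    | add x y hx hy =>
      obtain ⟨ξ, hξ⟩ := hx
      obtain ⟨η, hη⟩ := hy
      exact ⟨ξ + η, by simp [← hξ, ← hη, columnTensor, TensorProduct.add_tmul,
        Finset.sum_add_distrib]⟩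
  refine ⟨_, fun j => (b j : K), b.orthonormal.comp_linearIsometry F.subtypeₗᵢ, ?_, ?_⟩
  · obtain ⟨u, hu⟩ := hvw (Set.mem_insert v _)
    rw [← hu]
    exact key u
  · obtain ⟨u, hu⟩ := hvw (Set.mem_insert_of_mem v rfl)
    rw [← hu]
    exact key u

theorem opNorm_le_of_inner_ofAlg {T : HilbertTensor L K →L[ℂ] HilbertTensor L K} {c : ℝ}
    (hc : 0 ≤ c) (h : ∀ v w : L ⊗[ℂ] K,
      ‖⟪HilbertTensor.ofAlg w, T (HilbertTensor.ofAlg v)⟫_ℂ‖ ≤ c * ‖v‖ * ‖w‖) : ‖T‖ ≤ c := by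
  have h1 : ∀ x y : HilbertTensor L K, ‖⟪y, T x⟫_ℂ‖ ≤ c * ‖x‖ * ‖y‖ := by
    intro x y
    refine HilbertTensor.denseRange_ofAlg.induction_on₂
      (p := fun x y => ‖⟪y, T x⟫_ℂ‖ ≤ c * ‖x‖ * ‖y‖) (isClosed_le (by fun_prop) (by fun_prop))
      (fun v w => ?_) x y
    rw [HilbertTensor.ofAlg.norm_map, HilbertTensor.ofAlg.norm_map]
    exact h v w
  refine T.opNorm_le_bound hc fun x => ?_
  have h2 := h1 x (T x)
  rw [inner_self_eq_norm_sq_to_K, norm_pow, RCLike.norm_ofReal, abs_norm, sq] at h2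
  rcases (norm_nonneg (T x)).eq_or_lt with h0 | h0
  · rw [← h0]; positivity
  · exact le_of_mul_le_mul_right h2 h0

end Slice

/-! ### Products and adjoints of tensor products of operators -/

section OpTensor

variable {H K : Type*} [NormedAddCommGroup H] [InnerProductSpace ℂ H]
  [NormedAddCommGroup K] [InnerProductSpace ℂ K]

theorem HilbertTensor.clm_ext_tmul {f g : HilbertTensor H K →L[ℂ] HilbertTensor H K}
    (h : ∀ x y, f (hTmul x y) = g (hTmul x y)) : f = g :=
  HilbertTensor.clm_ext fun x => by
    induction x using TensorProduct.induction_on with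
    | zero => simp
    | tmul x y => exact h x y
    | add x y hx hy => simp only [map_add, hx, hy]

theorem opTensor_mul (T T' : H →L[ℂ] H) (S S' : K →L[ℂ] K) :
    opTensor T S * opTensor T' S' = opTensor (T * T') (S * S') :=
  HilbertTensor.clm_ext_tmul fun x y => by
    simp [mul_apply_eq_comp, opTensor_hTmul]

theorem opTensor_one : opTensor (1 : H →L[ℂ] H) (1 : K →L[ℂ] K) = 1 :=
  HilbertTensor.clm_ext_tmul fun x y => by
    simp [opTensor_hTmul]

theorem star_opTensor [CompleteSpace H] [CompleteSpace K] (T : H →L[ℂ] H) (S : K →L[ℂ] K) :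
    star (opTensor T S) = opTensor (star T) (star S) := by
  symm
  rw [ContinuousLinearMap.star_eq_adjoint (opTensor T S), ContinuousLinearMap.eq_adjoint_iff]
  intro x y
  refine HilbertTensor.denseRange_ofAlg.induction_on₂
    (p := fun x y => ⟪opTensor (star T) (star S) x, y⟫_ℂ = ⟪x, opTensor T S y⟫_ℂ)
    (isClosed_eq (by fun_prop) (by fun_prop)) (fun v w => ?_) x y
  induction v using TensorProduct.induction_on with
  | zero => simp
  | add v v' hv hv' => simp only [map_add, inner_add_left, hv, hv']
  | tmul a b =>
    induction w using TensorProduct.induction_on with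
    | zero => simp
    | add v v' hv hv' => simp only [map_add, inner_add_right, hv, hv']
    | tmul c d =>
      change ⟪opTensor (star T) (star S) (hTmul a b), hTmul c d⟫_ℂ =
        ⟪hTmul a b, opTensor T S (hTmul c d)⟫_ℂ
      simp [opTensor_hTmul, inner_hTmul, ContinuousLinearMap.star_eq_adjoint,
        ContinuousLinearMap.adjoint_inner_left]

end OpTensor

/-! ### Density of the algebraic tensor product, and tensor products of completely bounded maps -/

namespace spatialTensor

variable {A B C D H K L M : Type*} [CStarAlgebra A] [CStarAlgebra B] [CStarAlgebra C]
  [CStarAlgebra D]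
  [NormedAddCommGroup H] [InnerProductSpace ℂ H] [CompleteSpace H]
  [NormedAddCommGroup K] [InnerProductSpace ℂ K] [CompleteSpace K]
  [NormedAddCommGroup L] [InnerProductSpace ℂ L] [CompleteSpace L]
  [NormedAddCommGroup M] [InnerProductSpace ℂ M] [CompleteSpace M]

section Dense

variable (π : A →⋆ₐ[ℂ] (H →L[ℂ] H)) (ρ : B →⋆ₐ[ℂ] (K →L[ℂ] K))

theorem coe_ofAlg_tmul (a : A) (b : B) :
    (ofAlg π ρ (a ⊗ₜ b) : HilbertTensor H K →L[ℂ] HilbertTensor H K) = opTensor (π a) (ρ b) := rfl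

theorem ofAlg_one : ofAlg π ρ (1 ⊗ₜ 1) = 1 :=
  Subtype.ext (by rw [coe_ofAlg_tmul, map_one, map_one, opTensor_one]; rfl)

theorem exists_ofAlg_eq_mul (x y : A ⊗[ℂ] B) : ∃ z, ofAlg π ρ z = ofAlg π ρ x * ofAlg π ρ y := by
  induction x using TensorProduct.induction_on with
  | zero => exact ⟨0, by simp⟩
  | add x x' hx hx' =>
    obtain ⟨z, hz⟩ := hx
    obtain ⟨z', hz'⟩ := hx'
    exact ⟨z + z', by rw [map_add, hz, hz', map_add, add_mul]⟩
  | tmul a b =>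
    induction y using TensorProduct.induction_on with
    | zero => exact ⟨0, by simp⟩
    | add x x' hx hx' =>
      obtain ⟨z, hz⟩ := hx
      obtain ⟨z', hz'⟩ := hx'
      exact ⟨z + z', by rw [map_add, hz, hz', map_add, mul_add]⟩
    | tmul a' b' =>
      refine ⟨(a * a') ⊗ₜ (b * b'), Subtype.ext ?_⟩
      rw [coe_ofAlg_tmul, map_mul, map_mul, ← opTensor_mul]
      rfl

theorem exists_ofAlg_eq_star (x : A ⊗[ℂ] B) : ∃ z, ofAlg π ρ z = star (ofAlg π ρ x) := by
  induction x using TensorProduct.induction_on with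
  | zero => exact ⟨0, by simp⟩
  | add x x' hx hx' =>
    obtain ⟨z, hz⟩ := hx
    obtain ⟨z', hz'⟩ := hx'
    exact ⟨z + z', by rw [map_add, hz, hz', map_add, star_add]⟩
  | tmul a b =>
    refine ⟨star a ⊗ₜ star b, Subtype.ext ?_⟩
    rw [coe_ofAlg_tmul, map_star, map_star, ← star_opTensor]
    rfl

/-- The image of the algebraic tensor product is already closed under products, adjoints and
scalars, so it exhausts the star algebra generated by the elementary tensors before closure. -/
theorem denseRange_ofAlg : DenseRange (ofAlg π ρ) := by
  intro y
  have hy : (y : HilbertTensor H K →L[ℂ] HilbertTensor H K) ∈ closure (StarAlgebra.adjoin ℂ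
    (Set.range fun p : A × B => opTensor (π p.1) (ρ p.2)) : Set _) := y.2
  rw [closure_subtype]
  refine closure_mono (s := (StarAlgebra.adjoin ℂ
    (Set.range fun p : A × B => opTensor (π p.1) (ρ p.2)) : Set _)) ?_ hy
  suffices h : ∀ T ∈ StarAlgebra.adjoin ℂ (Set.range fun p : A × B => opTensor (π p.1) (ρ p.2)),
      ∃ z, (ofAlg π ρ z : HilbertTensor H K →L[ℂ] HilbertTensor H K) = T by
    intro T hT
    obtain ⟨z, hz⟩ := h T hT
    exact ⟨_, ⟨z, rfl⟩, hz⟩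
  intro T hT
  induction hT using StarAlgebra.adjoin_induction with
  | mem T hT =>
    obtain ⟨p, rfl⟩ := hT
    exact ⟨p.1 ⊗ₜ p.2, rfl⟩
  | algebraMap r =>
    refine ⟨r • (1 ⊗ₜ 1), ?_⟩
    rw [map_smul, ofAlg_one, Algebra.algebraMap_eq_smul_one]
    rfl
  | add S T _ _ hS hT =>
    obtain ⟨z, rfl⟩ := hS
    obtain ⟨z', rfl⟩ := hT
    exact ⟨z + z', by rw [map_add]; rfl⟩
  | mul S T _ _ hS hT =>
    obtain ⟨z, rfl⟩ := hS
    obtain ⟨z', rfl⟩ := hT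
    obtain ⟨w, hw⟩ := exists_ofAlg_eq_mul π ρ z z'
    exact ⟨w, by rw [hw]; rfl⟩
  | star S _ hS =>
    obtain ⟨z, rfl⟩ := hS
    obtain ⟨w, hw⟩ := exists_ofAlg_eq_star π ρ z
    exact ⟨w, by rw [hw]; rfl⟩

variable {π ρ} in
theorem clm_ext {V : Type*} [NormedAddCommGroup V] [NormedSpace ℂ V]
    {f g : spatialTensor π ρ →L[ℂ] V}
    (h : ∀ a b, f (ofAlg π ρ (a ⊗ₜ b)) = g (ofAlg π ρ (a ⊗ₜ b))) : f = g := by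
  ext x
  refine (denseRange_ofAlg π ρ).induction_on (p := fun x => f x = g x) x
    (isClosed_eq f.continuous g.continuous) fun x => ?_
  induction x using TensorProduct.induction_on with
  | zero => simp
  | tmul x y => exact h x y
  | add x y hx hy => simp only [map_add, hx, hy]

end Dense

section Bounds

/-- The slice map `a ⊗ b ↦ ⟪f, ρ(b) g⟫ a`. -/
def slice (A : Type*) [CStarAlgebra A] (ρ : B →⋆ₐ[ℂ] (K →L[ℂ] K)) (f g : K) : A ⊗[ℂ] B →ₗ[ℂ] A :=
  (TensorProduct.rid ℂ A).toLinearMap ∘ₗ TensorProduct.map LinearMap.id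
    ((innerSL ℂ f).toLinearMap ∘ₗ (ContinuousLinearMap.apply ℂ K g).toLinearMap ∘ₗ
      ρ.toAlgHom.toLinearMap)

theorem slice_tmul (ρ : B →⋆ₐ[ℂ] (K →L[ℂ] K)) (f g : K) (a : A) (b : B) :
    slice A ρ f g (a ⊗ₜ b) = ⟪f, ρ b g⟫_ℂ • a := rfl

/-- The matrix of slices of an element of `A ⊙ B` along a family of vectors. -/
def sliceMatrix {n : ℕ} (ρ : B →⋆ₐ[ℂ] (K →L[ℂ] K)) (f : Fin n → K) (x : A ⊗[ℂ] B) :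
    CStarMatrix (Fin n) (Fin n) A :=
  CStarMatrix.ofMatrix fun r j => slice A ρ (f r) (f j) x

theorem sliceMatrix_apply {n : ℕ} (ρ : B →⋆ₐ[ℂ] (K →L[ℂ] K)) (f : Fin n → K) (x : A ⊗[ℂ] B)
    (r j : Fin n) : sliceMatrix ρ f x r j = slice A ρ (f r) (f j) x := rfl

theorem norm_le_of_inner_ofAlg {π : A →⋆ₐ[ℂ] (H →L[ℂ] H)} {ρ : B →⋆ₐ[ℂ] (K →L[ℂ] K)}
    {T : spatialTensor π ρ} {c : ℝ} (hc : 0 ≤ c) (h : ∀ v w : H ⊗[ℂ] K,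
      ‖⟪HilbertTensor.ofAlg w, (T : HilbertTensor H K →L[ℂ] HilbertTensor H K)
        (HilbertTensor.ofAlg v)⟫_ℂ‖ ≤ c * ‖v‖ * ‖w‖) : ‖T‖ ≤ c :=
  opNorm_le_of_inner_ofAlg hc h

/-- Slicing in the second leg commutes with `φ` in the first. Thus the coefficients of `(φ ⊗ id) x`
along `f` are those of the amplification of `φ` applied to one matrix over `A`. -/
theorem inner_ofAlg_map_left (τ : C →⋆ₐ[ℂ] (L →L[ℂ] L)) (ρ : B →⋆ₐ[ℂ] (K →L[ℂ] K))
    (φ : A →ₗ[ℂ] C) {n : ℕ} (f : Fin n → K) (x : A ⊗[ℂ] B) (ξ η : PiLp 2 (fun _ : Fin n => L)) :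
    ⟪HilbertTensor.ofAlg (columnTensor f η),
      (ofAlg τ ρ (TensorProduct.map φ LinearMap.id x) : HilbertTensor L K →L[ℂ] HilbertTensor L K)
        (HilbertTensor.ofAlg (columnTensor f ξ))⟫_ℂ =
      ⟪η, matrixRep τ n ((sliceMatrix ρ f x).map φ) ξ⟫_ℂ := by
  rw [matrixRep_apply, inner_matrixOp]
  simp only [CStarMatrix.map_apply, sliceMatrix_apply]
  induction x using TensorProduct.induction_on with
  | zero => simp
  | add x y hx hy =>
    simp only [map_add, AddMemClass.coe_add, _root_.add_apply, inner_add_right,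
      Finset.sum_add_distrib, hx, hy]
  | tmul a b =>
    have h : ∀ (x : L) (y : K), HilbertTensor.ofAlg (x ⊗ₜ[ℂ] y) = hTmul x y := fun _ _ => rfl
    simp only [TensorProduct.map_tmul, LinearMap.id_apply, coe_ofAlg_tmul, columnTensor, map_sum,
      h, opTensor_hTmul, sum_inner, inner_sum, inner_hTmul, slice_tmul, map_smul,
      _root_.smul_apply, inner_smul_right]
    rw [Finset.sum_comm]
    refine Finset.sum_congr rfl fun r _ => Finset.sum_congr rfl fun j _ => mul_comm _ _

/-- A coefficient of `(φ ⊗ id) x` involves only finitely many orthonormal vectors of `K`, hence a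
finite amplification of `φ` on a slice matrix. The number of vectors is arbitrary, which is why the
bound on `φ` must be uniform in `n`. -/
theorem norm_ofAlg_map_left_le {π : A →⋆ₐ[ℂ] (H →L[ℂ] H)} (τ : C →⋆ₐ[ℂ] (L →L[ℂ] L))
    (ρ : B →⋆ₐ[ℂ] (K →L[ℂ] K)) {φ : A →ₗ[ℂ] C} {c : ℝ} (hc : 0 ≤ c)
    (hφ : ∀ (n : ℕ) (M : CStarMatrix (Fin n) (Fin n) A),
      ‖matrixRep τ n (M.map φ)‖ ≤ c * ‖matrixRep π n M‖) (x : A ⊗[ℂ] B) :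
    ‖ofAlg τ ρ (TensorProduct.map φ LinearMap.id x)‖ ≤ c * ‖ofAlg π ρ x‖ := by
  refine norm_le_of_inner_ofAlg (mul_nonneg hc (norm_nonneg _)) fun v w => ?_
  obtain ⟨n, f, hf, ⟨ξ, rfl⟩, ⟨η, rfl⟩⟩ := exists_columnTensor_eq v w
  rw [inner_ofAlg_map_left, norm_columnTensor hf, norm_columnTensor hf]
  -- The slice matrix is the compression of `x` to `H ⊗ span f`, along the isometry given by
  -- `columnTensor f`.
  have h1 : ‖matrixRep π n (sliceMatrix ρ f x)‖ ≤ ‖ofAlg π ρ x‖ := by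
    refine ContinuousLinearMap.opNorm_le_bound _ (norm_nonneg _) fun ζ => ?_
    set θ := matrixRep π n (sliceMatrix ρ f x) ζ with hθ
    have h2 : ⟪HilbertTensor.ofAlg (columnTensor f θ),
        (ofAlg π ρ x : HilbertTensor H K →L[ℂ] HilbertTensor H K)
          (HilbertTensor.ofAlg (columnTensor f ζ))⟫_ℂ = ⟪θ, θ⟫_ℂ := by
      have := inner_ofAlg_map_left π ρ (LinearMap.id : A →ₗ[ℂ] A) f x ζ θ
      rw [TensorProduct.map_id] at this
      exact this
    have h3 : ‖θ‖ * ‖θ‖ ≤ ‖ofAlg π ρ x‖ * ‖ζ‖ * ‖θ‖ := by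
      have h4 := norm_inner_le_norm (𝕜 := ℂ) (HilbertTensor.ofAlg (columnTensor f θ))
        ((ofAlg π ρ x : HilbertTensor H K →L[ℂ] HilbertTensor H K)
          (HilbertTensor.ofAlg (columnTensor f ζ)))
      rw [h2, inner_self_eq_norm_sq_to_K, norm_pow, RCLike.norm_ofReal, abs_norm, sq] at h4
      refine h4.trans ?_
      rw [mul_comm, HilbertTensor.ofAlg.norm_map, norm_columnTensor hf]
      refine mul_le_mul_of_nonneg_right ((ContinuousLinearMap.le_opNorm _ _).trans ?_)
        (norm_nonneg _)
      rw [HilbertTensor.ofAlg.norm_map, norm_columnTensor hf]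
      rfl
    rcases (norm_nonneg θ).eq_or_lt with h0 | h0
    · rw [← h0]; positivity
    · exact le_of_mul_le_mul_right h3 h0
  calc _ ≤ ‖η‖ * ‖matrixRep τ n ((sliceMatrix ρ f x).map φ) ξ‖ := norm_inner_le_norm _ _
    _ ≤ ‖η‖ * (‖matrixRep τ n ((sliceMatrix ρ f x).map φ)‖ * ‖ξ‖) := by
      gcongr
      exact ContinuousLinearMap.le_opNorm _ _
    _ ≤ ‖η‖ * (c * ‖ofAlg π ρ x‖ * ‖ξ‖) := by
      gcongr
      exact (hφ n _).trans (by gcongr)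
    _ = _ := by ring

theorem inner_ofAlg_comm (π : A →⋆ₐ[ℂ] (H →L[ℂ] H)) (ρ : B →⋆ₐ[ℂ] (K →L[ℂ] K)) (x : A ⊗[ℂ] B)
    (v w : H ⊗[ℂ] K) :
    ⟪HilbertTensor.ofAlg w, (ofAlg π ρ x : HilbertTensor H K →L[ℂ] HilbertTensor H K)
        (HilbertTensor.ofAlg v)⟫_ℂ =
      ⟪HilbertTensor.ofAlg (TensorProduct.comm ℂ H K w),
        (ofAlg ρ π (TensorProduct.comm ℂ A B x) : HilbertTensor K H →L[ℂ] HilbertTensor K H)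
          (HilbertTensor.ofAlg (TensorProduct.comm ℂ H K v))⟫_ℂ := by
  induction x using TensorProduct.induction_on with
  | zero => simp
  | add x y hx hy =>
    simp only [map_add, AddMemClass.coe_add, _root_.add_apply,
      inner_add_right, hx, hy]
  | tmul a b =>
    induction v using TensorProduct.induction_on with
    | zero => simp
    | add x y hx hy => simp only [map_add, inner_add_right, hx, hy]
    | tmul x y =>
      induction w using TensorProduct.induction_on with
      | zero => simp
      | add x y hx hy => simp only [map_add, inner_add_left, hx, hy]
      | tmul x' y' =>
        have h : ∀ (x : H) (y : K), HilbertTensor.ofAlg (x ⊗ₜ[ℂ] y) = hTmul x y := fun _ _ => rfl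
        have h' : ∀ (x : K) (y : H), HilbertTensor.ofAlg (x ⊗ₜ[ℂ] y) = hTmul x y := fun _ _ => rfl
        simp only [TensorProduct.comm_tmul, coe_ofAlg_tmul, h, h', opTensor_hTmul, inner_hTmul]
        exact mul_comm _ _

/-- The flip of `H ⊗ K` is isometric and preserves matrix coefficients. One inequality is enough,
since applying it with the legs exchanged gives the other. -/
theorem norm_ofAlg_comm_le (π : A →⋆ₐ[ℂ] (H →L[ℂ] H)) (ρ : B →⋆ₐ[ℂ] (K →L[ℂ] K))
    (x : A ⊗[ℂ] B) : ‖ofAlg π ρ x‖ ≤ ‖ofAlg ρ π (TensorProduct.comm ℂ A B x)‖ := by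
  refine norm_le_of_inner_ofAlg (norm_nonneg _) fun v w => ?_
  rw [inner_ofAlg_comm]
  refine (norm_inner_le_norm _ _).trans ?_
  have h : ∀ u : H ⊗[ℂ] K, ‖HilbertTensor.ofAlg (TensorProduct.comm ℂ H K u)‖ = ‖u‖ := fun u => by
    rw [HilbertTensor.ofAlg.norm_map]
    exact (TensorProduct.commIsometry ℂ H K).norm_map u
  rw [h, mul_comm]
  refine mul_le_mul_of_nonneg_right ?_ (norm_nonneg _)
  rw [← h v]
  exact ContinuousLinearMap.le_opNorm _ _

theorem norm_ofAlg_map_right_le {π : A →⋆ₐ[ℂ] (H →L[ℂ] H)} (τ : C →⋆ₐ[ℂ] (L →L[ℂ] L))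
    (ρ : B →⋆ₐ[ℂ] (K →L[ℂ] K)) {φ : A →ₗ[ℂ] C} {c : ℝ} (hc : 0 ≤ c)
    (hφ : ∀ (n : ℕ) (M : CStarMatrix (Fin n) (Fin n) A),
      ‖matrixRep τ n (M.map φ)‖ ≤ c * ‖matrixRep π n M‖) (x : B ⊗[ℂ] A) :
    ‖ofAlg ρ τ (TensorProduct.map LinearMap.id φ x)‖ ≤ c * ‖ofAlg ρ π x‖ := by
  refine (norm_ofAlg_comm_le _ _ _).trans ?_
  rw [← TensorProduct.map_comm]
  refine (norm_ofAlg_map_left_le τ ρ hc hφ _).trans ?_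
  gcongr
  refine (norm_ofAlg_comm_le _ _ _).trans ?_
  rw [← LinearEquiv.trans_apply, TensorProduct.comm_trans_comm]
  rfl

theorem norm_ofAlg_map_le {π : A →⋆ₐ[ℂ] (H →L[ℂ] H)} {ρ : B →⋆ₐ[ℂ] (K →L[ℂ] K)}
    (π' : C →⋆ₐ[ℂ] (L →L[ℂ] L)) (ρ' : D →⋆ₐ[ℂ] (M →L[ℂ] M))
    {φ : A →ₗ[ℂ] C} {ψ : B →ₗ[ℂ] D} {c d : ℝ} (hc : 0 ≤ c) (hd : 0 ≤ d)
    (hφ : ∀ (n : ℕ) (M : CStarMatrix (Fin n) (Fin n) A),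
      ‖matrixRep π' n (M.map φ)‖ ≤ c * ‖matrixRep π n M‖)
    (hψ : ∀ (n : ℕ) (M : CStarMatrix (Fin n) (Fin n) B),
      ‖matrixRep ρ' n (M.map ψ)‖ ≤ d * ‖matrixRep ρ n M‖) (x : A ⊗[ℂ] B) :
    ‖ofAlg π' ρ' (TensorProduct.map φ ψ x)‖ ≤ c * d * ‖ofAlg π ρ x‖ := by
  have h : TensorProduct.map φ ψ x =
      TensorProduct.map φ LinearMap.id (TensorProduct.map LinearMap.id ψ x) := by
    rw [← LinearMap.comp_apply, ← TensorProduct.map_comp, LinearMap.comp_id, LinearMap.id_comp]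
  rw [h, mul_assoc]
  refine (norm_ofAlg_map_left_le π' ρ' hc hφ _).trans ?_
  gcongr
  exact norm_ofAlg_map_right_le ρ' π hd hψ x

end Bounds

end spatialTensor

/-! ### Norms of tensor products of operators, and the associativity isometry -/

section OpTensor

variable {H K L : Type*} [NormedAddCommGroup H] [InnerProductSpace ℂ H]
  [NormedAddCommGroup K] [InnerProductSpace ℂ K] [NormedAddCommGroup L] [InnerProductSpace ℂ L]

theorem norm_opTensor_le (T : H →L[ℂ] H) (S : K →L[ℂ] K) : ‖opTensor T S‖ ≤ ‖T‖ * ‖S‖ := by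
  refine ContinuousLinearMap.opNorm_le_bound _ (by positivity) fun x => ?_
  refine HilbertTensor.denseRange_ofAlg.induction_on
    (p := fun x => ‖opTensor T S x‖ ≤ ‖T‖ * ‖S‖ * ‖x‖) x
    (isClosed_le (by fun_prop) (by fun_prop)) fun v => ?_
  rw [opTensor_ofAlg, HilbertTensor.ofAlg.norm_map, HilbertTensor.ofAlg.norm_map]
  exact (ContinuousLinearMap.le_opNorm _ _).trans
    (mul_le_mul_of_nonneg_right (TensorProduct.norm_mapL_le T S) (norm_nonneg _))

theorem norm_hTmul (x : H) (y : K) : ‖hTmul x y‖ = ‖x‖ * ‖y‖ := by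
  rw [hTmul, HilbertTensor.ofAlg.norm_map, TensorProduct.norm_tmul]

theorem le_norm_opTensor_one (T : K →L[ℂ] K) [Nontrivial H] :
    ‖T‖ ≤ ‖opTensor (1 : H →L[ℂ] H) T‖ := by
  refine T.opNorm_le_bound (norm_nonneg _) fun y => ?_
  obtain ⟨x, hx⟩ := exists_ne (0 : H)
  have h := (opTensor (1 : H →L[ℂ] H) T).le_opNorm (hTmul x y)
  rw [opTensor_hTmul, norm_hTmul, norm_hTmul] at h
  have hx' : 0 < ‖x‖ := norm_pos_iff.2 hx
  change ‖x‖ * ‖T y‖ ≤ _ at h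
  rw [mul_left_comm] at h
  exact le_of_mul_le_mul_left h hx'

theorem topologicalClosure_span_range_id :
    (Submodule.span ℂ (Set.range (fun x : H => x))).topologicalClosure = ⊤ := by
  rw [Set.range_id', Submodule.span_univ]
  exact top_unique (Submodule.le_topologicalClosure _)

theorem hTmul_assoc_total : (Submodule.span ℂ (Set.range fun p : H × K × L =>
    hTmul p.1 (hTmul p.2.1 p.2.2))).topologicalClosure = ⊤ :=
  hTmul_total (v := fun x : H => x) topologicalClosure_span_range_id
    (w := fun p : K × L => hTmul p.1 p.2)
    (hTmul_total (v := fun x : K => x) (w := fun x : L => x) topologicalClosure_span_range_id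
      topologicalClosure_span_range_id)

/-- The associativity isometry `H ⊗ (K ⊗ L) → (H ⊗ K) ⊗ L`. -/
theorem exists_isometry_assoc :
    ∃ W : HilbertTensor H (HilbertTensor K L) →ₗᵢ[ℂ] HilbertTensor (HilbertTensor H K) L,
      ∀ x y z, W (hTmul x (hTmul y z)) = hTmul (hTmul x y) z := by
  obtain ⟨W, hW⟩ := exists_isometry_of_gram
    (w := fun p : H × K × L => hTmul (hTmul p.1 p.2.1) p.2.2) hTmul_assoc_total
    (by simp [inner_hTmul, mul_assoc])
  exact ⟨W, fun x y z => hW (x, y, z)⟩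

end OpTensor

/-! ### Continuous extensions and the associator -/

namespace spatialTensor

variable {A B C D H K L M : Type*} [CStarAlgebra A] [CStarAlgebra B] [CStarAlgebra C]
  [CStarAlgebra D]
  [NormedAddCommGroup H] [InnerProductSpace ℂ H] [CompleteSpace H]
  [NormedAddCommGroup K] [InnerProductSpace ℂ K] [CompleteSpace K]
  [NormedAddCommGroup L] [InnerProductSpace ℂ L] [CompleteSpace L]
  [NormedAddCommGroup M] [InnerProductSpace ℂ M] [CompleteSpace M]

section Extend

variable {V : Type*} [NormedAddCommGroup V] [NormedSpace ℂ V] [CompleteSpace V]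
  {π : A →⋆ₐ[ℂ] (H →L[ℂ] H)} {ρ : B →⋆ₐ[ℂ] (K →L[ℂ] K)}

/-- The bound is what ensures that `extend` really extends `f`; hence each tensor map below needs a
norm estimate before it can be evaluated. -/
theorem extend_ofAlg {f : A ⊗[ℂ] B →ₗ[ℂ] V} (hf : ∃ c, ∀ x, ‖f x‖ ≤ c * ‖ofAlg π ρ x‖)
    (x : A ⊗[ℂ] B) : extend π ρ f (ofAlg π ρ x) = f x :=
  LinearMap.extendOfNorm_eq (denseRange_ofAlg π ρ) hf x

theorem exists_norm_ofAlg_map_le (hπ : Function.Injective π) (hρ : Function.Injective ρ)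
    (π' : C →⋆ₐ[ℂ] (L →L[ℂ] L)) (ρ' : D →⋆ₐ[ℂ] (M →L[ℂ] M))
    {φ : A →ₗ[ℂ] C} {ψ : B →ₗ[ℂ] D} (hφ : IsCompletelyBounded φ) (hψ : IsCompletelyBounded ψ) :
    ∃ c, 0 ≤ c ∧ ∀ x, ‖ofAlg π' ρ' (TensorProduct.map φ ψ x)‖ ≤ c * ‖ofAlg π ρ x‖ := by
  obtain ⟨c, hc⟩ := hφ.exists_norm_matrixRep_le hπ π'
  obtain ⟨d, hd⟩ := hψ.exists_norm_matrixRep_le hρ ρ'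
  refine ⟨|c| * |d|, by positivity, fun x => ?_⟩
  exact norm_ofAlg_map_le π' ρ' (abs_nonneg c) (abs_nonneg d)
    (fun n N => (hc n N).trans (by gcongr; exact le_abs_self c))
    (fun n N => (hd n N).trans (by gcongr; exact le_abs_self d)) x

theorem map_ofAlg (hπ : Function.Injective π) (hρ : Function.Injective ρ)
    (π' : C →⋆ₐ[ℂ] (L →L[ℂ] L)) (ρ' : D →⋆ₐ[ℂ] (M →L[ℂ] M))
    {φ : A →ₗ[ℂ] C} {ψ : B →ₗ[ℂ] D} (hφ : IsCompletelyBounded φ) (hψ : IsCompletelyBounded ψ)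
    (x : A ⊗[ℂ] B) :
    map π ρ π' ρ' φ ψ (ofAlg π ρ x) = ofAlg π' ρ' (TensorProduct.map φ ψ x) := by
  obtain ⟨c, -, hc⟩ := exists_norm_ofAlg_map_le hπ hρ π' ρ' hφ hψ
  exact extend_ofAlg ⟨c, hc⟩ x

/-- The constant has to be exactly one: it makes `P ⊗ P` a contractive projection, to which
Tomiyama's theorem applies again. -/
theorem norm_map_apply_le_of_projection (hπ : Function.Injective π) (hρ : Function.Injective ρ)
    (π' : C →⋆ₐ[ℂ] (L →L[ℂ] L)) (ρ' : D →⋆ₐ[ℂ] (M →L[ℂ] M))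
    {i : C →⋆ₐ[ℂ] A} {P : A →ₗ[ℂ] C} (hP : ∀ a, ‖P a‖ ≤ ‖a‖) (hi : ∀ c, P (i c) = c)
    {j : D →⋆ₐ[ℂ] B} {Q : B →ₗ[ℂ] D} (hQ : ∀ b, ‖Q b‖ ≤ ‖b‖) (hj : ∀ d, Q (j d) = d)
    (x : spatialTensor π ρ) : ‖map π ρ π' ρ' P Q x‖ ≤ ‖x‖ := by
  rw [← one_mul ‖x‖]
  refine LinearMap.norm_extendOfNorm_apply_le (denseRange_ofAlg π ρ) 1 (fun x => ?_) x
  have := norm_ofAlg_map_le π' ρ' zero_le_one zero_le_one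
    (norm_matrixRep_map_le_of_projection hP hi hπ π')
    (norm_matrixRep_map_le_of_projection hQ hj hρ ρ') x
  rwa [one_mul] at this

/-- The functional is tensored as a map into `ℂ ⊗ B`, with `ℂ` acting on itself. The result has the
form `1 ⊗ b`, whose norm dominates `‖b‖` because `ρ` is isometric. -/
theorem exists_norm_lid_map_le {φ : A →ₗ[ℂ] ℂ} (hπ : Function.Injective π)
    (hρ : Function.Injective ρ) (hφ : IsCompletelyBounded φ) :
    ∃ c, ∀ x, ‖((TensorProduct.lid ℂ B).toLinearMap ∘ₗ
      TensorProduct.map φ LinearMap.id) x‖ ≤ c * ‖ofAlg π ρ x‖ := by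
  let τ : ℂ →⋆ₐ[ℂ] (ℂ →L[ℂ] ℂ) := StarAlgHom.ofId ℂ _
  obtain ⟨c, hc⟩ := hφ.exists_norm_matrixRep_le hπ τ
  refine ⟨|c|, fun x => ?_⟩
  refine le_trans ?_ (norm_ofAlg_map_left_le τ ρ (abs_nonneg c)
    (fun n N => (hc n N).trans (by gcongr; exact le_abs_self c)) x)
  set y := TensorProduct.map φ (LinearMap.id : B →ₗ[ℂ] B) x with hy
  have h1 : y = 1 ⊗ₜ[ℂ] TensorProduct.lid ℂ B y :=
    (TensorProduct.lid ℂ B).injective (by simp)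
  rw [LinearMap.comp_apply, ← hy, LinearEquiv.coe_coe]
  conv_rhs => rw [h1]
  rw [← NonUnitalStarAlgHom.norm_map ρ hρ]
  refine (le_norm_opTensor_one (H := ℂ) _).trans (le_of_eq ?_)
  rw [← map_one τ]
  rfl

theorem exists_norm_rid_map_le {φ : B →ₗ[ℂ] ℂ} (hπ : Function.Injective π)
    (hρ : Function.Injective ρ) (hφ : IsCompletelyBounded φ) :
    ∃ c, ∀ x, ‖((TensorProduct.rid ℂ A).toLinearMap ∘ₗ
      TensorProduct.map LinearMap.id φ) x‖ ≤ c * ‖ofAlg π ρ x‖ := by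
  obtain ⟨c, hc⟩ := exists_norm_lid_map_le hρ hπ hφ
  refine ⟨|c|, fun x => ?_⟩
  have h1 : ((TensorProduct.rid ℂ A).toLinearMap ∘ₗ TensorProduct.map LinearMap.id φ) x =
      ((TensorProduct.lid ℂ A).toLinearMap ∘ₗ TensorProduct.map φ LinearMap.id)
        (TensorProduct.comm ℂ A B x) := by
    induction x using TensorProduct.induction_on with
    | zero => simp
    | tmul a b => simp
    | add x y hx hy => simp only [map_add, hx, hy]
  have h2 : ‖ofAlg ρ π (TensorProduct.comm ℂ A B x)‖ ≤ ‖ofAlg π ρ x‖ := by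
    refine (norm_ofAlg_comm_le _ _ _).trans (le_of_eq ?_)
    rw [← LinearEquiv.trans_apply, TensorProduct.comm_trans_comm]
    rfl
  rw [h1]
  refine (hc _).trans ?_
  gcongr
  exact le_abs_self c

end Extend

section Assoc

variable (π : A →⋆ₐ[ℂ] (H →L[ℂ] H)) (ρ : B →⋆ₐ[ℂ] (K →L[ℂ] K)) (τ : C →⋆ₐ[ℂ] (L →L[ℂ] L))

theorem norm_ofAlg_tmul_le (a : A) (b : B) : ‖ofAlg π ρ (a ⊗ₜ b)‖ ≤ ‖a‖ * ‖b‖ :=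
  (norm_opTensor_le (π a) (ρ b)).trans (mul_le_mul (NonUnitalStarAlgHom.norm_apply_le π a)
    (NonUnitalStarAlgHom.norm_apply_le ρ b) (norm_nonneg _) (norm_nonneg _))

/-- The map `a ↦ a ⊗ b`. -/
def tmulRight (b : B) : A →L[ℂ] spatialTensor π ρ :=
  (ofAlg π ρ ∘ₗ (TensorProduct.mk ℂ A B).flip b).mkContinuous ‖b‖ fun a => by
    rw [mul_comm]
    exact norm_ofAlg_tmul_le π ρ a b

/-- The map `(A ⊙ B) ⊙ C → (A ⊗ B) ⊗ C`. -/
abbrev ofAlgLeft : (A ⊗[ℂ] B) ⊗[ℂ] C →ₗ[ℂ] spatialTensor (rep π ρ) τ :=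
  ofAlg (rep π ρ) τ ∘ₗ TensorProduct.map (ofAlg π ρ) LinearMap.id

/-- The map `(A ⊙ B) ⊙ C → A ⊗ (B ⊗ C)`. -/
abbrev ofAlgRight : (A ⊗[ℂ] B) ⊗[ℂ] C →ₗ[ℂ] spatialTensor π (rep ρ τ) :=
  ofAlg π (rep ρ τ) ∘ₗ TensorProduct.map LinearMap.id (ofAlg ρ τ) ∘ₗ
    (TensorProduct.assoc ℂ A B C).toLinearMap

theorem ofAlg_mem_topologicalClosure (T : spatialTensor π ρ) (c : C) :
    ofAlg (rep π ρ) τ (T ⊗ₜ c) ∈ (LinearMap.range (ofAlgLeft π ρ τ)).topologicalClosure := by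
  refine (denseRange_ofAlg π ρ).induction_on
    (p := fun T => ofAlg (rep π ρ) τ (T ⊗ₜ c) ∈
      (LinearMap.range (ofAlgLeft π ρ τ)).topologicalClosure) T
    ((Submodule.isClosed_topologicalClosure _).preimage (tmulRight (rep π ρ) τ c).continuous)
    fun x => Submodule.le_topologicalClosure _ ⟨x ⊗ₜ c, rfl⟩

theorem denseRange_ofAlgLeft : DenseRange (ofAlgLeft π ρ τ) := by
  have h : (LinearMap.range (ofAlgLeft π ρ τ)).topologicalClosure = ⊤ := by
    rw [eq_top_iff]
    rintro x -
    refine (denseRange_ofAlg (rep π ρ) τ).induction_on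
      (p := fun x => x ∈ (LinearMap.range (ofAlgLeft π ρ τ)).topologicalClosure) x
      (Submodule.isClosed_topologicalClosure _) fun x => ?_
    induction x using TensorProduct.induction_on with
    | zero => rw [map_zero]; exact Submodule.zero_mem _
    | add x y hx hy => rw [map_add]; exact Submodule.add_mem _ hx hy
    | tmul T c => exact ofAlg_mem_topologicalClosure π ρ τ T c
  rw [DenseRange, ← LinearMap.coe_range]
  exact Submodule.dense_iff_topologicalClosure_eq_top.2 h

/-- The isometry `W` intertwines the actions of `x` on the two bracketings of the Hilbert space
tensor product. This inequality alone gives continuity of `assoc`; surjectivity of `W` plays no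
role. -/
theorem norm_ofAlgRight_le (x : (A ⊗[ℂ] B) ⊗[ℂ] C) :
    ‖ofAlgRight π ρ τ x‖ ≤ ‖ofAlgLeft π ρ τ x‖ := by
  obtain ⟨W, hW⟩ := exists_isometry_assoc (H := H) (K := K) (L := L)
  have key : W.toContinuousLinearMap ∘L (ofAlgRight π ρ τ x :
        HilbertTensor H (HilbertTensor K L) →L[ℂ] HilbertTensor H (HilbertTensor K L)) =
      (ofAlgLeft π ρ τ x : HilbertTensor (HilbertTensor H K) L →L[ℂ]
        HilbertTensor (HilbertTensor H K) L) ∘L W.toContinuousLinearMap := by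
    refine ContinuousLinearMap.ext_on
      (Submodule.dense_iff_topologicalClosure_eq_top.2 hTmul_assoc_total) ?_
    rintro _ ⟨⟨u, v, w⟩, rfl⟩
    induction x using TensorProduct.induction_on with
    | zero => simp
    | add x y hx hy =>
      simp only [map_add, AddMemClass.coe_add, ContinuousLinearMap.comp_apply,
        _root_.add_apply] at hx hy ⊢
      rw [hx, hy]
    | tmul x c =>
      induction x using TensorProduct.induction_on with
      | zero => simp
      | add x y hx hy =>
        simp only [TensorProduct.add_tmul, map_add, AddMemClass.coe_add,
          ContinuousLinearMap.comp_apply, _root_.add_apply] at hx hy ⊢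
        rw [hx, hy]
      | tmul a b =>
        change W (opTensor (π a) (opTensor (ρ b) (τ c)) (hTmul u (hTmul v w))) =
          opTensor (opTensor (π a) (ρ b)) (τ c) (W (hTmul u (hTmul v w)))
        simp only [hW, opTensor_hTmul]
  refine ContinuousLinearMap.opNorm_le_bound _ (norm_nonneg _) fun v => ?_
  have h := congrArg (fun T => T v) key
  simp only [ContinuousLinearMap.comp_apply] at h
  have h2 := congrArg norm h
  rw [LinearIsometry.coe_toContinuousLinearMap, W.norm_map] at h2
  refine h2.trans_le ((ContinuousLinearMap.le_opNorm _ _).trans (le_of_eq ?_))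
  rw [W.norm_map]
  rfl

theorem assoc_ofAlg (a : A) (b : B) (c : C) :
    assoc π ρ τ (ofAlg (rep π ρ) τ (ofAlg π ρ (a ⊗ₜ b) ⊗ₜ c)) =
      ofAlg π (rep ρ τ) (a ⊗ₜ ofAlg ρ τ (b ⊗ₜ c)) :=
  LinearMap.extendOfNorm_eq (f := ofAlgRight π ρ τ) (e := ofAlgLeft π ρ τ)
    (denseRange_ofAlgLeft π ρ τ)
    ⟨1, fun x => by rw [one_mul]; exact norm_ofAlgRight_le π ρ τ x⟩ ((a ⊗ₜ b) ⊗ₜ c)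

variable {π ρ τ} in
theorem clm_ext_left {V : Type*} [NormedAddCommGroup V] [NormedSpace ℂ V]
    {f g : spatialTensor (rep π ρ) τ →L[ℂ] V}
    (h : ∀ a b c, f (ofAlg (rep π ρ) τ (ofAlg π ρ (a ⊗ₜ b) ⊗ₜ c)) =
      g (ofAlg (rep π ρ) τ (ofAlg π ρ (a ⊗ₜ b) ⊗ₜ c))) : f = g :=
  clm_ext fun T c => by
    have : f ∘L tmulRight (rep π ρ) τ c = g ∘L tmulRight (rep π ρ) τ c :=
      clm_ext fun a b => h a b c
    exact congrArg (fun F => F T) this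

end Assoc

end spatialTensor

/-! ### Functoriality of the tensor product and naturality of the associator -/

namespace spatialTensor

section Functoriality

variable {A B C A₁ B₁ C₁ A₂ B₂ D E H K L H₁ K₁ L₁ H₂ K₂ M N : Type*}
  [CStarAlgebra A] [CStarAlgebra B] [CStarAlgebra C] [CStarAlgebra A₁] [CStarAlgebra B₁]
  [CStarAlgebra C₁] [CStarAlgebra A₂] [CStarAlgebra B₂] [CStarAlgebra D] [CStarAlgebra E]
  [NormedAddCommGroup H] [InnerProductSpace ℂ H] [CompleteSpace H]
  [NormedAddCommGroup K] [InnerProductSpace ℂ K] [CompleteSpace K]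
  [NormedAddCommGroup L] [InnerProductSpace ℂ L] [CompleteSpace L]
  [NormedAddCommGroup H₁] [InnerProductSpace ℂ H₁] [CompleteSpace H₁]
  [NormedAddCommGroup K₁] [InnerProductSpace ℂ K₁] [CompleteSpace K₁]
  [NormedAddCommGroup L₁] [InnerProductSpace ℂ L₁] [CompleteSpace L₁]
  [NormedAddCommGroup H₂] [InnerProductSpace ℂ H₂] [CompleteSpace H₂]
  [NormedAddCommGroup K₂] [InnerProductSpace ℂ K₂] [CompleteSpace K₂]
  [NormedAddCommGroup M] [InnerProductSpace ℂ M] [CompleteSpace M]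
  [NormedAddCommGroup N] [InnerProductSpace ℂ N] [CompleteSpace N]
  {π : A →⋆ₐ[ℂ] (H →L[ℂ] H)} {ρ : B →⋆ₐ[ℂ] (K →L[ℂ] K)} {τ : C →⋆ₐ[ℂ] (L →L[ℂ] L)}
  {π₁ : A₁ →⋆ₐ[ℂ] (H₁ →L[ℂ] H₁)} {ρ₁ : B₁ →⋆ₐ[ℂ] (K₁ →L[ℂ] K₁)}
  {τ₁ : C₁ →⋆ₐ[ℂ] (L₁ →L[ℂ] L₁)}
  {π₂ : A₂ →⋆ₐ[ℂ] (H₂ →L[ℂ] H₂)} {ρ₂ : B₂ →⋆ₐ[ℂ] (K₂ →L[ℂ] K₂)}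

theorem apply_eq_of_ofAlg {V : Type*} [NormedAddCommGroup V] [NormedSpace ℂ V]
    {f g : spatialTensor π ρ →L[ℂ] V}
    (h : ∀ a b, f (ofAlg π ρ (a ⊗ₜ b)) = g (ofAlg π ρ (a ⊗ₜ b))) (x : spatialTensor π ρ) :
    f x = g x := by
  rw [clm_ext h]

theorem rep_injective (π : A →⋆ₐ[ℂ] (H →L[ℂ] H)) (ρ : B →⋆ₐ[ℂ] (K →L[ℂ] K)) :
    Function.Injective (rep π ρ) :=
  Subtype.val_injective

/-- A commuting square of tensor products of completely bounded maps. -/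
theorem map_map_eq_map_map (hπ : Function.Injective π) (hρ : Function.Injective ρ)
    (hπ₁ : Function.Injective π₁) (hρ₁ : Function.Injective ρ₁)
    (hπ₂ : Function.Injective π₂) (hρ₂ : Function.Injective ρ₂)
    (σ : D →⋆ₐ[ℂ] (M →L[ℂ] M)) (υ : E →⋆ₐ[ℂ] (N →L[ℂ] N))
    {φ₁ : A →ₗ[ℂ] A₁} {ψ₁ : B →ₗ[ℂ] B₁} {φ₁' : A₁ →ₗ[ℂ] D} {ψ₁' : B₁ →ₗ[ℂ] E}
    {φ₂ : A →ₗ[ℂ] A₂} {ψ₂ : B →ₗ[ℂ] B₂} {φ₂' : A₂ →ₗ[ℂ] D} {ψ₂' : B₂ →ₗ[ℂ] E}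
    (h₁ : IsCompletelyBounded φ₁) (k₁ : IsCompletelyBounded ψ₁)
    (h₁' : IsCompletelyBounded φ₁') (k₁' : IsCompletelyBounded ψ₁')
    (h₂ : IsCompletelyBounded φ₂) (k₂ : IsCompletelyBounded ψ₂)
    (h₂' : IsCompletelyBounded φ₂') (k₂' : IsCompletelyBounded ψ₂')
    (hφ : ∀ a, φ₁' (φ₁ a) = φ₂' (φ₂ a)) (hψ : ∀ b, ψ₁' (ψ₁ b) = ψ₂' (ψ₂ b))
    (x : spatialTensor π ρ) :
    map π₁ ρ₁ σ υ φ₁' ψ₁' (map π ρ π₁ ρ₁ φ₁ ψ₁ x) =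
      map π₂ ρ₂ σ υ φ₂' ψ₂' (map π ρ π₂ ρ₂ φ₂ ψ₂ x) := by
  refine apply_eq_of_ofAlg (f := map π₁ ρ₁ σ υ φ₁' ψ₁' ∘L map π ρ π₁ ρ₁ φ₁ ψ₁)
    (g := map π₂ ρ₂ σ υ φ₂' ψ₂' ∘L map π ρ π₂ ρ₂ φ₂ ψ₂) (fun a b => ?_) x
  rw [ContinuousLinearMap.comp_apply, ContinuousLinearMap.comp_apply, map_ofAlg hπ hρ _ _ h₁ k₁,
    map_ofAlg hπ hρ _ _ h₂ k₂, map_ofAlg hπ₁ hρ₁ _ _ h₁' k₁', map_ofAlg hπ₂ hρ₂ _ _ h₂' k₂']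
  simp only [TensorProduct.map_tmul, hφ, hψ]

/-- Naturality of the associativity isomorphism. -/
theorem assoc_map (hπ : Function.Injective π) (hτ : Function.Injective τ)
    {φ : A →ₗ[ℂ] A₁} {ψ : B →ₗ[ℂ] B₁} {χ : C →ₗ[ℂ] C₁}
    {Φ : spatialTensor π ρ →ₗ[ℂ] spatialTensor π₁ ρ₁}
    {Ψ : spatialTensor ρ τ →ₗ[ℂ] spatialTensor ρ₁ τ₁}
    (hφ : IsCompletelyBounded φ) (hχ : IsCompletelyBounded χ)
    (hΦ : IsCompletelyBounded Φ) (hΨ : IsCompletelyBounded Ψ)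
    (hΦφ : ∀ a b, Φ (ofAlg π ρ (a ⊗ₜ b)) = ofAlg π₁ ρ₁ (φ a ⊗ₜ ψ b))
    (hΨψ : ∀ b c, Ψ (ofAlg ρ τ (b ⊗ₜ c)) = ofAlg ρ₁ τ₁ (ψ b ⊗ₜ χ c))
    (x : spatialTensor (rep π ρ) τ) :
    assoc π₁ ρ₁ τ₁ (map (rep π ρ) τ (rep π₁ ρ₁) τ₁ Φ χ x) =
      map π (rep ρ τ) π₁ (rep ρ₁ τ₁) φ Ψ (assoc π ρ τ x) := by
  -- Both composites are continuous, so it is enough to compare them on tensors `(a ⊗ b) ⊗ c`, where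
  -- `Φ` and `Ψ` act as `φ ⊗ ψ` and `ψ ⊗ χ`.
  have h1 : ∀ a b c, map (rep π ρ) τ (rep π₁ ρ₁) τ₁ Φ χ
      (ofAlg (rep π ρ) τ (ofAlg π ρ (a ⊗ₜ b) ⊗ₜ c)) =
        ofAlg (rep π₁ ρ₁) τ₁ (ofAlg π₁ ρ₁ (φ a ⊗ₜ ψ b) ⊗ₜ χ c) := fun a b c => by
    have := map_ofAlg (rep_injective π ρ) hτ (rep π₁ ρ₁) τ₁ hΦ hχ (ofAlg π ρ (a ⊗ₜ b) ⊗ₜ c)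
    rwa [TensorProduct.map_tmul, hΦφ] at this
  have h2 : ∀ a b c, map π (rep ρ τ) π₁ (rep ρ₁ τ₁) φ Ψ
      (ofAlg π (rep ρ τ) (a ⊗ₜ ofAlg ρ τ (b ⊗ₜ c))) =
        ofAlg π₁ (rep ρ₁ τ₁) (φ a ⊗ₜ ofAlg ρ₁ τ₁ (ψ b ⊗ₜ χ c)) := fun a b c => by
    have := map_ofAlg hπ (rep_injective ρ τ) π₁ (rep ρ₁ τ₁) hφ hΨ (a ⊗ₜ ofAlg ρ τ (b ⊗ₜ c))
    rwa [TensorProduct.map_tmul, hΨψ] at this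
  have h3 : assoc π₁ ρ₁ τ₁ ∘L map (rep π ρ) τ (rep π₁ ρ₁) τ₁ Φ χ =
      map π (rep ρ τ) π₁ (rep ρ₁ τ₁) φ Ψ ∘L assoc π ρ τ :=
    clm_ext_left fun a b c =>
      (congrArg (assoc π₁ ρ₁ τ₁) (h1 a b c)).trans ((assoc_ofAlg π₁ ρ₁ τ₁ _ _ _).trans
        ((h2 a b c).symm.trans (congrArg (map π (rep ρ τ) π₁ (rep ρ₁ τ₁) φ Ψ)
          (assoc_ofAlg π ρ τ a b c).symm)))
  exact congrArg (fun F => F x) h3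

end Functoriality

end spatialTensor

/-! ### The hyperbialgebra structure on the range of the expectation -/

section Expectation

variable {A H : Type*} [CStarAlgebra A]
  [NormedAddCommGroup H] [InnerProductSpace ℂ H] [CompleteSpace H]
  {S : StarSubalgebra ℂ A} [hS : IsClosed (S : Set A)] {P : A →L[ℂ] S}

namespace IsConditionalExpectation

theorem norm_apply_le (hP : IsConditionalExpectation S P) (a : A) : ‖P.toLinearMap a‖ ≤ ‖a‖ := by
  have := P.le_opNorm a
  rwa [hP.norm_eq_one, one_mul] at this

theorem apply_subtype (hP : IsConditionalExpectation S P) (b : S) :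
    P.toLinearMap (S.subtype b) = b := hP.proj b

theorem isCompletelyBounded (hP : IsConditionalExpectation S P) :
    IsCompletelyBounded P.toLinearMap :=
  isCompletelyBounded_of_projection hP.norm_apply_le hP.apply_subtype

theorem isCompletelyBounded_expectationEnd (hP : IsConditionalExpectation S P) :
    IsCompletelyBounded (expectationEnd S P) :=
  (isCompletelyBounded_starAlgHom S.subtype).comp hP.isCompletelyBounded

end IsConditionalExpectation

theorem isCompletelyBounded_id : IsCompletelyBounded (LinearMap.id : A →ₗ[ℂ] A) :=
  isCompletelyBounded_starAlgHom (StarAlgHom.id ℂ A)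

omit hS in
variable (S) in
theorem restrictRep_injective {π : A →⋆ₐ[ℂ] (H →L[ℂ] H)} (hπ : Function.Injective π) :
    Function.Injective (restrictRep S π) :=
  hπ.comp Subtype.val_injective

-- Since `S` is represented by restricting `π`, both tensor products live on `H ⊗ H`, and the
-- inclusion `S ⊗ S ⊆ A ⊗ A` is a literal inclusion of operator algebras.
variable (S) in
theorem spatialTensor_restrictRep_le (π : A →⋆ₐ[ℂ] (H →L[ℂ] H)) :
    spatialTensor (restrictRep S π) (restrictRep S π) ≤ spatialTensor π π := by
  refine StarSubalgebra.topologicalClosure_mono (StarAlgebra.adjoin_mono ?_)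
  rintro _ ⟨p, rfl⟩
  exact ⟨(p.1, p.2), rfl⟩

variable (S) in
/-- The inclusion `S ⊗ S ⊆ A ⊗ A`. -/
def restrictIncl (π : A →⋆ₐ[ℂ] (H →L[ℂ] H)) :
    spatialTensor (restrictRep S π) (restrictRep S π) →⋆ₐ[ℂ] spatialTensor π π :=
  StarSubalgebra.inclusion (spatialTensor_restrictRep_le S π)

theorem norm_restrictIncl (π : A →⋆ₐ[ℂ] (H →L[ℂ] H))
    (x : spatialTensor (restrictRep S π) (restrictRep S π)) : ‖restrictIncl S π x‖ = ‖x‖ := by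
  have h : Function.Injective (restrictIncl S π) :=
    Set.inclusion_injective (spatialTensor_restrictRep_le S π)
  exact NonUnitalStarAlgHom.norm_map (restrictIncl S π) h x

theorem restrictIncl_ofAlg (π : A →⋆ₐ[ℂ] (H →L[ℂ] H)) (x : S ⊗[ℂ] S) :
    restrictIncl S π (spatialTensor.ofAlg (restrictRep S π) (restrictRep S π) x) =
      spatialTensor.ofAlg π π (TensorProduct.map S.subtype.toAlgHom.toLinearMap
        S.subtype.toAlgHom.toLinearMap x) := by
  induction x using TensorProduct.induction_on with
  | zero => simp
  | add x y hx hy => simp only [map_add, hx, hy]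
  | tmul a b => rfl

variable (S) in
/-- The inclusion `S ⊗ S ⊆ A ⊗ A`, as a continuous linear map. -/
def restrictInclL (π : A →⋆ₐ[ℂ] (H →L[ℂ] H)) :
    spatialTensor (restrictRep S π) (restrictRep S π) →L[ℂ] spatialTensor π π :=
  (restrictIncl S π).toAlgHom.toLinearMap.mkContinuous 1 fun x => by
    rw [one_mul]; exact (norm_restrictIncl π x).le

theorem restrictInclL_ofAlg (π : A →⋆ₐ[ℂ] (H →L[ℂ] H)) (x : S ⊗[ℂ] S) :
    restrictInclL S π (spatialTensor.ofAlg (restrictRep S π) (restrictRep S π) x) =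
      spatialTensor.ofAlg π π (TensorProduct.map S.subtype.toAlgHom.toLinearMap
        S.subtype.toAlgHom.toLinearMap x) := restrictIncl_ofAlg π x

variable (P) in
/-- The map `P ⊗ P : A ⊗ A → S ⊗ S`. -/
def expectationTensor (π : A →⋆ₐ[ℂ] (H →L[ℂ] H)) :
    spatialTensor π π →L[ℂ] spatialTensor (restrictRep S π) (restrictRep S π) :=
  spatialTensor.map π π (restrictRep S π) (restrictRep S π) P.toLinearMap P.toLinearMap

section

variable {π : A →⋆ₐ[ℂ] (H →L[ℂ] H)} (hπ : Function.Injective π)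
  (hP : IsConditionalExpectation S P)

include hπ hP

theorem expectationTensor_ofAlg (x : A ⊗[ℂ] A) :
    expectationTensor P π (spatialTensor.ofAlg π π x) =
      spatialTensor.ofAlg (restrictRep S π) (restrictRep S π)
        (TensorProduct.map P.toLinearMap P.toLinearMap x) :=
  spatialTensor.map_ofAlg hπ hπ _ _ hP.isCompletelyBounded hP.isCompletelyBounded x

theorem norm_expectationTensor_le (x : spatialTensor π π) :
    ‖expectationTensor P π x‖ ≤ ‖x‖ :=
  spatialTensor.norm_map_apply_le_of_projection hπ hπ _ _ hP.norm_apply_le hP.apply_subtype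
    hP.norm_apply_le hP.apply_subtype x

theorem expectationTensor_tmul (a b : A) :
    (expectationTensor P π).toLinearMap (spatialTensor.ofAlg π π (a ⊗ₜ b)) =
      spatialTensor.ofAlg (restrictRep S π) (restrictRep S π)
        (P.toLinearMap a ⊗ₜ P.toLinearMap b) :=
  expectationTensor_ofAlg hπ hP (a ⊗ₜ b)

theorem expectationTensor_restrictInclL
    (x : spatialTensor (restrictRep S π) (restrictRep S π)) :
    expectationTensor P π (restrictInclL S π x) = x := by
  refine spatialTensor.apply_eq_of_ofAlg (f := expectationTensor P π ∘L restrictInclL S π)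
    (g := ContinuousLinearMap.id ℂ _) (fun a b => ?_) x
  rw [ContinuousLinearMap.comp_apply, restrictInclL_ofAlg, expectationTensor_ofAlg hπ hP,
    TensorProduct.map_tmul, TensorProduct.map_tmul, ContinuousLinearMap.id_apply]
  exact congrArg₂ (fun s t : S => spatialTensor.ofAlg (restrictRep S π) (restrictRep S π)
    (s ⊗ₜ t)) (hP.proj a) (hP.proj b)

/-- The compatibility identities concern maps into `A ⊗ A`, while the new coproduct takes values in
`S ⊗ S`; this translates between the two. -/
theorem restrictInclL_expectationTensor (x : spatialTensor π π) :
    restrictInclL S π (expectationTensor P π x) =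
      spatialTensor.map π π π π (expectationEnd S P) (expectationEnd S P) x := by
  refine spatialTensor.apply_eq_of_ofAlg (f := restrictInclL S π ∘L expectationTensor P π)
    (fun a b => ?_) x
  rw [ContinuousLinearMap.comp_apply, expectationTensor_ofAlg hπ hP, restrictInclL_ofAlg,
    spatialTensor.map_ofAlg hπ hπ _ _ hP.isCompletelyBounded_expectationEnd
      hP.isCompletelyBounded_expectationEnd]
  rfl

/-- `P ⊗ P` is contractive and a left inverse of the inclusion `S ⊗ S ⊆ A ⊗ A`, so the result on
projections of norm one applies to it. -/
theorem isCompletelyPositive_expectationTensor :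
    IsCompletelyPositive (expectationTensor P π).toLinearMap :=
  isCompletelyPositive_of_projection (i := restrictIncl S π)
    (norm_expectationTensor_le hπ hP) (expectationTensor_restrictInclL hπ hP)

theorem expectationTensor_one : expectationTensor P π 1 = 1 := by
  have := expectationTensor_restrictInclL hπ hP 1
  rwa [show restrictInclL S π 1 = 1 from map_one (restrictIncl S π)] at this

variable {Δ : A →ₗ[ℂ] spatialTensor π π} {ε : A →⋆ₐ[ℂ] ℂ}

/-- By the left compatibility identity, `(P ⊗ P) Δ(P a) = (P ⊗ id) Δ(P (P a)) = (P ⊗ id) Δ(P a) = (P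
⊗ P) Δ a`, first inside `A ⊗ A`. Applying `P ⊗ P` brings this back to `S ⊗ S`. -/
theorem expectationTensor_comul_apply (hPΔ : IsCompatibleExpectation S π Δ P) (a : A) :
    expectationTensor P π (Δ (P a)) = expectationTensor P π (Δ a) := by
  have h1 : spatialTensor.map π π π π (expectationEnd S P) (expectationEnd S P) (Δ (P a)) =
      spatialTensor.map π π π π (expectationEnd S P) (expectationEnd S P) (Δ a) := by
    rw [← hPΔ.left, ← hPΔ.left, hP.proj]
  rw [← expectationTensor_restrictInclL hπ hP (expectationTensor P π (Δ (P a))),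
    restrictInclL_expectationTensor hπ hP, h1, ← restrictInclL_expectationTensor hπ hP,
    expectationTensor_restrictInclL hπ hP]

theorem restrictCoproduct_apply_expectation (hPΔ : IsCompatibleExpectation S π Δ P) (a : A) :
    restrictCoproduct S π Δ P (P a) = expectationTensor P π (Δ a) :=
  expectationTensor_comul_apply hπ hP hPΔ a

theorem isCompletelyPositive_restrictCoproduct (hΔ : IsCompletelyPositive Δ) :
    IsCompletelyPositive (restrictCoproduct S π Δ P) :=
  (isCompletelyPositive_expectationTensor hπ hP).comp
    (hΔ.comp (isCompletelyPositive_starAlgHom S.subtype))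

theorem restrictCoproduct_one (hΔ : Δ 1 = 1) : restrictCoproduct S π Δ P 1 = 1 := by
  change expectationTensor P π (Δ 1) = 1
  rw [hΔ, expectationTensor_one hπ hP]

theorem isCompletelyBounded_expectationTensor :
    IsCompletelyBounded (expectationTensor P π).toLinearMap :=
  (isCompletelyPositive_expectationTensor hπ hP).isCompletelyBounded
    (expectationTensor_one hπ hP)

/-- By the intertwining relation, `(Δ̃ ⊗ id)(P ⊗ P) = ((P ⊗ P) ⊗ P)(Δ ⊗ id)` and likewise on the
other leg. Naturality of the associator then moves the projections outside, and coassociativity of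
`Δ` finishes. -/
theorem coassoc_restrictCoproduct (hA : IsCStarHyperbialgebra π Δ ε)
    (hPΔ : IsCompatibleExpectation S π Δ P) (s : S) :
    spatialTensor.assoc (restrictRep S π) (restrictRep S π) (restrictRep S π)
        (spatialTensor.map (restrictRep S π) (restrictRep S π)
          (spatialTensor.rep (restrictRep S π) (restrictRep S π)) (restrictRep S π)
          (restrictCoproduct S π Δ P) LinearMap.id (restrictCoproduct S π Δ P s)) =
      spatialTensor.map (restrictRep S π) (restrictRep S π) (restrictRep S π)
        (spatialTensor.rep (restrictRep S π) (restrictRep S π))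
        LinearMap.id (restrictCoproduct S π Δ P) (restrictCoproduct S π Δ P s) := by
  have hcb := isCompletelyBounded_expectationTensor hπ hP
  have hΔS := (isCompletelyPositive_restrictCoproduct hπ hP
    hA.completelyPositive).isCompletelyBounded (restrictCoproduct_one hπ hP hA.map_one)
  have hΔ := hA.completelyPositive.isCompletelyBounded hA.map_one
  have hπS := restrictRep_injective S hπ
  have hPcb := hP.isCompletelyBounded
  have hleft := spatialTensor.map_map_eq_map_map hπ hπ hπS hπS
    (spatialTensor.rep_injective π π) hπ
    (spatialTensor.rep (restrictRep S π) (restrictRep S π)) (restrictRep S π)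
    hPcb hPcb hΔS isCompletelyBounded_id hΔ isCompletelyBounded_id hcb hPcb
    (restrictCoproduct_apply_expectation hπ hP hPΔ) (fun b => rfl) (Δ s)
  have hright := spatialTensor.map_map_eq_map_map hπ hπ hπS hπS
    hπ (spatialTensor.rep_injective π π) (restrictRep S π)
    (spatialTensor.rep (restrictRep S π) (restrictRep S π))
    hPcb hPcb isCompletelyBounded_id hΔS isCompletelyBounded_id hΔ hPcb hcb
    (fun b => rfl) (restrictCoproduct_apply_expectation hπ hP hPΔ) (Δ s)
  refine (congrArg _ hleft).trans (Eq.trans ?_ hright.symm)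
  rw [spatialTensor.assoc_map hπ hπ hPcb hPcb hcb hcb (expectationTensor_tmul hπ hP)
    (expectationTensor_tmul hπ hP), hA.coassoc]

/-- On `Δ s`, `P ⊗ P` may be replaced by `id ⊗ P`, which commutes with `ε ⊗ id`. What remains is
`P((ε ⊗ id) Δ s) = P s = s`. -/
theorem counit_left_restrictCoproduct (hA : IsCStarHyperbialgebra π Δ ε)
    (hPΔ : IsCompatibleExpectation S π Δ P) (s : S) :
    spatialTensor.extend (restrictRep S π) (restrictRep S π)
      ((TensorProduct.lid ℂ S).toLinearMap ∘ₗ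
        TensorProduct.map ((restrictCounit S ε).toAlgHom.toLinearMap) LinearMap.id)
      (restrictCoproduct S π Δ P s) = s := by
  have hπS := restrictRep_injective S hπ
  have hbS := spatialTensor.exists_norm_lid_map_le hπS hπS
    (isCompletelyBounded_starAlgHom (restrictCounit S ε))
  have hbA := spatialTensor.exists_norm_lid_map_le hπ hπ (isCompletelyBounded_starAlgHom ε)
  let ι : S →L[ℂ] A := S.toSubmodule.subtypeL
  have h1 : ι ∘L spatialTensor.extend (restrictRep S π) (restrictRep S π)
      ((TensorProduct.lid ℂ S).toLinearMap ∘ₗ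
        TensorProduct.map ((restrictCounit S ε).toAlgHom.toLinearMap) LinearMap.id) =
      spatialTensor.extend π π ((TensorProduct.lid ℂ A).toLinearMap ∘ₗ
        TensorProduct.map (ε.toAlgHom.toLinearMap) LinearMap.id) ∘L restrictInclL S π :=
    spatialTensor.clm_ext fun a b => by
      rw [ContinuousLinearMap.comp_apply, ContinuousLinearMap.comp_apply, restrictInclL_ofAlg,
        spatialTensor.extend_ofAlg hbS, spatialTensor.extend_ofAlg hbA]
      rfl
  have h2 : spatialTensor.extend π π ((TensorProduct.lid ℂ A).toLinearMap ∘ₗ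
        TensorProduct.map (ε.toAlgHom.toLinearMap) LinearMap.id) ∘L
          spatialTensor.map π π π π LinearMap.id (expectationEnd S P) =
      (ι ∘L P) ∘L spatialTensor.extend π π ((TensorProduct.lid ℂ A).toLinearMap ∘ₗ
        TensorProduct.map (ε.toAlgHom.toLinearMap) LinearMap.id) :=
    spatialTensor.clm_ext fun a b => by
      rw [ContinuousLinearMap.comp_apply, ContinuousLinearMap.comp_apply,
        spatialTensor.map_ofAlg hπ hπ _ _ isCompletelyBounded_id
          hP.isCompletelyBounded_expectationEnd, spatialTensor.extend_ofAlg hbA,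
        spatialTensor.extend_ofAlg hbA]
      exact (map_smul (ι ∘L P) (ε a) b).symm
  refine Subtype.ext ?_
  refine (congrArg (fun F => F (expectationTensor P π (Δ s))) h1).trans ?_
  rw [ContinuousLinearMap.comp_apply, restrictInclL_expectationTensor hπ hP, hPΔ.right]
  refine (congrArg (fun F => F (Δ s)) h2).trans ?_
  rw [ContinuousLinearMap.comp_apply, hA.counit_left]
  exact congrArg Subtype.val (hP.proj s)

/-- Here the other identity is the useful one: `(P ⊗ P) Δ s = (P ⊗ id) Δ(P s)` keeps `P` off the leg
on which `ε` acts. -/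
theorem counit_right_restrictCoproduct (hA : IsCStarHyperbialgebra π Δ ε)
    (hPΔ : IsCompatibleExpectation S π Δ P) (s : S) :
    spatialTensor.extend (restrictRep S π) (restrictRep S π)
      ((TensorProduct.rid ℂ S).toLinearMap ∘ₗ
        TensorProduct.map LinearMap.id ((restrictCounit S ε).toAlgHom.toLinearMap))
      (restrictCoproduct S π Δ P s) = s := by
  have hπS := restrictRep_injective S hπ
  have hbS := spatialTensor.exists_norm_rid_map_le hπS hπS
    (isCompletelyBounded_starAlgHom (restrictCounit S ε))
  have hbA := spatialTensor.exists_norm_rid_map_le hπ hπ (isCompletelyBounded_starAlgHom ε)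
  let ι : S →L[ℂ] A := S.toSubmodule.subtypeL
  have h1 : ι ∘L spatialTensor.extend (restrictRep S π) (restrictRep S π)
      ((TensorProduct.rid ℂ S).toLinearMap ∘ₗ
        TensorProduct.map LinearMap.id ((restrictCounit S ε).toAlgHom.toLinearMap)) =
      spatialTensor.extend π π ((TensorProduct.rid ℂ A).toLinearMap ∘ₗ
        TensorProduct.map LinearMap.id (ε.toAlgHom.toLinearMap)) ∘L restrictInclL S π :=
    spatialTensor.clm_ext fun a b => by
      rw [ContinuousLinearMap.comp_apply, ContinuousLinearMap.comp_apply, restrictInclL_ofAlg,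
        spatialTensor.extend_ofAlg hbS, spatialTensor.extend_ofAlg hbA]
      rfl
  have h2 : spatialTensor.extend π π ((TensorProduct.rid ℂ A).toLinearMap ∘ₗ
        TensorProduct.map LinearMap.id (ε.toAlgHom.toLinearMap)) ∘L
          spatialTensor.map π π π π (expectationEnd S P) LinearMap.id =
      (ι ∘L P) ∘L spatialTensor.extend π π ((TensorProduct.rid ℂ A).toLinearMap ∘ₗ
        TensorProduct.map LinearMap.id (ε.toAlgHom.toLinearMap)) :=
    spatialTensor.clm_ext fun a b => by
      rw [ContinuousLinearMap.comp_apply, ContinuousLinearMap.comp_apply,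
        spatialTensor.map_ofAlg hπ hπ _ _ hP.isCompletelyBounded_expectationEnd
          isCompletelyBounded_id, spatialTensor.extend_ofAlg hbA,
        spatialTensor.extend_ofAlg hbA]
      exact (map_smul (ι ∘L P) (ε b) a).symm
  refine Subtype.ext ?_
  refine (congrArg (fun F => F (expectationTensor P π (Δ s))) h1).trans ?_
  rw [ContinuousLinearMap.comp_apply, restrictInclL_expectationTensor hπ hP, ← hPΔ.left]
  refine (congrArg (fun F => F (Δ (P (s : A)))) h2).trans ?_
  rw [ContinuousLinearMap.comp_apply, hA.counit_right, hP.proj]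
  exact congrArg Subtype.val (hP.proj s)

/-- The range of a compatible conditional expectation is a C⋆-hyperbialgebra. -/
theorem isCStarHyperbialgebra_restrict (hA : IsCStarHyperbialgebra π Δ ε)
    (hPΔ : IsCompatibleExpectation S π Δ P) :
    IsCStarHyperbialgebra (restrictRep S π) (restrictCoproduct S π Δ P) (restrictCounit S ε) where
  completelyPositive := isCompletelyPositive_restrictCoproduct hπ hP hA.completelyPositive
  map_one := restrictCoproduct_one hπ hP hA.map_one
  coassoc := coassoc_restrictCoproduct hπ hP hA hPΔ
  counit_left := counit_left_restrictCoproduct hπ hP hA hPΔ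
  counit_right := counit_right_restrictCoproduct hπ hP hA hPΔ

end

end Expectation

/-! ### Restriction, truncation and density of step functions -/

section StepFunctions

variable {k : Type*} [NormedAddCommGroup k] [InnerProductSpace ℂ k]

theorem L2on.coeFn_restrict {I : Set ℝ} (hI : MeasurableSet I)
    (f : Lp k 2 (volume : Measure ℝ)) :
    (L2on.restrict hI f : Lp k 2 (volume : Measure ℝ)) =ᵐ[volume] I.indicator f :=
  ((Lp.memLp f).indicator hI).coeFn_toLp

theorem L2on.restrict_congr {I : Set ℝ} (hI : MeasurableSet I)
    {f g : Lp k 2 (volume : Measure ℝ)} (h : ∀ᵐ r : ℝ, r ∈ I → f r = g r) :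
    L2on.restrict hI f = L2on.restrict hI g := by
  refine Subtype.ext (Lp.ext ?_)
  filter_upwards [L2on.coeFn_restrict hI f, L2on.coeFn_restrict hI g, h] with r h1 h2 h3
  rw [h1, h2]
  by_cases hr : r ∈ I
  · rw [Set.indicator_of_mem hr, Set.indicator_of_mem hr, h3 hr]
  · rw [Set.indicator_of_notMem hr, Set.indicator_of_notMem hr]

theorem L2on.restrict_eq_self {I : Set ℝ} (hI : MeasurableSet I) (f : L2on k I) :
    L2on.restrict hI (f : Lp k 2 (volume : Measure ℝ)) = f := by
  refine Subtype.ext (Lp.ext ?_)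
  have hf : ∀ᵐ r : ℝ, r ∉ I → (f : Lp k 2 (volume : Measure ℝ)) r = 0 := f.2
  filter_upwards [L2on.coeFn_restrict hI (f : Lp k 2 (volume : Measure ℝ)), hf] with r h1 h2
  rw [h1]
  by_cases hr : r ∈ I
  · rw [Set.indicator_of_mem hr]
  · rw [Set.indicator_of_notMem hr, h2 hr]

theorem L2on.restrict_eq_zero {I J : Set ℝ} (hI : MeasurableSet I) (h : Disjoint I J)
    {f : Lp k 2 (volume : Measure ℝ)} (hf : f ∈ L2on k J) : L2on.restrict hI f = 0 := by
  rw [← map_zero (L2on.restrict (k := k) hI)]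
  refine L2on.restrict_congr hI ?_
  have hf : ∀ᵐ r : ℝ, r ∉ J → f r = 0 := hf
  filter_upwards [hf, Lp.coeFn_zero k 2 (volume : Measure ℝ)] with r h1 h2 hr
  rw [h1 (Set.disjoint_left.1 h hr), h2]; rfl

theorem L2on.continuous_restrict {I : Set ℝ} (hI : MeasurableSet I) :
    Continuous (L2on.restrict (k := k) hI) := by
  refine AddMonoidHomClass.continuous_of_bound (L2on.restrict (k := k) hI) 1 fun f => ?_
  rw [one_mul]
  refine Lp.norm_le_norm_of_ae_le ?_
  filter_upwards [L2on.coeFn_restrict hI f] with r hr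
  exact (congrArg norm hr).le.trans (norm_indicator_le_norm_self f r)

theorem L2on.incl_restrict_add (t : ℝ≥0) (f : Lp k 2 (volume : Measure ℝ)) :
    L2on.incl (show Set.Ico (0 : ℝ) t ⊆ Set.Ici 0 from Set.Ico_subset_Ici_self)
        (L2on.restrict measurableSet_Ico f) +
      L2on.incl (Set.Ici_subset_Ici.2 (show (0 : ℝ) ≤ t from t.2))
        (L2on.restrict measurableSet_Ici f) =
      L2on.restrict measurableSet_Ici f := by
  refine Subtype.ext (Lp.ext ?_)
  refine (Lp.coeFn_add _ _).trans ?_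
  filter_upwards [L2on.coeFn_restrict (measurableSet_Ico (a := (0 : ℝ)) (b := (t : ℝ))) f,
    L2on.coeFn_restrict (measurableSet_Ici (a := (t : ℝ))) f,
    L2on.coeFn_restrict (measurableSet_Ici (a := (0 : ℝ))) f] with r h1 h2 h3
  refine (congrArg₂ (· + ·) h1 h2).trans (Eq.trans ?_ h3.symm)
  have ht : (0 : ℝ) ≤ t := t.2
  by_cases hr : 0 ≤ r <;> by_cases hr' : r < t <;>
    simp only [Set.indicator, Set.mem_Ico, Set.mem_Ici, hr, hr', not_le.2, not_lt.1, if_true,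
      if_false, true_and, false_and, add_zero, zero_add, not_false_iff]
  exact absurd (ht.trans (not_lt.1 hr')) hr

/-- A step function may be cut off at time `t`. -/
theorem exists_mem_stepSpan_truncation (t : ℝ≥0) {f : Lp k 2 (volume : Measure ℝ)}
    (hf : f ∈ stepSpan k) : ∃ g ∈ stepSpan k,
      L2on.restrict (measurableSet_Ico (a := (0 : ℝ)) (b := (t : ℝ))) g =
        L2on.restrict measurableSet_Ico f ∧
      L2on.restrict (measurableSet_Ici (a := (t : ℝ))) g = 0 := by
  induction hf using Submodule.span_induction with
  | zero => exact ⟨0, zero_mem _, rfl, map_zero _⟩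
  | add f f' _ _ h h' =>
    obtain ⟨g, hg, h1, h2⟩ := h
    obtain ⟨g', hg', h1', h2'⟩ := h'
    exact ⟨g + g', add_mem hg hg', by rw [map_add, map_add, h1, h1'],
      by rw [map_add, h2, h2', add_zero]⟩
  | smul c f _ h =>
    obtain ⟨g, hg, h1, h2⟩ := h
    exact ⟨c • g, Submodule.smul_mem _ c hg, by rw [map_smul, map_smul, h1],
      by rw [map_smul, h2, smul_zero]⟩
  | mem f hf =>
    obtain ⟨⟨d, s⟩, rfl⟩ := hf
    -- Cutting `d_{[0,s[}` at `t` gives `d_{[0,min s t[}`, again a generator.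
    refine ⟨_, Submodule.subset_span ⟨(d, min s t), rfl⟩, L2on.restrict_congr _ ?_, ?_⟩
    · filter_upwards [indicatorConstLp_coeFn (p := 2) (c := d) (μ := (volume : Measure ℝ))
        (hs := measurableSet_Ico (a := (0 : ℝ)) (b := ((min s t : ℝ≥0) : ℝ)))
        (hμs := measure_Ico_lt_top.ne), indicatorConstLp_coeFn (p := 2) (c := d)
        (μ := (volume : Measure ℝ)) (hs := measurableSet_Ico (a := (0 : ℝ)) (b := (s : ℝ)))
        (hμs := measure_Ico_lt_top.ne)] with r h1 h2 hr
      rw [h1, h2]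
      simp only [Set.indicator, Set.mem_Ico, NNReal.coe_min, lt_min_iff, hr.2, and_true]
    · rw [← map_zero (L2on.restrict (k := k) measurableSet_Ici)]
      refine L2on.restrict_congr _ ?_
      filter_upwards [indicatorConstLp_coeFn (p := 2) (c := d) (μ := (volume : Measure ℝ))
        (hs := measurableSet_Ico (a := (0 : ℝ)) (b := ((min s t : ℝ≥0) : ℝ)))
        (hμs := measure_Ico_lt_top.ne), Lp.coeFn_zero k 2 (volume : Measure ℝ)] with r h1 h2 hr
      rw [h1, h2]
      refine Set.indicator_of_notMem (fun h => ?_) _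
      rw [Set.mem_Ico, NNReal.coe_min, lt_min_iff] at h
      exact absurd hr (not_le.2 h.2.2)

/-- The indicator function of the interval with endpoints `0` and `b`, times a vector. -/
def centredStep (p : k × ℝ) : Lp k 2 (volume : Measure ℝ) :=
  indicatorConstLp 2 (measurableSet_Ico (a := min 0 p.2) (b := max 0 p.2))
    measure_Ico_lt_top.ne p.1

/-- A function orthogonal to all these steps has vanishing integral from `0` to every `b`, and so is
zero almost everywhere by Lebesgue differentiation. Negative `b` is admitted so that this can be
argued on the whole line. -/
theorem centredStep_total [CompleteSpace k] :
    (Submodule.span ℂ (Set.range (centredStep (k := k)))).topologicalClosure = ⊤ := by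
  rw [Submodule.topologicalClosure_eq_top_iff, Submodule.eq_bot_iff]
  intro f hf
  have h1 : ∀ b : ℝ, ∫ x in Set.Ico (min 0 b) (max 0 b), f x = 0 := by
    intro b
    refine ext_inner_left ℂ fun d => ?_
    rw [inner_zero_right, ← L2.inner_indicatorConstLp_eq_inner_setIntegral (𝕜 := ℂ)
      measurableSet_Ico measure_Ico_lt_top.ne]
    exact hf _ (Submodule.subset_span ⟨(d, b), rfl⟩)
  have h2 : ∀ b : ℝ, ∫ x in (0 : ℝ)..b, f x = 0 := by
    intro b
    rw [intervalIntegral.intervalIntegral_eq_integral_uIoc, Set.uIoc,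
      ← integral_Ico_eq_integral_Ioc, h1, smul_zero]
  refine Lp.ext ?_
  filter_upwards [LocallyIntegrable.ae_hasDerivAt_integral
      ((Lp.memLp f).locallyIntegrable one_le_two),
    Lp.coeFn_zero k 2 (volume : Measure ℝ)] with x h3 h4
  rw [h4]
  have h5 := h3 0
  simp only [h2] at h5
  exact h5.unique (hasDerivAt_const x 0)

theorem exists_mem_stepSpan_restrict_eq {f : Lp k 2 (volume : Measure ℝ)}
    (hf : f ∈ Submodule.span ℂ (Set.range (centredStep (k := k)))) : ∃ g ∈ stepSpan k,
      L2on.restrict (measurableSet_Ici (a := (0 : ℝ))) g = L2on.restrict measurableSet_Ici f := by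
  induction hf using Submodule.span_induction with
  | zero => exact ⟨0, zero_mem _, rfl⟩
  | add f f' _ _ h h' =>
    obtain ⟨g, hg, h1⟩ := h
    obtain ⟨g', hg', h1'⟩ := h'
    exact ⟨g + g', add_mem hg hg', by rw [map_add, map_add, h1, h1']⟩
  | smul c f _ h =>
    obtain ⟨g, hg, h1⟩ := h
    exact ⟨c • g, Submodule.smul_mem _ c hg, by rw [map_smul, map_smul, h1]⟩
  | mem f hf =>
    obtain ⟨⟨d, b⟩, rfl⟩ := hf
    -- For negative `b` the witness is `d_{[0,0[} = 0`, as it should be: the centred step then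
    -- vanishes on the half-line.
    refine ⟨_, Submodule.subset_span ⟨(d, b.toNNReal), rfl⟩, L2on.restrict_congr _ ?_⟩
    filter_upwards [indicatorConstLp_coeFn (p := 2) (c := d) (μ := (volume : Measure ℝ))
      (hs := measurableSet_Ico (a := (0 : ℝ)) (b := (b.toNNReal : ℝ)))
      (hμs := measure_Ico_lt_top.ne), indicatorConstLp_coeFn (p := 2) (c := d)
      (μ := (volume : Measure ℝ)) (hs := measurableSet_Ico (a := min 0 b) (b := max 0 b))
      (hμs := measure_Ico_lt_top.ne)] with r h1 h2 hr
    have hr : 0 ≤ r := hr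
    rw [h1, centredStep, h2]
    simp only [Set.indicator, Set.mem_Ico, Real.coe_toNNReal', hr, true_and, max_comm b,
      (min_le_left 0 b).trans hr]

/-- A closed property of square integrable functions on the half-line that holds for step functions
holds for all of them. -/
theorem stepSpan_induction [CompleteSpace k] {p : Lp k 2 (volume : Measure ℝ) → Prop}
    (hp : IsClosed {f | p f}) (hstep : ∀ f ∈ stepSpan k, p f)
    (hcongr : ∀ f g, L2on.restrict (measurableSet_Ici (a := (0 : ℝ))) f =
      L2on.restrict measurableSet_Ici g → p f → p g) (f : Lp k 2 (volume : Measure ℝ)) : p f := by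
  have hd := (Submodule.dense_iff_topologicalClosure_eq_top).2 (centredStep_total (k := k))
  refine hd.induction (P := p) (fun g hg => ?_) hp f
  obtain ⟨g', hg', h⟩ := exists_mem_stepSpan_restrict_eq hg
  exact hcongr g' g h (hstep g' hg')

end StepFunctions

/-! ### Totality and continuity of exponential vectors -/

section Compression

variable {H H' K K' L : Type*} [NormedAddCommGroup H] [InnerProductSpace ℂ H]
  [NormedAddCommGroup K] [InnerProductSpace ℂ K] [NormedAddCommGroup L] [InnerProductSpace ℂ L]

/-- The operator `x ↦ x ⊗ y`. -/
def hTmulRight (H : Type*) [NormedAddCommGroup H] [InnerProductSpace ℂ H] (y : K) :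
    H →L[ℂ] HilbertTensor H K :=
  HilbertTensor.ofAlg.toContinuousLinearMap.comp ((TensorProduct.mkL ℂ H K).flip y)

theorem hTmul_ext_of_total {ι κ : Type*} {v : ι → H} {w : κ → K}
    (hv : (Submodule.span ℂ (Set.range v)).topologicalClosure = ⊤)
    (hw : (Submodule.span ℂ (Set.range w)).topologicalClosure = ⊤)
    {f g : HilbertTensor H K →L[ℂ] L} (h : ∀ i j, f (hTmul (v i) (w j)) = g (hTmul (v i) (w j))) :
    f = g :=
  ContinuousLinearMap.ext_on
    ((Submodule.dense_iff_topologicalClosure_eq_top).2 (hTmul_total hv hw)) (by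
      rintro _ ⟨⟨i, j⟩, rfl⟩
      exact h i j)

theorem expVec_ext {f g : Fock K →L[ℂ] L} (h : ∀ u, f (expVec u) = g (expVec u)) : f = g :=
  ContinuousLinearMap.ext_on ((Submodule.dense_iff_topologicalClosure_eq_top).2 expVec_total) (by
    rintro _ ⟨u, rfl⟩
    exact h u)

/-- The distance between two exponential vectors is a continuous expression in the kernel `exp ⟪f,
g⟫`. -/
theorem continuous_expVec : Continuous (expVec : K → Fock K) := by
  rw [continuous_iff_continuousAt]
  intro f
  rw [ContinuousAt, tendsto_iff_norm_sub_tendsto_zero]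
  have h : ∀ g : K, ‖expVec g - expVec f‖ = Real.sqrt (RCLike.re (Complex.exp ⟪g, g⟫_ℂ -
      Complex.exp ⟪g, f⟫_ℂ - (Complex.exp ⟪f, g⟫_ℂ - Complex.exp ⟪f, f⟫_ℂ))) := by
    intro g
    rw [@norm_eq_sqrt_re_inner ℂ, inner_sub_left, inner_sub_right, inner_sub_right, inner_expVec,
      inner_expVec, inner_expVec, inner_expVec]
  simp only [h]
  have hc : Continuous fun g : K => Real.sqrt (RCLike.re (Complex.exp ⟪g, g⟫_ℂ -
      Complex.exp ⟪g, f⟫_ℂ - (Complex.exp ⟪f, g⟫_ℂ - Complex.exp ⟪f, f⟫_ℂ))) := by fun_prop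
  refine (hc.tendsto f).trans (le_of_eq ?_)
  simp

theorem norm_expVec_zero : ‖expVec (0 : K)‖ = 1 := by
  rw [@norm_eq_sqrt_re_inner ℂ, inner_expVec, inner_zero_left, Complex.exp_zero]
  simp

end Compression

/-! ### Bounded adapted operators as ampliations -/

section Adapted

variable {k : Type*} [NormedAddCommGroup k] [InnerProductSpace ℂ k]

variable (k) in
/-- The embedding `v ↦ v ⊗ ε(0)` of `ℱ_{[0,s[}` in `ℱ`. -/
def fockEmbed (s : ℝ≥0) : Fock (L2on k (Set.Ico 0 (s : ℝ))) →L[ℂ] FockSpace k :=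
  (fockSplit k s).toContinuousLinearMap ∘L hTmulRight _ (expVec 0)

theorem fockEmbed_apply (s : ℝ≥0) (v : Fock (L2on k (Set.Ico 0 (s : ℝ)))) :
    fockEmbed k s v = fockSplit k s (hTmul v (expVec 0)) := rfl

theorem adjoint_fockEmbed_apply (s : ℝ≥0) (v : Fock (L2on k (Set.Ico 0 (s : ℝ)))) :
    ContinuousLinearMap.adjoint (fockEmbed k s) (fockEmbed k s v) = v := by
  refine ext_inner_right ℂ fun w => ?_
  rw [ContinuousLinearMap.adjoint_inner_left, fockEmbed_apply, fockEmbed_apply,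
    LinearIsometry.inner_map_map, inner_hTmul, inner_self_eq_norm_sq_to_K, norm_expVec_zero]
  simp

/-- The compression of a bounded operator on `ℱ` to `ℱ_{[0,s[}`. -/
def fockCompress (s : ℝ≥0) (T : FockSpace k →L[ℂ] FockSpace k) :
    Fock (L2on k (Set.Ico 0 (s : ℝ))) →L[ℂ] Fock (L2on k (Set.Ico 0 (s : ℝ))) :=
  ContinuousLinearMap.adjoint (fockEmbed k s) ∘L T ∘L fockEmbed k s

theorem fockSplit_hTmul_expVec (s : ℝ≥0) (f : L2on k (Set.Ico 0 (s : ℝ)))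
    (g : L2on k (Set.Ici (s : ℝ))) :
    fockSplit k s (hTmul (expVec f) (expVec g)) = expVec
      (L2on.incl (show Set.Ico (0 : ℝ) s ⊆ Set.Ici 0 from Set.Ico_subset_Ici_self) f +
        L2on.incl (Set.Ici_subset_Ici.2 (show (0 : ℝ) ≤ s from s.2)) g) :=
  fockJoin_apply _ _ _ f g

theorem fockSplit_expVec (s : ℝ≥0) (f : Lp k 2 (volume : Measure ℝ)) :
    fockSplit k s (hTmul (expVec (L2on.restrict measurableSet_Ico f))
      (expVec (L2on.restrict measurableSet_Ici f))) =
      expVec (L2on.restrict measurableSet_Ici f) := by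
  rw [fockSplit_hTmul_expVec, L2on.incl_restrict_add]

/-- A bounded operator on `ℱ` that is adapted at time `s` on the step functions acts on exponential
vectors through its compression to `ℱ_{[0,s[}`. -/
theorem apply_expVec_of_adapted_of_mem {s : ℝ≥0} {T : FockSpace k →L[ℂ] FockSpace k}
    {Y : expDomain (k := k) (measurableSet_Ico (a := (0 : ℝ)) (b := (s : ℝ))) →ₗ[ℂ]
        Fock (L2on k (Set.Ico 0 (s : ℝ)))}
    (hY : ∀ f : stepSpan k, T (expVec (L2on.restrict measurableSet_Ici (f : Lp k 2 volume))) =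
        fockSplit k s (hTmul (Y (expDomain.mk k measurableSet_Ico f))
          (expVec (L2on.restrict measurableSet_Ici (f : Lp k 2 volume)))))
    {f : Lp k 2 (volume : Measure ℝ)} (hf : f ∈ stepSpan k) :
    T (expVec (L2on.restrict measurableSet_Ici f)) =
      fockSplit k s (hTmul (fockCompress s T (expVec (L2on.restrict measurableSet_Ico f)))
        (expVec (L2on.restrict measurableSet_Ici f))) := by
  -- The truncation `g` has the same past as `f` and a zero future, so adaptedness at `g` reads `T
  -- (u ⊗ ε(0)) = Y u ⊗ ε(0)`. This identifies `Y u` with the compression of `T`.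
  obtain ⟨g, hg, h1, h2⟩ := exists_mem_stepSpan_truncation s hf
  have hm : expDomain.mk k (measurableSet_Ico (a := (0 : ℝ)) (b := (s : ℝ))) ⟨g, hg⟩ =
      expDomain.mk k measurableSet_Ico ⟨f, hf⟩ := Subtype.ext (congrArg expVec h1)
  have h3 : fockCompress s T (expVec (L2on.restrict measurableSet_Ico f)) =
      Y (expDomain.mk k measurableSet_Ico ⟨f, hf⟩) := by
    have h4 := fockSplit_expVec s g
    rw [h2, h1] at h4
    have h5 := hY ⟨g, hg⟩
    rw [hm, h2, ← h4, ← fockEmbed_apply, ← fockEmbed_apply] at h5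
    rw [fockCompress, ContinuousLinearMap.comp_apply, ContinuousLinearMap.comp_apply, h5,
      adjoint_fockEmbed_apply]
  rw [h3]
  exact hY ⟨f, hf⟩

theorem continuous_hTmul {X H K : Type*} [TopologicalSpace X] [NormedAddCommGroup H]
    [InnerProductSpace ℂ H] [NormedAddCommGroup K] [InnerProductSpace ℂ K] {u : X → H} {v : X → K}
    (hu : Continuous u) (hv : Continuous v) : Continuous fun x => hTmul (u x) (v x) := by
  have h : Continuous fun x => TensorProduct.mkL ℂ H K (u x) (v x) := by fun_prop
  exact HilbertTensor.ofAlg.continuous.comp h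

theorem L2on.restrict_eq_of_Ici {I : Set ℝ} (hI : MeasurableSet I) (h0 : I ⊆ Set.Ici 0)
    {f g : Lp k 2 (volume : Measure ℝ)} (h : L2on.restrict (measurableSet_Ici (a := (0 : ℝ))) f =
      L2on.restrict measurableSet_Ici g) : L2on.restrict hI f = L2on.restrict hI g := by
  refine L2on.restrict_congr hI ?_
  have h' := congrArg (fun u : L2on k (Set.Ici 0) => (u : Lp k 2 (volume : Measure ℝ))) h
  filter_upwards [L2on.coeFn_restrict (measurableSet_Ici (a := (0 : ℝ))) f,
    L2on.coeFn_restrict (measurableSet_Ici (a := (0 : ℝ))) g] with r h1 h2 hr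
  rw [h', h2, Set.indicator_of_mem (h0 hr), Set.indicator_of_mem (h0 hr)] at h1
  exact h1.symm

/-- Once the possibly unbounded `Y` has been replaced by the bounded compression, both sides are
continuous in `f`, so the identity passes from step functions to all of `L²`. -/
theorem apply_expVec_of_adapted [CompleteSpace k] {s : ℝ≥0} {T : FockSpace k →L[ℂ] FockSpace k}
    {Y : expDomain (k := k) (measurableSet_Ico (a := (0 : ℝ)) (b := (s : ℝ))) →ₗ[ℂ]
        Fock (L2on k (Set.Ico 0 (s : ℝ)))}
    (hY : ∀ f : stepSpan k, T (expVec (L2on.restrict measurableSet_Ici (f : Lp k 2 volume))) =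
        fockSplit k s (hTmul (Y (expDomain.mk k measurableSet_Ico f))
          (expVec (L2on.restrict measurableSet_Ici (f : Lp k 2 volume)))))
    (f : Lp k 2 (volume : Measure ℝ)) :
    T (expVec (L2on.restrict measurableSet_Ici f)) =
      fockSplit k s (hTmul (fockCompress s T (expVec (L2on.restrict measurableSet_Ico f)))
        (expVec (L2on.restrict measurableSet_Ici f))) := by
  refine stepSpan_induction (p := fun f => T (expVec (L2on.restrict measurableSet_Ici f)) =
      fockSplit k s (hTmul (fockCompress s T (expVec (L2on.restrict measurableSet_Ico f)))
        (expVec (L2on.restrict measurableSet_Ici f)))) ?_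
    (fun f hf => apply_expVec_of_adapted_of_mem hY hf) (fun f g h hf => ?_) f
  · have h1 : ∀ {I : Set ℝ} (hI : MeasurableSet I),
        Continuous fun f : Lp k 2 (volume : Measure ℝ) => expVec (L2on.restrict hI f) :=
      fun hI => continuous_expVec.comp (L2on.continuous_restrict hI)
    exact isClosed_eq (T.continuous.comp (h1 _)) ((fockSplit k s).continuous.comp
      (continuous_hTmul ((fockCompress s T).continuous.comp (h1 _)) (h1 _)))
  · have h1 := L2on.restrict_eq_of_Ici (measurableSet_Ico (a := (0 : ℝ)) (b := (s : ℝ)))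
      Set.Ico_subset_Ici_self h
    have h2 := L2on.restrict_eq_of_Ici (measurableSet_Ici (a := (s : ℝ)))
      (Set.Ici_subset_Ici.2 s.2) h
    rwa [h, h1, h2] at hf

/-- A bounded operator on `ℱ` that is adapted at time `s` is the ampliation of its compression to
`ℱ_{[0,s[}`. -/
theorem apply_fockSplit_of_adapted [CompleteSpace k] {s : ℝ≥0}
    {T : FockSpace k →L[ℂ] FockSpace k}
    {Y : expDomain (k := k) (measurableSet_Ico (a := (0 : ℝ)) (b := (s : ℝ))) →ₗ[ℂ]
        Fock (L2on k (Set.Ico 0 (s : ℝ)))}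
    (hY : ∀ f : stepSpan k, T (expVec (L2on.restrict measurableSet_Ici (f : Lp k 2 volume))) =
        fockSplit k s (hTmul (Y (expDomain.mk k measurableSet_Ico f))
          (expVec (L2on.restrict measurableSet_Ici (f : Lp k 2 volume)))))
    (f : L2on k (Set.Ico 0 (s : ℝ))) (g : L2on k (Set.Ici (s : ℝ))) :
    T (fockSplit k s (hTmul (expVec f) (expVec g))) =
      fockSplit k s (hTmul (fockCompress s T (expVec f)) (expVec g)) := by
  -- The sum has past `f` and future `g`, so independent exponential vectors in the two factors are
  -- reached.
  have h := apply_expVec_of_adapted hY (f + g : Lp k 2 (volume : Measure ℝ))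
  have hf : L2on.restrict (measurableSet_Ico (a := (0 : ℝ)) (b := (s : ℝ)))
      (f + g : Lp k 2 (volume : Measure ℝ)) = f := by
    rw [map_add, L2on.restrict_eq_self, L2on.restrict_eq_zero _ (disjoint_Ico_Ici _) g.2, add_zero]
  have hg : L2on.restrict (measurableSet_Ici (a := (s : ℝ)))
      (f + g : Lp k 2 (volume : Measure ℝ)) = g := by
    rw [map_add, L2on.restrict_eq_self, L2on.restrict_eq_zero _ (disjoint_Ico_Ici _).symm f.2,
      zero_add]
  rwa [← fockSplit_expVec s, hf, hg] at h

theorem fockShift_expVec (s : ℝ≥0) (f : L2on k (Set.Ico 0 (s : ℝ))) (g : L2on k (Set.Ici 0)) :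
    fockShift k s (hTmul (expVec f) (expVec g)) = expVec
      (L2on.incl (show Set.Ico (0 : ℝ) s ⊆ Set.Ici 0 from Set.Ico_subset_Ici_self) f +
        L2on.incl (Set.Ici_subset_Ici.2 (show (0 : ℝ) ≤ s from s.2)) (L2on.shift s g)) :=
  fockJoin_apply _ _ _ f g

theorem fockShift_hTmul_expVec (s : ℝ≥0) (v : Fock (L2on k (Set.Ico 0 (s : ℝ))))
    (g : L2on k (Set.Ici 0)) :
    fockShift k s (hTmul v (expVec g)) = fockSplit k s (hTmul v (expVec (L2on.shift s g))) := by
  have h : (fockShift k s).toContinuousLinearMap ∘L hTmulRight _ (expVec g) =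
      (fockSplit k s).toContinuousLinearMap ∘L hTmulRight _ (expVec (L2on.shift s g)) :=
    expVec_ext fun f => (fockShift_expVec s f g).trans
      (fockSplit_hTmul_expVec s f (L2on.shift s g)).symm
  exact DFunLike.congr_fun h v

/-- `fockShift` sends `v ⊗ ε(g)` to `v` tensored with a shifted future vector, and an adapted
operator leaves the future factor alone. -/
theorem comp_fockShift_of_adapted [CompleteSpace k] {s : ℝ≥0}
    {T : FockSpace k →L[ℂ] FockSpace k}
    {Y : expDomain (k := k) (measurableSet_Ico (a := (0 : ℝ)) (b := (s : ℝ))) →ₗ[ℂ]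
        Fock (L2on k (Set.Ico 0 (s : ℝ)))}
    (hY : ∀ f : stepSpan k, T (expVec (L2on.restrict measurableSet_Ici (f : Lp k 2 volume))) =
        fockSplit k s (hTmul (Y (expDomain.mk k measurableSet_Ico f))
          (expVec (L2on.restrict measurableSet_Ici (f : Lp k 2 volume))))) :
    T ∘L (fockShift k s).toContinuousLinearMap =
      (fockShift k s).toContinuousLinearMap ∘L
        opTensor (fockCompress s T) (ContinuousLinearMap.id ℂ (FockSpace k)) := by
  refine hTmul_ext_of_total expVec_total expVec_total fun f g => ?_
  have h1 := opTensor_hTmul (fockCompress s T) (ContinuousLinearMap.id ℂ (FockSpace k))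
    (expVec f) (expVec g)
  have h2 : T (fockShift k s (hTmul (expVec f) (expVec g))) =
      fockShift k s (hTmul (fockCompress s T (expVec f)) (expVec g)) := by
    rw [fockShift_hTmul_expVec, fockShift_hTmul_expVec]
    exact apply_fockSplit_of_adapted hY f (L2on.shift s g)
  exact h2.trans (congrArg (fockShift k s) h1.symm)

/-- The product of an operator that is adapted at time `s` and a shifted operator, as a compression
of a tensor product of operators. -/
theorem comp_ccrFlow_of_comp_fockShift {s : ℝ≥0} {T : FockSpace k →L[ℂ] FockSpace k}
    (hT : T ∘L (fockShift k s).toContinuousLinearMap =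
      (fockShift k s).toContinuousLinearMap ∘L
        opTensor (fockCompress s T) (ContinuousLinearMap.id ℂ (FockSpace k)))
    (X : FockSpace k →L[ℂ] FockSpace k) :
    T ∘L ccrFlow s X = ((fockShift k s).toContinuousLinearMap ∘L
      opTensor (ContinuousLinearMap.adjoint (fockEmbed k s))
        (ContinuousLinearMap.id ℂ (FockSpace k))) ∘L
      opTensor T X ∘L (opTensor (fockEmbed k s) (ContinuousLinearMap.id ℂ (FockSpace k)) ∘L
        ContinuousLinearMap.adjoint (fockShift k s).toContinuousLinearMap) := by
  -- With `E = fockEmbed k s` the compression is `E⋆ T E`, and `(E⋆ T E) ⊗ X = (E⋆ ⊗ 1)(T ⊗ X)(E ⊗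
  -- 1)`.
  have h : opTensor (fockCompress s T) (ContinuousLinearMap.id ℂ (FockSpace k)) ∘L
      opTensor (ContinuousLinearMap.id ℂ (Fock (L2on k (Set.Ico 0 (s : ℝ))))) X =
      opTensor (ContinuousLinearMap.adjoint (fockEmbed k s))
        (ContinuousLinearMap.id ℂ (FockSpace k)) ∘L
      opTensor T X ∘L opTensor (fockEmbed k s) (ContinuousLinearMap.id ℂ (FockSpace k)) :=
    hTmul_ext_of_total expVec_total expVec_total fun f g => by
      simp only [ContinuousLinearMap.comp_apply, opTensor_hTmul, ContinuousLinearMap.id_apply,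
        fockCompress]
  ext v
  have h1 := DFunLike.congr_fun hT (opTensor (ContinuousLinearMap.id ℂ _) X
    (ContinuousLinearMap.adjoint (fockShift k s).toContinuousLinearMap v))
  have h2 := DFunLike.congr_fun h
    (ContinuousLinearMap.adjoint (fockShift k s).toContinuousLinearMap v)
  exact h1.trans (congrArg (fockShift k s) h2)

end Adapted

/-! ### Lifting and restricting convolution cocycles -/

section Cocycles

variable {A H k : Type*} [CStarAlgebra A]
  [NormedAddCommGroup H] [InnerProductSpace ℂ H] [CompleteSpace H]
  [NormedAddCommGroup k] [InnerProductSpace ℂ k]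
  {S : StarSubalgebra ℂ A} [hS : IsClosed (S : Set A)] {P : A →L[ℂ] S}
  {π : A →⋆ₐ[ℂ] (H →L[ℂ] H)}

/-- A compression of the tensor product of two completely bounded maps is bounded for the spatial
norm. -/
theorem exists_norm_le_of_eq_comp_opTensor {B E F G : Type*} [CStarAlgebra B]
    [NormedAddCommGroup E] [InnerProductSpace ℂ E] [CompleteSpace E]
    [NormedAddCommGroup F] [InnerProductSpace ℂ F] [CompleteSpace F]
    [NormedAddCommGroup G] [NormedSpace ℂ G]
    {ρ : B →⋆ₐ[ℂ] (H →L[ℂ] H)} (hρ : Function.Injective ρ)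
    {φ : B →ₗ[ℂ] (E →L[ℂ] E)} {ψ : B →ₗ[ℂ] (F →L[ℂ] F)}
    (hφ : IsCompletelyBounded φ) (hψ : IsCompletelyBounded ψ)
    (U : HilbertTensor E F →L[ℂ] G) (V : G →L[ℂ] HilbertTensor E F)
    {f : B ⊗[ℂ] B →ₗ[ℂ] (G →L[ℂ] G)}
    (hf : ∀ a b, f (a ⊗ₜ b) = U ∘L opTensor (φ a) (ψ b) ∘L V) :
    ∃ c, 0 ≤ c ∧ ∀ y, ‖f y‖ ≤ c * ‖spatialTensor.ofAlg ρ ρ y‖ := by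
  let σ := StarAlgHom.id ℂ (E →L[ℂ] E)
  let τ := StarAlgHom.id ℂ (F →L[ℂ] F)
  obtain ⟨c, hc0, hc⟩ := spatialTensor.exists_norm_ofAlg_map_le hρ hρ σ τ hφ hψ
  have hUV : ∀ y, f y = U ∘L (spatialTensor.ofAlg σ τ (TensorProduct.map φ ψ y) :
      HilbertTensor E F →L[ℂ] HilbertTensor E F) ∘L V := by
    intro y
    induction y using TensorProduct.induction_on with
    | zero => simp
    | add x y hx hy =>
      rw [map_add, hx, hy, map_add, map_add, AddMemClass.coe_add, ContinuousLinearMap.add_comp,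
        ContinuousLinearMap.comp_add]
    | tmul a b => exact hf a b
  refine ⟨‖U‖ * c * ‖V‖, by positivity, fun y => ?_⟩
  rw [hUV]
  calc _ ≤ ‖U‖ * (‖spatialTensor.ofAlg σ τ (TensorProduct.map φ ψ y)‖ * ‖V‖) :=
        (ContinuousLinearMap.opNorm_comp_le _ _).trans (mul_le_mul_of_nonneg_left
          (ContinuousLinearMap.opNorm_comp_le _ _) (norm_nonneg _))
    _ ≤ ‖U‖ * ((c * ‖spatialTensor.ofAlg ρ ρ y‖) * ‖V‖) := by
        gcongr
        exact hc y
    _ = _ := by ring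

/-- The map `l_s ⊗ (σ_s ∘ l_t)` is bounded for the spatial norm. -/
theorem IsCBProcess.exists_norm_increment_le [CompleteSpace k] {B : Type*} [CStarAlgebra B]
    {ρ : B →⋆ₐ[ℂ] (H →L[ℂ] H)} (hρ : Function.Injective ρ)
    {l : ℝ≥0 → B →ₗ[ℂ] (FockSpace k →L[ℂ] FockSpace k)} (hl : IsCBProcess l) (s t : ℝ≥0)
    {f : B ⊗[ℂ] B →ₗ[ℂ] (FockSpace k →L[ℂ] FockSpace k)}
    (hf : ∀ a b, f (a ⊗ₜ b) = l s a ∘L ccrFlow s (l t b)) :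
    ∃ c, 0 ≤ c ∧ ∀ y, ‖f y‖ ≤ c * ‖spatialTensor.ofAlg ρ ρ y‖ := by
  -- The outer operators depend only on `s`, so the bound for `l_s ⊗ l_t` passes to `l_s ⊗ (σ_s ∘
  -- l_t)`.
  refine exists_norm_le_of_eq_comp_opTensor hρ (hl.completelyBounded s) (hl.completelyBounded t)
    ((fockShift k s).toContinuousLinearMap ∘L
      opTensor (ContinuousLinearMap.adjoint (fockEmbed k s))
        (ContinuousLinearMap.id ℂ (FockSpace k)))
    (opTensor (fockEmbed k s) (ContinuousLinearMap.id ℂ (FockSpace k)) ∘L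
      ContinuousLinearMap.adjoint (fockShift k s).toContinuousLinearMap) fun a b => ?_
  obtain ⟨Y, hY⟩ := (hl.isOperatorProcess a).adapted s
  exact (hf a b).trans (comp_ccrFlow_of_comp_fockShift (comp_fockShift_of_adapted hY) (l t b))

/-- Since `P ⊗ P` is contractive, a bound for `g` is also one for `f`. Both extensions are then
genuine and agree on elementary tensors. -/
theorem extend_comp_expectation {V : Type*} [NormedAddCommGroup V] [NormedSpace ℂ V]
    [CompleteSpace V] (hπ : Function.Injective π) (hP : IsConditionalExpectation S P)
    {f : A ⊗[ℂ] A →ₗ[ℂ] V} {g : S ⊗[ℂ] S →ₗ[ℂ] V}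
    (hfg : ∀ x, f x = g (TensorProduct.map P.toLinearMap P.toLinearMap x))
    (hg : ∃ c, 0 ≤ c ∧ ∀ y, ‖g y‖ ≤
      c * ‖spatialTensor.ofAlg (restrictRep S π) (restrictRep S π) y‖)
    (x : spatialTensor π π) :
    spatialTensor.extend π π f x =
      spatialTensor.extend (restrictRep S π) (restrictRep S π) g (expectationTensor P π x) := by
  obtain ⟨c, hc0, hc⟩ := hg
  have hf : ∃ c, ∀ y, ‖f y‖ ≤ c * ‖spatialTensor.ofAlg π π y‖ := by
    refine ⟨c, fun y => ?_⟩
    rw [hfg]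
    refine (hc _).trans ?_
    rw [← expectationTensor_ofAlg hπ hP]
    exact mul_le_mul_of_nonneg_left (norm_expectationTensor_le hπ hP _) hc0
  refine spatialTensor.apply_eq_of_ofAlg (f := spatialTensor.extend π π f)
    (g := spatialTensor.extend (restrictRep S π) (restrictRep S π) g ∘L expectationTensor P π)
    (fun a b => ?_) x
  have h := spatialTensor.extend_ofAlg ⟨c, hc⟩
    (TensorProduct.map P.toLinearMap P.toLinearMap (a ⊗ₜ[ℂ] b))
  rw [← expectationTensor_ofAlg hπ hP, ← hfg] at h
  exact (spatialTensor.extend_ofAlg hf (a ⊗ₜ[ℂ] b)).trans h.symm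

theorem incrementTensor_comp_expectation [CompleteSpace k] (hπ : Function.Injective π)
    (hP : IsConditionalExpectation S P)
    {l : ℝ≥0 → S →ₗ[ℂ] (FockSpace k →L[ℂ] FockSpace k)} (hl : IsCBProcess l) (s t : ℝ≥0)
    (x : spatialTensor π π) :
    incrementTensor π (fun t => l t ∘ₗ P.toLinearMap) s t x =
      incrementTensor (restrictRep S π) l s t (expectationTensor P π x) := by
  refine extend_comp_expectation hπ hP (fun x => ?_)
    (hl.exists_norm_increment_le (fun a b h => Subtype.ext (hπ h)) s t fun a b => ?_) x
  swap; · rfl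
  induction x using TensorProduct.induction_on with
  | zero => simp only [map_zero]
  | add x y hx hy => simp only [map_add, hx, hy]
  | tmul a b => rfl

/-- Measurability and adaptedness are conditions on each element separately, so only complete
boundedness concerns `φ`. -/
theorem isCBProcess_comp {B : Type*} [CStarAlgebra B] {φ : A →ₗ[ℂ] B}
    (hφ : IsCompletelyBounded φ) {l : ℝ≥0 → B →ₗ[ℂ] (FockSpace k →L[ℂ] FockSpace k)}
    (hl : IsCBProcess l) : IsCBProcess fun t => l t ∘ₗ φ where
  isOperatorProcess a := hl.isOperatorProcess (φ a)
  completelyBounded t := (hl.completelyBounded t).comp hφ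

end Cocycles

theorem mainTheorem6 {A H k : Type*} [CStarAlgebra A]
    [NormedAddCommGroup H] [InnerProductSpace ℂ H] [CompleteSpace H]
    [NormedAddCommGroup k] [InnerProductSpace ℂ k] [CompleteSpace k]
    (π : A →⋆ₐ[ℂ] (H →L[ℂ] H)) (hπ : Function.Injective π)
    (Δ : A →ₗ[ℂ] spatialTensor π π) (ε : A →⋆ₐ[ℂ] ℂ) (hA : IsCStarHyperbialgebra π Δ ε)
    (S : StarSubalgebra ℂ A) [hS : IsClosed (S : Set A)]
    (P : A →L[ℂ] S) (hP : IsConditionalExpectation S P) (hPΔ : IsCompatibleExpectation S π Δ P) :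
    IsCStarHyperbialgebra (restrictRep S π) (restrictCoproduct S π Δ P) (restrictCounit S ε) ∧
    Set.BijOn
      (fun (l' : ℝ≥0 → S →ₗ[ℂ] (FockSpace k →L[ℂ] FockSpace k)) (t : ℝ≥0) =>
        l' t ∘ₗ P.toLinearMap)
      {l' | IsQSConvolutionCocycle (restrictRep S π) (restrictCoproduct S π Δ P)
        (restrictCounit S ε) l'}
      {l | IsCBProcess l ∧ (∀ (t : ℝ≥0) (a : A), l t (P a) = l t a) ∧
        HasConvolutionIncrements π Δ l ∧
        ∀ a : A, l 0 a = ε (P a) • ContinuousLinearMap.id ℂ (FockSpace k)} ∧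
    Set.InvOn
      (fun (l : ℝ≥0 → A →ₗ[ℂ] (FockSpace k →L[ℂ] FockSpace k)) (t : ℝ≥0) =>
        l t ∘ₗ S.subtype.toAlgHom.toLinearMap)
      (fun (l' : ℝ≥0 → S →ₗ[ℂ] (FockSpace k →L[ℂ] FockSpace k)) (t : ℝ≥0) =>
        l' t ∘ₗ P.toLinearMap)
      {l' | IsQSConvolutionCocycle (restrictRep S π) (restrictCoproduct S π Δ P)
        (restrictCounit S ε) l'}
      {l | IsCBProcess l ∧ (∀ (t : ℝ≥0) (a : A), l t (P a) = l t a) ∧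
        HasConvolutionIncrements π Δ l ∧
        ∀ a : A, l 0 a = ε (P a) • ContinuousLinearMap.id ℂ (FockSpace k)} := by
  refine ⟨isCStarHyperbialgebra_restrict hπ hP hA hPΔ, ?_⟩
  rw [and_comm]
  -- Bijectivity follows from the two inverse identities once each map is known to land in the right
  -- set.
  refine (fun h => ⟨h, h.bijOn ?_ ?_⟩) ⟨?_, ?_⟩
  · rintro l' ⟨hproc, hincr, hinit⟩
    refine ⟨isCBProcess_comp hP.isCompletelyBounded hproc,
      fun t a => congrArg (l' t) (hP.proj (P a)), fun s t a => ?_, fun a => hinit (P a)⟩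
    -- The lifted increment at `Δ a` is that of `l'` at `(P ⊗ P) Δ a = Δ̃(P a)`, so the cocycle
    -- identity of `l'` at `P a` applies.
    rw [incrementTensor_comp_expectation hπ hP hproc,
      ← restrictCoproduct_apply_expectation hπ hP hPΔ]
    exact hincr s t (P a)
  · rintro l ⟨hproc, hinv, hincr, hinit⟩
    have hproc' := isCBProcess_comp (isCompletelyBounded_starAlgHom S.subtype) hproc
    refine ⟨hproc', fun s t a => ?_, fun a => ?_⟩
    -- By invariance `l` is the lift of its own restriction, so its increment at `Δ a` factors
    -- through `P ⊗ P`. For `a` in `S`, `(P ⊗ P) Δ a` is `Δ̃ a` by definition.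
    · have hl : (fun t => (l t ∘ₗ S.subtype.toAlgHom.toLinearMap) ∘ₗ P.toLinearMap) = l := by
        funext t
        ext a : 1
        exact hinv t a
      refine (hincr s t a).trans ?_
      refine Eq.trans ?_ (incrementTensor_comp_expectation hπ hP hproc' s t (Δ a))
      rw [hl]
    · refine (hinit a).trans ?_
      rw [hP.proj]
      rfl
  · rintro l' -
    funext t
    ext s : 1
    exact congrArg (l' t) (hP.proj s)
  · rintro l ⟨-, hl, -, -⟩
    funext t
    ext a : 1
    exact hl t a

end
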